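/- **Theorem.** Let $\Gamma$ be a locally compact Hausdorff group with left Haar measure $|\cdot|$ (a Radon measure), let $X$ be a probability space, let $L^p(X)$ denote real- or complex-valued functions, and let $G$ be a nilpotent group of unitary operators on $L^2(X)$ that act as isometric algebra homomorphisms on $L^\infty(X)$. A map $g\colon\Gamma\to G$ is *measurable* if for every $f\in L^2(X)$ the map $m\mapsto g(m)f\in L^2(X)$ is strongly measurable on every compact subset of $\Gamma$ (up to a null set). For $b\in\Gamma$ put $D_b g(n)=g(n)^{-1}g(nb)$; $g$ is a *right polynomial* if there is $d\in\mathbb N$ such that $D_{b_1}\cdots D_{b_{d+1}}g\equiv 1_G$ for all $b_1,\dots,b_{d+1}\in\Gamma$. A *Følner net* in $\Gamma$ is a net $(F_\alpha)_{\alpha\in A}$, indexed by a nonempty directed set, of nonempty compact subsets of $\Gamma$ with $|F_\alpha|>0$ such that for every compact $K\subset\Gamma$ $$\lim_\alpha\ \sup_{l\in K}\frac{|lF_\alpha\,\triangle\,F_\alpha|}{|F_\alpha|}=0 .$$ Let $g_1,\dots,g_j\colon\Gamma\to G$ be measurable right polynomial maps and let $f_1,\dots,f_j\in L^\infty(X)$.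 Then there is a function $L\in L^2(X)$ such that for every Følner net $(F_\alpha)_{\alpha\in A}$ in $\Gamma$ the map $m\mapsto g_1(m)f_1\cdots g_j(m)f_j\in L^2(X)$ (the pointwise product of the functions $g_i(m)f_i$) is Bochner integrable over each $F_\alpha$, and $$\lim_{\alpha}\ \frac1{|F_\alpha|}\int_{m\in F_\alpha} g_1(m)f_1\cdots g_j(m)f_j = L\quad\text{in }L^2(X).$$ That is, the limit exists and is independent of the Følner net. -/

import Mathlib

open MeasureTheory Filter
open scoped ENNReal Topology Pointwise

/-- The right derivative `D_b g (n) = g(n)⁻¹ g(n b)` of a map between groups. -/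
def rightDeriv {Γ H : Type*} [Group Γ] [Group H] (b : Γ) (g : Γ → H) : Γ → H :=
  fun n => (g n)⁻¹ * g (n * b)

/-- `g` is a right polynomial map: for some `d` (its scalar degree is then at most `d`), all
iterated right derivatives `D_{b₁} ⋯ D_{b_{d+1}} g` of order `d + 1` are identically `1`. -/
def IsRightPolynomial {Γ H : Type*} [Group Γ] [Group H] (g : Γ → H) : Prop :=
  ∃ d : ℕ, ∀ bs : List Γ, bs.length = d + 1 → ∀ n : Γ, bs.foldr rightDeriv g n = 1

/-- A Følner net for the left Haar measure `μ`: a net of nonempty compact sets of positive measure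
(so that averages over them make sense) such that
`sup_{l ∈ K} |l F_α ∆ F_α| / |F_α| → 0` for every compact set `K`. -/
structure IsFolnerNet {Γ : Type*} [Group Γ] [TopologicalSpace Γ] [MeasurableSpace Γ]
    (μ : Measure Γ) {ι : Type*} [Preorder ι] (F : ι → Set Γ) : Prop where
  nonempty : ∀ α, (F α).Nonempty
  isCompact : ∀ α, IsCompact (F α)
  measure_pos : ∀ α, 0 < μ (F α)
  tendsto_symmDiff : ∀ K : Set Γ, IsCompact K →
    Tendsto (fun α => ⨆ l ∈ K, μ (symmDiff (l • F α) (F α)) / μ (F α)) atTop (𝓝 0)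

section LInfty

variable {X : Type*} [MeasurableSpace X] {ν : Measure X} {𝕜 : Type*} [RCLike 𝕜]

/-- An element of `L²` which belongs to `L^∞`. -/
def IsEssBounded (f : Lp 𝕜 2 ν) : Prop := (f : X →ₘ[ν] 𝕜) ∈ Lp 𝕜 ∞ ν

/-- The unitary operator `U` of `L²` restricts to an isometric algebra homomorphism of `L^∞`
(linearity being already part of `U`). -/
structure ActsOnLInfty (U : Lp 𝕜 2 ν ≃ₗᵢ[𝕜] Lp 𝕜 2 ν) : Prop where
  isEssBounded : ∀ f : Lp 𝕜 2 ν, IsEssBounded f → IsEssBounded (U f)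
  isometric : ∀ f : Lp 𝕜 2 ν, IsEssBounded f → eLpNorm (U f) ∞ ν = eLpNorm f ∞ ν
  map_mul : ∀ f₁ f₂ f : Lp 𝕜 2 ν, IsEssBounded f₁ → IsEssBounded f₂ →
    (f : X →ₘ[ν] 𝕜) = (f₁ : X →ₘ[ν] 𝕜) * (f₂ : X →ₘ[ν] 𝕜) →
      (U f : X →ₘ[ν] 𝕜) = (U f₁ : X →ₘ[ν] 𝕜) * (U f₂ : X →ₘ[ν] 𝕜)

theorem prod_mem_LInfty [IsFiniteMeasure ν] {κ : Type*} (s : Finset κ) (u : κ → (X →ₘ[ν] 𝕜))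
    (hu : ∀ i, u i ∈ Lp 𝕜 ∞ ν) : (∏ i ∈ s, u i) ∈ Lp 𝕜 ∞ ν := by
  classical
  induction s using Finset.induction_on with
  | empty =>
    rw [Finset.prod_empty, Lp.mem_Lp_iff_memLp]
    exact (memLp_congr_ae AEEqFun.coeFn_one).2 (memLp_const (1 : 𝕜))
  | insert a s ha ih =>
    rw [Finset.prod_insert ha, Lp.mem_Lp_iff_memLp]
    exact (memLp_congr_ae (AEEqFun.coeFn_mul _ _)).2
      (MemLp.mul (Lp.mem_Lp_iff_memLp.1 ih) (Lp.mem_Lp_iff_memLp.1 (hu a)))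

/-- The (a.e. pointwise) product of finitely many essentially bounded functions, as an element
of `L²`. -/
def boundedProd [IsFiniteMeasure ν] {j : ℕ} (u : Fin j → Lp 𝕜 2 ν)
    (hu : ∀ i, IsEssBounded (u i)) : Lp 𝕜 2 ν :=
  ⟨∏ i, (u i : X →ₘ[ν] 𝕜), Lp.antitone le_top (prod_mem_LInfty _ _ hu)⟩

end LInfty

/-- Measurability of an operator-valued map `g` on a locally compact group with Haar measure `μ`,
with respect to the strong operator topology: every orbit map `m ↦ g(m) f` is
`μ`-measurable, as a map into `L²`, on every compact set. -/
def IsMeasurableOperatorMap {Γ : Type*} [TopologicalSpace Γ] [MeasurableSpace Γ] (μ : Measure Γ)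
    {X : Type*} [MeasurableSpace X] {ν : Measure X} {𝕜 : Type*} [RCLike 𝕜]
    (g : Γ → (Lp 𝕜 2 ν ≃ₗᵢ[𝕜] Lp 𝕜 2 ν)) : Prop :=
  ∀ f : Lp 𝕜 2 ν, ∀ K : Set Γ, IsCompact K →
    AEStronglyMeasurable (fun m => g m f) (μ.restrict K)

/-! The limit is taken along `folner μ`, the filter of asymptotic left invariance on compact sets of
positive measure. Every Følner net tends to it, so one limit along this filter serves all nets.
Since L² is complete, it suffices that the averages are Cauchy. This is proved by Walsh's
energy-increment scheme, as an induction over systems of polynomial maps.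

Single out a map p of the system, let W be the product of the other factors and A_F v the average of
W(n) p(n) v over F. With σ = A_F* A_F v one has ⟨v, σ⟩ = ‖A_F v‖². So as long as the averages of v
are not small, subtracting a multiple of σ lowers ‖v‖² by a fixed amount
(`limit_norm_sub_structured_le`), and after boundedly many steps only small averages remain
(`energy_increment`). For the subtracted σ, invariance of F turns A_{F'} σ into an average over m ∈
F of averages over l ∈ F' of W(l) p(l) p(lm)⁻¹ (W̄(lm) h), where h does not depend on l
(`weightedAvg_dualAvg`). These are averages of the system `redFinset`. Its new maps p(l) p(lm)⁻¹
i(lm) equal i(l) D_m(p⁻¹i)(l), so they perturb some i ≠ p by a map of higher degree than p⁻¹i.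
Polynomial maps of each filtered degree form a group (`polyClosed_zero`), so cosets can be counted
degree by degree, and these counts drop lexicographically (`exists_complexity_lt`).

Here σ depends on F, and the reduced system on m, so the induction hypothesis must be uniform in
such parameters. Maps and functions therefore depend on a point of a space Ω, and convergence is
tested by a `Mean` on Ω. The parameter F is adjoined by an ultrafilter limit and m by averaging over
F, which takes the place of quantitative bounds. Means act on bounded continuous functions. This is
legitimate because measurable polynomial maps are strongly continuous
(`continuous_of_isRightPolynomial`). -/

set_option linter.unusedSectionVars false

/-! ### Polynomial maps into a filtered group form groups -/

section PolynomialMaps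

variable {Γ H : Type*} [Group Γ] [Group H]

/-- A decreasing sequence of subgroups with `[F i, F j] ≤ F (i + j)` and `F N = 1`. -/
structure IsCommFiltration (F : ℕ → Subgroup H) (N : ℕ) : Prop where
  anti : Antitone F
  comm : ∀ i j, ∀ x ∈ F i, ∀ y ∈ F j, x⁻¹ * y⁻¹ * x * y ∈ F (i + j)
  conj : ∀ i, ∀ x ∈ F i, ∀ y, y * x * y⁻¹ ∈ F i
  bot : F N = ⊥

/-- Polynomial maps of filtered degree: `D_{b₁} ⋯ D_{b_k} g` takes values in `F (t + k)`. -/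
def PolyMap (F : ℕ → Subgroup H) (t : ℕ) : Set (Γ → H) :=
  {g | ∀ (bs : List Γ) (n : Γ), bs.foldr rightDeriv g n ∈ F (t + bs.length)}

variable {F : ℕ → Subgroup H} {N : ℕ}

theorem mem_polyMap_iff {t : ℕ} {g : Γ → H} :
    g ∈ PolyMap F t ↔ (∀ n, g n ∈ F t) ∧ ∀ b, rightDeriv b g ∈ PolyMap F (t + 1) := by
  constructor
  · intro h
    refine ⟨fun n => by simpa using h [] n, fun b bs n => ?_⟩
    have := h (bs ++ [b]) n
    rw [List.foldr_append] at this
    simpa [Nat.add_assoc, Nat.add_comm 1] using this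
  · rintro ⟨h0, h1⟩ bs n
    rcases List.eq_nil_or_concat bs with rfl | ⟨cs, b, rfl⟩
    · simpa using h0 n
    · rw [List.concat_eq_append, List.foldr_append]
      simpa [Nat.add_assoc, Nat.add_comm 1] using h1 b cs n

theorem polyMap_one_mem (t : ℕ) : (1 : Γ → H) ∈ PolyMap F t := by
  intro bs n
  have : bs.foldr rightDeriv (1 : Γ → H) = 1 := by
    induction bs with
    | nil => rfl
    | cons b bs ih => rw [List.foldr_cons, ih]; ext n; simp [rightDeriv]
  rw [this]; exact one_mem _

theorem polyMap_anti (hF : Antitone F) {s t : ℕ} (h : s ≤ t) {g : Γ → H}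
    (hg : g ∈ PolyMap F t) : g ∈ PolyMap F s :=
  fun bs n => hF (by omega) (hg bs n)

theorem polyMap_eq_one (hF : IsCommFiltration F N) {t : ℕ} (ht : N ≤ t) {g : Γ → H}
    (hg : g ∈ PolyMap F t) : g = 1 := by
  ext n
  have := hF.anti ht ((mem_polyMap_iff.1 hg).1 n)
  rw [hF.bot] at this
  exact this

/-- Descending induction to show that a family of predicates is contained in `PolyMap`. -/
theorem polyMap_of_descending (hF : IsCommFiltration F N) (P : ℕ → (Γ → H) → Prop) (k : ℕ)
    (hval : ∀ t, k ≤ t → ∀ g, P t g → ∀ n, g n ∈ F t)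
    (hder : ∀ t, k ≤ t → (∀ s, t < s → ∀ g, P s g → g ∈ PolyMap F s) →
      ∀ g, P t g → ∀ b, rightDeriv b g ∈ PolyMap F (t + 1)) :
    ∀ t, k ≤ t → ∀ g, P t g → g ∈ PolyMap F t := by
  have key : ∀ m t, k ≤ t → N ≤ t + m → ∀ g, P t g → g ∈ PolyMap F t := by
    intro m
    induction m with
    | zero =>
      intro t hk hN g hg
      have : g = 1 := by
        ext n
        have := hF.anti hN (by simpa using hval t hk g hg n)
        rw [hF.bot] at this
        exact this
      rw [this]; exact polyMap_one_mem t
    | succ m ih =>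
      intro t hk hN g hg
      exact mem_polyMap_iff.2 ⟨hval t hk g hg, hder t hk
        (fun s hs => ih s (by omega) (by omega)) g hg⟩
  exact fun t hk => key N t hk (by omega)

/-- The group property and the commutator relations, for indices at least `k`. -/
structure PolyClosed (Γ : Type*) [Group Γ] (F : ℕ → Subgroup H) (k : ℕ) : Prop where
  mul : ∀ t, k ≤ t → ∀ g h : Γ → H, g ∈ PolyMap F t → h ∈ PolyMap F t → g * h ∈ PolyMap F t
  inv : ∀ t, k ≤ t → ∀ g : Γ → H, g ∈ PolyMap F t → g⁻¹ ∈ PolyMap F t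
  comm : ∀ t u, k ≤ t → k ≤ u → ∀ g h : Γ → H, g ∈ PolyMap F t → h ∈ PolyMap F u →
    g⁻¹ * h⁻¹ * g * h ∈ PolyMap F (t + u)

/-- With g' = D_b g and n' = D_b n, the derivative of g n g⁻¹ is again a conjugate by g, of [n,
g'⁻¹] n' [n', g'⁻¹]. As g' has degree k + 1, the relations already known put this element in degree
t + 1, and descending induction applies. -/
theorem PolyClosed.conj_left (hF : IsCommFiltration F N) {k : ℕ} (hk : PolyClosed Γ F (k + 1)) :
    ∀ t, k + 1 ≤ t → ∀ z : Γ → H, (∃ g n : Γ → H, g ∈ PolyMap F k ∧ n ∈ PolyMap F t ∧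
      z = g * n * g⁻¹) → z ∈ PolyMap F t := by
  refine polyMap_of_descending hF (fun t z => ∃ g n : Γ → H, g ∈ PolyMap F k ∧ n ∈ PolyMap F t ∧
      z = g * n * g⁻¹) (k + 1) ?_ ?_
  · rintro t ht z ⟨g, n, hg, hn, rfl⟩ m
    exact hF.conj t _ ((mem_polyMap_iff.1 hn).1 m) _
  · rintro t ht ih z ⟨g, n, hg, hn, rfl⟩ b
    have hg' := (mem_polyMap_iff.1 hg).2 b
    have hn' := (mem_polyMap_iff.1 hn).2 b
    refine ih (t + 1) (by omega) _ ⟨g, n⁻¹ * rightDeriv b g * n * rightDeriv b n *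
      (rightDeriv b g)⁻¹, hg, ?_, ?_⟩
    · have e : n⁻¹ * rightDeriv b g * n * rightDeriv b n * (rightDeriv b g)⁻¹ =
          (n⁻¹ * (rightDeriv b g)⁻¹⁻¹ * n * (rightDeriv b g)⁻¹) *
          (rightDeriv b n * ((rightDeriv b n)⁻¹ * (rightDeriv b g)⁻¹⁻¹ * rightDeriv b n *
            (rightDeriv b g)⁻¹)) := by group
      rw [e]
      have hgi := hk.inv _ le_rfl _ hg'
      refine hk.mul _ (by omega) _ _ ?_ (hk.mul _ (by omega) _ _ hn' ?_)
      · exact polyMap_anti hF.anti (by omega) (hk.comm _ _ ht le_rfl _ _ hn hgi)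
      · exact polyMap_anti hF.anti (by omega) (hk.comm _ _ (by omega) le_rfl _ _ hn' hgi)
    · ext m
      simp only [rightDeriv, Pi.mul_apply, Pi.inv_apply]
      group

/-- `inv` is not yet available at level k, so this is not a case of `conj_left`. That lemma enters
through c = g g' g⁻¹, which has degree k + 1. -/
theorem PolyClosed.conj_right (hF : IsCommFiltration F N) {k : ℕ} (hk : PolyClosed Γ F (k + 1)) :
    ∀ t, k + 1 ≤ t → ∀ z : Γ → H, (∃ g n : Γ → H, g ∈ PolyMap F k ∧ n ∈ PolyMap F t ∧
      z = g⁻¹ * n * g) → z ∈ PolyMap F t := by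
  refine polyMap_of_descending hF (fun t z => ∃ g n : Γ → H, g ∈ PolyMap F k ∧ n ∈ PolyMap F t ∧
      z = g⁻¹ * n * g) (k + 1) ?_ ?_
  · rintro t ht z ⟨g, n, hg, hn, rfl⟩ m
    simpa using hF.conj t _ ((mem_polyMap_iff.1 hn).1 m) (g m)⁻¹
  · rintro t ht ih z ⟨g, n, hg, hn, rfl⟩ b
    have hg' := (mem_polyMap_iff.1 hg).2 b
    have hn' := (mem_polyMap_iff.1 hn).2 b
    have hc : g * rightDeriv b g * g⁻¹ ∈ PolyMap F (k + 1) :=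
      hk.conj_left hF _ le_rfl _ ⟨g, _, hg, hg', rfl⟩
    set c := g * rightDeriv b g * g⁻¹ with hcdef
    refine ih (t + 1) (by omega) _ ⟨g, n⁻¹ * c⁻¹ * n * rightDeriv b n * c, hg, ?_, ?_⟩
    · have e : n⁻¹ * c⁻¹ * n * rightDeriv b n * c = (n⁻¹ * c⁻¹ * n * c) *
          (rightDeriv b n * ((rightDeriv b n)⁻¹ * c⁻¹ * rightDeriv b n * c)) := by group
      rw [e]
      refine hk.mul _ (by omega) _ _ ?_ (hk.mul _ (by omega) _ _ hn' ?_)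
      · exact polyMap_anti hF.anti (by omega) (hk.comm _ _ ht le_rfl _ _ hn hc)
      · exact polyMap_anti hF.anti (by omega) (hk.comm _ _ (by omega) le_rfl _ _ hn' hc)
    · ext m
      simp only [hcdef, rightDeriv, Pi.mul_apply, Pi.inv_apply]
      group

/-- Derivatives of products and inverses are products of derivatives up to conjugation by maps of
degree k, and the two conjugation lemmas handle that. Commutators follow by descending induction on
the total degree t + u. -/
theorem PolyClosed.of_succ (hF : IsCommFiltration F N) {k : ℕ} (hk : PolyClosed Γ F (k + 1)) :
    PolyClosed Γ F k := by
  have cl := fun t (ht : k + 1 ≤ t) (g n : Γ → H) hg hn =>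
    hk.conj_left hF t ht _ ⟨g, n, hg, hn, rfl⟩
  have cr := fun t (ht : k + 1 ≤ t) (g n : Γ → H) hg hn =>
    hk.conj_right hF t ht _ ⟨g, n, hg, hn, rfl⟩
  have hmul : ∀ t, k ≤ t → ∀ g h : Γ → H, g ∈ PolyMap F t → h ∈ PolyMap F t →
      g * h ∈ PolyMap F t := by
    intro t ht g h hg hh
    refine mem_polyMap_iff.2 ⟨fun n => mul_mem ((mem_polyMap_iff.1 hg).1 n)
      ((mem_polyMap_iff.1 hh).1 n), fun b => ?_⟩
    have e : rightDeriv b (g * h) = (h⁻¹ * rightDeriv b g * h) * rightDeriv b h := by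
      ext n; simp only [rightDeriv, Pi.mul_apply, Pi.inv_apply]; group
    rw [e]
    exact hk.mul _ (by omega) _ _ (cr _ (by omega) _ _ (polyMap_anti hF.anti ht hh)
      ((mem_polyMap_iff.1 hg).2 b)) ((mem_polyMap_iff.1 hh).2 b)
  have hinv : ∀ t, k ≤ t → ∀ g : Γ → H, g ∈ PolyMap F t → g⁻¹ ∈ PolyMap F t := by
    intro t ht g hg
    refine mem_polyMap_iff.2 ⟨fun n => inv_mem ((mem_polyMap_iff.1 hg).1 n), fun b => ?_⟩
    have e : rightDeriv b g⁻¹ = g * (rightDeriv b g)⁻¹ * g⁻¹ := by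
      ext n; simp only [rightDeriv, Pi.mul_apply, Pi.inv_apply]; group
    rw [e]
    exact cl _ (by omega) _ _ (polyMap_anti hF.anti ht hg)
      (hk.inv _ (by omega) _ ((mem_polyMap_iff.1 hg).2 b))
  have hcr : ∀ t, k ≤ t → ∀ g n : Γ → H, g ∈ PolyMap F k → n ∈ PolyMap F t →
      g⁻¹ * n * g ∈ PolyMap F t := by
    intro t ht g n hg hn
    rcases ht.eq_or_lt with rfl | ht
    · exact hmul _ le_rfl _ _ (hmul _ le_rfl _ _ (hinv _ le_rfl _ hg) hn) hg
    · exact cr t ht g n hg hn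
  refine ⟨hmul, hinv, ?_⟩
  have key : ∀ T, 2 * k ≤ T → ∀ z : Γ → H, (∃ t u, k ≤ t ∧ k ≤ u ∧ t + u = T ∧ ∃ g h : Γ → H,
      g ∈ PolyMap F t ∧ h ∈ PolyMap F u ∧ z = g⁻¹ * h⁻¹ * g * h) → z ∈ PolyMap F T := by
    refine polyMap_of_descending hF (fun T z => ∃ t u, k ≤ t ∧ k ≤ u ∧ t + u = T ∧
      ∃ g h : Γ → H, g ∈ PolyMap F t ∧ h ∈ PolyMap F u ∧ z = g⁻¹ * h⁻¹ * g * h) (2 * k) ?_ ?_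
    · rintro T hT z ⟨t, u, ht, hu, rfl, g, h, hg, hh, rfl⟩ n
      exact hF.comm _ _ _ ((mem_polyMap_iff.1 hg).1 n) _ ((mem_polyMap_iff.1 hh).1 n)
    · rintro T hT ih z ⟨t, u, ht, hu, rfl, g, h, hg, hh, rfl⟩ b
      have hg' := (mem_polyMap_iff.1 hg).2 b
      have hh' := (mem_polyMap_iff.1 hh).2 b
      set g' := rightDeriv b g
      set h' := rightDeriv b h
      have hgk := polyMap_anti hF.anti ht hg
      have hhk := polyMap_anti hF.anti hu hh
      have hct : g⁻¹ * h⁻¹ * g * h ∈ PolyMap F t := by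
        have : g⁻¹ * h⁻¹ * g * h = g⁻¹ * (h⁻¹ * g * h) := by group
        rw [this]
        exact hmul t ht _ _ (hinv t ht _ hg) (hcr t ht _ _ hhk hg)
      have hcu : ∀ y : Γ → H, y ∈ PolyMap F u → g⁻¹ * y⁻¹ * g * y ∈ PolyMap F u := fun y hy =>
        hmul u hu _ _ (hcr u hu _ _ hgk (hinv u hu _ hy)) hy
      have hhh : h * h' ∈ PolyMap F u := hmul u hu _ _ hh (polyMap_anti hF.anti (by omega) hh')
      -- Each of the four factors is a commutator, or a conjugate of one, with total degree t + u +
      -- 1: [g, h'], [[g, h], h'], [[g, hh'], g'] and [g', hh'].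
      have e : rightDeriv b (g⁻¹ * h⁻¹ * g * h) =
          ((g⁻¹ * h⁻¹ * g * h)⁻¹ * (g⁻¹ * h'⁻¹ * g * h') * (g⁻¹ * h⁻¹ * g * h)) *
          ((g⁻¹ * h⁻¹ * g * h)⁻¹ * h'⁻¹ * (g⁻¹ * h⁻¹ * g * h) * h') *
          ((g⁻¹ * (h * h')⁻¹ * g * (h * h'))⁻¹ * g'⁻¹ * (g⁻¹ * (h * h')⁻¹ * g * (h * h')) * g') *
          (g'⁻¹ * (h * h')⁻¹ * g' * (h * h')) := by
        ext n
        simp only [g', h', rightDeriv, Pi.mul_apply, Pi.inv_apply]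
        group
      rw [e]
      have i1 := ih (t + u + 1) (by omega)
      refine hmul _ (by omega) _ _ (hmul _ (by omega) _ _ (hmul _ (by omega) _ _ ?_ ?_) ?_) ?_
      · exact hcr _ (by omega) _ _ (polyMap_anti hF.anti ht hct)
          (i1 _ ⟨t, u + 1, ht, by omega, by omega, g, h', hg, hh', rfl⟩)
      · exact i1 _ ⟨t, u + 1, ht, by omega, by omega, _, h', hct, hh', rfl⟩
      · exact i1 _ ⟨u, t + 1, hu, by omega, by omega, _, g', hcu _ hhh, hg', rfl⟩
      · exact i1 _ ⟨t + 1, u, by omega, by omega, by omega, g', _, hg', hhh, rfl⟩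
  exact fun t u ht hu g h hg hh => key (t + u) (by omega) _ ⟨t, u, ht, hu, rfl, g, h, hg, hh, rfl⟩

/-- At level N all polynomial maps are trivial; from there `of_succ` descends to level 0. -/
theorem polyClosed_zero (hF : IsCommFiltration F N) : PolyClosed Γ F 0 := by
  have top : PolyClosed Γ F N := by
    refine ⟨fun t ht g h hg hh => ?_, fun t ht g hg => ?_, fun t u ht hu g h hg hh => ?_⟩
    · rw [polyMap_eq_one hF ht hg, polyMap_eq_one hF ht hh, one_mul]; exact polyMap_one_mem t
    · rw [polyMap_eq_one hF ht hg, inv_one]; exact polyMap_one_mem t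
    · rw [polyMap_eq_one hF ht hg, polyMap_eq_one hF hu hh]
      simpa using polyMap_one_mem _
  have : ∀ m, m ≤ N → PolyClosed Γ F (N - m) := by
    intro m
    induction m with
    | zero => intro _; simpa using top
    | succ m ih =>
      intro hm
      have h := ih (by omega)
      rw [show N - m = N - (m + 1) + 1 by omega] at h
      exact h.of_succ hF
  simpa using this N le_rfl

/-- Families of polynomial maps, indexed by `Ω`. -/
def polySubgroup (hF : IsCommFiltration F N) (Γ Ω : Type*) [Group Γ] (t : ℕ) :
    Subgroup (Ω → Γ → H) where
  carrier := {g | ∀ ω, g ω ∈ PolyMap F t}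
  mul_mem' hg hh ω := (polyClosed_zero hF).mul t (Nat.zero_le t) _ _ (hg ω) (hh ω)
  one_mem' _ := polyMap_one_mem t
  inv_mem' hg ω := (polyClosed_zero hF).inv t (Nat.zero_le t) _ (hg ω)

/-- Three subgroups lemma in the quotient by the target term, by induction on b. The +1 reflects
that the series starts with the whole group at index 0. -/
theorem commutator_lowerCentralSeries_le (a b : ℕ) :
    ⁅(⊤ : Subgroup H).lowerCentralSeries a, (⊤ : Subgroup H).lowerCentralSeries b⁆ ≤
      (⊤ : Subgroup H).lowerCentralSeries (a + b + 1) := by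
  induction b generalizing a with
  | zero => simp
  | succ b ih =>
    rw [Subgroup.commutator_le]
    intro x hx y hy
    set L := (⊤ : Subgroup H).lowerCentralSeries (a + (b + 1) + 1) with hL
    have : L.Normal := inferInstance
    let π := QuotientGroup.mk' L
    have hbot : ∀ S : Subgroup H, S ≤ L → S.map π = ⊥ := fun S hS => by
      rw [Subgroup.map_eq_bot_iff, QuotientGroup.ker_mk']; exact hS
    have h := Subgroup.commutator_commutator_eq_bot_of_rotate
      (H₁ := ((⊤ : Subgroup H).lowerCentralSeries b).map π) (H₂ := (⊤ : Subgroup H).map π)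
      (H₃ := ((⊤ : Subgroup H).lowerCentralSeries a).map π) ?_ ?_
    · rw [← Subgroup.map_commutator, ← Subgroup.map_commutator, Subgroup.map_eq_bot_iff,
        QuotientGroup.ker_mk', Subgroup.commutator_comm] at h
      exact h (Subgroup.commutator_mem_commutator hx hy)
    · rw [← Subgroup.map_commutator, ← Subgroup.map_commutator]
      refine hbot _ ?_
      rw [Subgroup.commutator_comm ⊤]
      refine (ih (a + 1)).trans (le_of_eq ?_)
      rw [hL]; congr 1; omega
    · rw [← Subgroup.map_commutator, ← Subgroup.map_commutator]
      refine hbot _ ?_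
      exact Subgroup.commutator_mono (ih a) le_rfl

/-- Repeating each term of the series e times gives room for maps of scalar degree below e. Rounding
can lose one in ⌊i/e⌋ + ⌊j/e⌋, and the extra +1 of the lower central series restores it. -/
theorem isFiltration_lowerCentralSeries {c : ℕ}
    (hc : (⊤ : Subgroup H).lowerCentralSeries c = ⊥) (e : ℕ) (he : 0 < e) :
    IsCommFiltration (fun t => (⊤ : Subgroup H).lowerCentralSeries (t / e)) (c * e) where
  anti s t h := Subgroup.lowerCentralSeries_antitone _ (Nat.div_le_div_right h)
  comm i j x hx y hy := by
    have h1 := Subgroup.commutator_mem_commutator (inv_mem hx) (inv_mem hy)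
    rw [commutatorElement_def, inv_inv, inv_inv] at h1
    refine Subgroup.lowerCentralSeries_antitone _ ?_ (commutator_lowerCentralSeries_le _ _ h1)
    have hi := Nat.div_add_mod i e
    have hj := Nat.div_add_mod j e
    have hi' := Nat.mod_lt i he
    have hj' := Nat.mod_lt j he
    rw [← Nat.lt_succ_iff, Nat.div_lt_iff_lt_mul he]
    simp only [Nat.succ_eq_add_one, add_mul, one_mul]
    nlinarith
  conj i x hx y := Subgroup.Normal.conj_mem inferInstance x hx y
  bot := by rw [Nat.mul_div_cancel _ he, hc]

theorem IsRightPolynomial.exists_le {g : Γ → H} (hg : IsRightPolynomial g) :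
    ∃ d : ℕ, ∀ bs : List Γ, d < bs.length → ∀ n, bs.foldr rightDeriv g n = 1 := by
  obtain ⟨d, hd⟩ := hg
  refine ⟨d, fun bs hbs n => ?_⟩
  rw [← List.take_append_drop (bs.length - (d + 1)) bs, List.foldr_append]
  have h1 : (bs.drop (bs.length - (d + 1))).foldr rightDeriv g = 1 := by
    ext m
    exact hd _ (by rw [List.length_drop]; omega) m
  rw [h1]
  have := polyMap_one_mem (Γ := Γ) (F := fun _ => (⊥ : Subgroup H)) 0
    (bs.take (bs.length - (d + 1))) n
  exact this

/-- Finitely many right polynomial maps into a nilpotent group are simultaneously polynomial with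
respect to a suitable filtration. -/
theorem exists_filtration [Group.IsNilpotent H] {κ : Type*} [Finite κ] (g : κ → Γ → H)
    (hg : ∀ i, IsRightPolynomial (g i)) :
    ∃ (F : ℕ → Subgroup H) (N : ℕ), IsCommFiltration F N ∧ ∀ i, g i ∈ PolyMap F 0 := by
  obtain ⟨c, hc⟩ := Subgroup.nilpotent_iff_lowerCentralSeries.1 (inferInstance : Group.IsNilpotent H)
  choose d hd using fun i => (hg i).exists_le
  obtain ⟨M, hM⟩ := Set.Finite.bddAbove (Set.finite_range d)
  -- Derivatives of order at most M need only lie in the whole group, and those of higher order are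
  -- trivial.
  refine ⟨_, _, isFiltration_lowerCentralSeries hc (M + 1) (by omega), fun i bs n => ?_⟩
  by_cases h : bs.length ≤ M
  · simp only [zero_add, Nat.div_eq_of_lt (Nat.lt_succ_of_le h)]
    exact Subgroup.mem_top _
  · rw [hd i bs (by have := hM (Set.mem_range_self i); omega) n]
    exact one_mem _

end PolynomialMaps

/-! ### Coset counts and their lexicographic decrease -/

section Complexity

variable {Γ H : Type*} [Group Γ] [Group H] {F : ℕ → Subgroup H} {N : ℕ}

theorem polySubgroup_anti (hF : IsCommFiltration F N) (Ω : Type*) {s t : ℕ} (h : s ≤ t) :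
    polySubgroup hF Γ Ω t ≤ polySubgroup hF Γ Ω s :=
  fun _ hg ω => polyMap_anti hF.anti h (hg ω)

theorem eq_one_of_mem_polySubgroup (hF : IsCommFiltration F N) {Ω : Type*} {g : Ω → Γ → H}
    (hg : g ∈ polySubgroup hF Γ Ω N) : g = 1 := by
  funext ω
  exact polyMap_eq_one hF le_rfl (hg ω)

theorem comp_mem_polySubgroup_iff (hF : IsCommFiltration F N) {Ω Ω' : Type*} {ψ : Ω' → Ω}
    (hψ : Function.Surjective ψ) {t : ℕ} {g : Ω → Γ → H} :
    g ∘ ψ ∈ polySubgroup hF Γ Ω' t ↔ g ∈ polySubgroup hF Γ Ω t :=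
  ⟨fun h ω => by obtain ⟨ω', rfl⟩ := hψ ω; exact h ω', fun h ω' => h (ψ ω')⟩

/-- The number of nontrivial left cosets of the families of degree `i + 1` which meet `S` and lie
in the coset of `p` modulo the families of degree `i`. -/
noncomputable def cosetCount (hF : IsCommFiltration F N) {Ω : Type*} (S : Finset (Ω → Γ → H))
    (p : Ω → Γ → H) (i : ℕ) : ℕ :=
  Set.ncard {c : (Ω → Γ → H) ⧸ polySubgroup hF Γ Ω (i + 1) | ∃ q ∈ S,
    p⁻¹ * q ∈ polySubgroup hF Γ Ω i ∧ q ∉ polySubgroup hF Γ Ω (i + 1) ∧ (q : _ ⧸ _) = c}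

/-- `p` is as far from the filtration as any element of `S`. -/
def IsLowest (hF : IsCommFiltration F N) {Ω : Type*} (S : Finset (Ω → Γ → H))
    (p : Ω → Γ → H) : Prop :=
  ∀ q ∈ S, ∀ i, p ∈ polySubgroup hF Γ Ω i → q ∈ polySubgroup hF Γ Ω i

/-- Every element of `S'` is a perturbation of (the pullback of) an element of `S` other
than `p`, of degree higher than that of its difference from `p`. -/
def IsPerturbation (hF : IsCommFiltration F N) {Ω Ω' : Type*} (ψ : Ω' → Ω)
    (S : Finset (Ω → Γ → H)) (p : Ω → Γ → H) (S' : Finset (Ω' → Γ → H)) : Prop :=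
  ∀ q' ∈ S', ∃ h ∈ S, h ≠ p ∧ ∀ i, p⁻¹ * h ∈ polySubgroup hF Γ Ω i →
    (h ∘ ψ)⁻¹ * q' ∈ polySubgroup hF Γ Ω' (i + 1)

theorem exists_level (hF : IsCommFiltration F N) {Ω : Type*} {p : Ω → Γ → H}
    (hp0 : p ∈ polySubgroup hF Γ Ω 0) (hp : p ≠ 1) :
    ∃ l < N, p ∈ polySubgroup hF Γ Ω l ∧ p ∉ polySubgroup hF Γ Ω (l + 1) := by
  classical
  have hex : ∃ l, p ∉ polySubgroup hF Γ Ω l := ⟨N, fun h => hp (eq_one_of_mem_polySubgroup hF h)⟩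
  have hpos : Nat.find hex ≠ 0 := fun h => (h ▸ Nat.find_spec hex) hp0
  have hle : Nat.find hex ≤ N := Nat.find_min' hex fun h => hp (eq_one_of_mem_polySubgroup hF h)
  refine ⟨Nat.find hex - 1, by omega, ?_, ?_⟩
  · exact not_not.1 (Nat.find_min hex (by omega))
  · rw [Nat.sub_add_cancel (by omega)]; exact Nat.find_spec hex

theorem exists_isLowest (hF : IsCommFiltration F N) {Ω : Type*} {S : Finset (Ω → Γ → H)}
    (hS : ∃ q ∈ S, q ≠ 1) : ∃ p ∈ S, p ≠ 1 ∧ IsLowest hF S p := by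
  classical
  have hne : ∃ l, ∃ q ∈ S, q ∉ polySubgroup hF Γ Ω l := by
    obtain ⟨q, hq, hq1⟩ := hS
    exact ⟨N, q, hq, fun h => hq1 (eq_one_of_mem_polySubgroup hF h)⟩
  obtain ⟨p, hp, hpl⟩ := Nat.find_spec hne
  refine ⟨p, hp, fun h => hpl (h ▸ one_mem _), fun q hq i hi => ?_⟩
  by_contra hqi
  exact hpl (polySubgroup_anti hF Ω (Nat.find_min' hne ⟨q, hq, hqi⟩) hi)

/-- If q' perturbs h and lies near p' in degree i, then h lies near p in degree i, and q' and h ∘ ψ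
agree modulo degree i + 1. So the cosets counted for S' are images of cosets counted for S. If S'
misses the coset of p, that coset is lost and the count drops. -/
theorem cosetCount_le_and_lt (hF : IsCommFiltration F N) {Ω Ω' : Type*} {ψ : Ω' → Ω}
    (hψ : Function.Surjective ψ) {S : Finset (Ω → Γ → H)} {p : Ω → Γ → H}
    (h0 : ∀ q ∈ S, q ∈ polySubgroup hF Γ Ω 0) (hp : p ∈ S)
    {S' : Finset (Ω' → Γ → H)} (hS' : IsPerturbation hF ψ S p S') {p' : Ω' → Γ → H} {i : ℕ}
    (hp' : (p ∘ ψ)⁻¹ * p' ∈ polySubgroup hF Γ Ω' i) :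
    cosetCount hF S' p' i ≤ cosetCount hF S p i ∧
      ((∀ q' ∈ S', (p ∘ ψ)⁻¹ * q' ∉ polySubgroup hF Γ Ω' (i + 1)) →
        p ∉ polySubgroup hF Γ Ω (i + 1) → cosetCount hF S' p' i < cosetCount hF S p i) := by
  classical
  have comp_mul : ∀ a b : Ω → Γ → H, (a⁻¹ * b) ∘ ψ = (a ∘ ψ)⁻¹ * (b ∘ ψ) := fun _ _ => rfl
  -- The perturbation is one degree finer than the distance from p to h, so closeness of q' to p
  -- passes to h one degree at a time.
  have close : ∀ (q' : Ω' → Γ → H) (h : Ω → Γ → H), h ∈ S →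
      (∀ i, p⁻¹ * h ∈ polySubgroup hF Γ Ω i → (h ∘ ψ)⁻¹ * q' ∈ polySubgroup hF Γ Ω' (i + 1)) →
      ∀ j, (p ∘ ψ)⁻¹ * q' ∈ polySubgroup hF Γ Ω' j → p⁻¹ * h ∈ polySubgroup hF Γ Ω j := by
    intro q' h hh hq j
    induction j with
    | zero => intro _; exact mul_mem (inv_mem (h0 p hp)) (h0 h hh)
    | succ j ih =>
      intro hj
      have h1 := hq j (ih (polySubgroup_anti hF _ (Nat.le_succ j) hj))
      rw [← comp_mem_polySubgroup_iff hF hψ, comp_mul]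
      have : (p ∘ ψ)⁻¹ * h ∘ ψ = ((p ∘ ψ)⁻¹ * q') * ((h ∘ ψ)⁻¹ * q')⁻¹ := by group
      rw [this]
      exact mul_mem hj (inv_mem h1)
  set A := {c : (Ω → Γ → H) ⧸ polySubgroup hF Γ Ω (i + 1) | ∃ q ∈ S,
    p⁻¹ * q ∈ polySubgroup hF Γ Ω i ∧ q ∉ polySubgroup hF Γ Ω (i + 1) ∧ (q : _ ⧸ _) = c} with hA
  set A' := {c : (Ω' → Γ → H) ⧸ polySubgroup hF Γ Ω' (i + 1) | ∃ q ∈ S',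
    p'⁻¹ * q ∈ polySubgroup hF Γ Ω' i ∧ q ∉ polySubgroup hF Γ Ω' (i + 1) ∧ (q : _ ⧸ _) = c}
    with hA'
  let φ : (Ω → Γ → H) ⧸ polySubgroup hF Γ Ω (i + 1) →
      (Ω' → Γ → H) ⧸ polySubgroup hF Γ Ω' (i + 1) :=
    Quotient.map' (fun g => g ∘ ψ) (by
      intro a b hab
      rw [QuotientGroup.leftRel_apply] at hab ⊢
      rw [← comp_mul, comp_mem_polySubgroup_iff hF hψ]
      exact hab)
  have hφ : ∀ g : Ω → Γ → H, φ (g : _ ⧸ _) = ((g ∘ ψ : Ω' → Γ → H) : _ ⧸ _) := fun g => rfl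
  have hAfin : A.Finite := (S.finite_toSet.image
    (fun q : Ω → Γ → H => (q : (Ω → Γ → H) ⧸ polySubgroup hF Γ Ω (i + 1)))).subset (by
      rintro c ⟨q, hq, -, -, rfl⟩
      exact ⟨q, hq, rfl⟩)
  have hsub : ∀ c ∈ A', ∃ h ∈ S, p⁻¹ * h ∈ polySubgroup hF Γ Ω i ∧
      h ∉ polySubgroup hF Γ Ω (i + 1) ∧ φ (h : _ ⧸ _) = c ∧ ∃ q' ∈ S',
        (h ∘ ψ)⁻¹ * q' ∈ polySubgroup hF Γ Ω' (i + 1) := by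
    rintro c ⟨q', hq', hpq, hq1, rfl⟩
    obtain ⟨h, hh, -, hq⟩ := hS' q' hq'
    have h1 : (p ∘ ψ)⁻¹ * q' ∈ polySubgroup hF Γ Ω' i := by
      have : (p ∘ ψ)⁻¹ * q' = ((p ∘ ψ)⁻¹ * p') * (p'⁻¹ * q') := by group
      rw [this]; exact mul_mem hp' hpq
    have h2 := close q' h hh hq i h1
    have h3 := hq i h2
    refine ⟨h, hh, h2, fun h4 => hq1 ?_, ?_, q', hq', h3⟩
    · rw [← comp_mem_polySubgroup_iff hF hψ] at h4
      have : q' = (h ∘ ψ) * ((h ∘ ψ)⁻¹ * q') := by group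
      rw [this]; exact mul_mem h4 h3
    · rw [hφ]; exact QuotientGroup.eq.2 h3
  constructor
  · have : A' ⊆ φ '' A := by
      intro c hc
      obtain ⟨h, hh, h1, h2, h3, -⟩ := hsub c hc
      exact ⟨_, ⟨h, hh, h1, h2, rfl⟩, h3⟩
    exact (Set.ncard_le_ncard this (hAfin.image _)).trans (Set.ncard_image_le hAfin)
  · intro hno hpi
    have hpA : (p : (Ω → Γ → H) ⧸ polySubgroup hF Γ Ω (i + 1)) ∈ A :=
      ⟨p, hp, by rw [inv_mul_cancel]; exact one_mem _, hpi, rfl⟩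
    have : A' ⊆ φ '' (A \ {(p : (Ω → Γ → H) ⧸ polySubgroup hF Γ Ω (i + 1))}) := by
      intro c hc
      obtain ⟨h, hh, h1, h2, h3, q', hq', h5⟩ := hsub c hc
      refine ⟨_, ⟨⟨h, hh, h1, h2, rfl⟩, fun h4 => hno q' hq' ?_⟩, h3⟩
      have h6 : p⁻¹ * h ∈ polySubgroup hF Γ Ω (i + 1) := QuotientGroup.eq.1 (Eq.symm h4)
      rw [← comp_mem_polySubgroup_iff hF hψ, comp_mul] at h6
      have : (p ∘ ψ)⁻¹ * q' = ((p ∘ ψ)⁻¹ * h ∘ ψ) * ((h ∘ ψ)⁻¹ * q') := by group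
      rw [this]; exact mul_mem h6 h5
    exact ((Set.ncard_le_ncard this (hAfin.sdiff.image _)).trans
      (Set.ncard_image_le hAfin.sdiff)).trans_lt (Set.ncard_sdiff_singleton_lt_of_mem hpA hAfin)

/-- The complexity of a system with a marked element, in the lexicographic order. -/
noncomputable def complexity (hF : IsCommFiltration F N) {Ω : Type*} (S : Finset (Ω → Γ → H))
    (p : Ω → Γ → H) : Lex (Fin N → ℕ) :=
  toLex fun i => cosetCount hF S p i

theorem toLex_lt_of_le_of_lt {a b : Fin N → ℕ} (i : Fin N) (hle : ∀ k < i, a k ≤ b k)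
    (hlt : a i < b i) : toLex a < toLex b := by
  classical
  have hex : ∃ k : ℕ, ∃ hk : k < N, a ⟨k, hk⟩ < b ⟨k, hk⟩ := ⟨i, i.2, hlt⟩
  obtain ⟨hk, hlt'⟩ := Nat.find_spec hex
  refine ⟨⟨Nat.find hex, hk⟩, fun k hki => le_antisymm ?_ ?_, hlt'⟩
  · refine hle k (lt_of_lt_of_le hki ?_)
    exact Nat.find_min' hex ⟨i.2, hlt⟩
  · by_contra hcon
    exact Nat.find_min hex (m := k) hki ⟨k.2, not_le.1 hcon⟩

/-- Let i be the first degree such that S' misses the coset of p modulo degree i + 1. A marked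
element p' that agrees with p modulo degree i does not raise the earlier counts and lowers the one
at i. Lower degrees dominate the lexicographic order. -/
theorem exists_complexity_lt (hF : IsCommFiltration F N) {Ω Ω' : Type*} {ψ : Ω' → Ω}
    (hψ : Function.Surjective ψ) {S : Finset (Ω → Γ → H)} {p : Ω → Γ → H}
    (h0 : ∀ q ∈ S, q ∈ polySubgroup hF Γ Ω 0) (hp : p ∈ S) (hp1 : p ≠ 1)
    (hlow : IsLowest hF S p) {S' : Finset (Ω' → Γ → H)}
    (hS' : IsPerturbation hF ψ S p S') (h1 : 1 ∈ S') (hne : ∃ q ∈ S', q ≠ 1) :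
    ∃ p' ∈ S', p' ≠ 1 ∧ IsLowest hF S' p' ∧ complexity hF S' p' < complexity hF S p := by
  classical
  have comp_mul : ∀ a b : Ω → Γ → H, (a⁻¹ * b) ∘ ψ = (a ∘ ψ)⁻¹ * (b ∘ ψ) := fun _ _ => rfl
  obtain ⟨l, hlN, hpl, hpl'⟩ := exists_level hF (h0 p hp) hp1
  have hS'l : ∀ q' ∈ S', q' ∈ polySubgroup hF Γ Ω' l := by
    intro q' hq'
    obtain ⟨h, hh, -, hq⟩ := hS' q' hq'
    have hl := hlow h hh l hpl
    have h2 := polySubgroup_anti hF _ (Nat.le_succ l) (hq l (mul_mem (inv_mem hpl) hl))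
    rw [← comp_mem_polySubgroup_iff hF hψ] at hl
    have : q' = (h ∘ ψ) * ((h ∘ ψ)⁻¹ * q') := by group
    rw [this]; exact mul_mem hl h2
  have hpψ : p ∘ ψ ∈ polySubgroup hF Γ Ω' l := (comp_mem_polySubgroup_iff hF hψ).2 hpl
  -- Otherwise S' would contain p ∘ ψ itself, and the perturbation property would force h = p.
  have hex : ∃ j, ∀ q' ∈ S', (p ∘ ψ)⁻¹ * q' ∉ polySubgroup hF Γ Ω' (j + 1) := by
    refine ⟨N, fun q' hq' hmem => ?_⟩
    have e1 := eq_one_of_mem_polySubgroup hF (polySubgroup_anti hF _ (Nat.le_succ N) hmem)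
    obtain ⟨h, hh, hhp, hq⟩ := hS' q' hq'
    have hq'' : q' = p ∘ ψ := by rw [← mul_one (p ∘ ψ), ← e1]; group
    have key : ∀ j, p⁻¹ * h ∈ polySubgroup hF Γ Ω j := by
      intro j
      induction j with
      | zero => exact mul_mem (inv_mem (h0 p hp)) (h0 h hh)
      | succ j ih =>
        have h2 := hq j ih
        rw [hq''] at h2
        rw [← comp_mem_polySubgroup_iff hF hψ, comp_mul, ← inv_mem_iff]
        simpa using h2
    have := eq_one_of_mem_polySubgroup hF (key N)
    exact hhp (inv_mul_eq_one.1 this).symm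
  set i := Nat.find hex with hi
  have hino : ∀ q' ∈ S', (p ∘ ψ)⁻¹ * q' ∉ polySubgroup hF Γ Ω' (i + 1) := Nat.find_spec hex
  have hli : l ≤ i := by
    by_contra hcon
    exact hino 1 h1 (by
      rw [mul_one]; exact inv_mem (polySubgroup_anti hF _ (by omega) hpψ))
  obtain ⟨q', hq', hqi⟩ : ∃ q' ∈ S', (p ∘ ψ)⁻¹ * q' ∈ polySubgroup hF Γ Ω' i := by
    rcases Nat.eq_zero_or_pos i with hz | hpos
    · exact ⟨1, h1, by
        rw [mul_one, hz]; exact inv_mem (polySubgroup_anti hF _ (Nat.zero_le l) hpψ)⟩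
    · have := Nat.find_min hex (m := i - 1) (by omega)
      push Not at this
      rwa [Nat.sub_add_cancel hpos] at this
  have hiN : i < N := by
    by_contra hcon
    have := eq_one_of_mem_polySubgroup hF (polySubgroup_anti hF _ (not_lt.1 hcon) hqi)
    exact hino q' hq' (this ▸ one_mem _)
  suffices ∃ p' ∈ S', p' ≠ 1 ∧ IsLowest hF S' p' ∧
      (p ∘ ψ)⁻¹ * p' ∈ polySubgroup hF Γ Ω' i by
    obtain ⟨p', hp', hp'1, hlow', hmem⟩ := this
    refine ⟨p', hp', hp'1, hlow', toLex_lt_of_le_of_lt ⟨i, hiN⟩ (fun k hk => ?_) ?_⟩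
    · exact (cosetCount_le_and_lt hF hψ h0 hp hS'
        (polySubgroup_anti hF _ (le_of_lt hk) hmem)).1
    · exact (cosetCount_le_and_lt hF hψ h0 hp hS' hmem).2 hino
        fun h => hpl' (polySubgroup_anti hF _ (by omega) h)
  -- If i is the level l of p, any lowest element of S' will do. If i > l, the element q' agrees
  -- with p beyond level l, so it also has level l and is lowest.
  rcases hli.eq_or_lt with hl | hl
  · obtain ⟨p', hp', hp'1, hlow'⟩ := exists_isLowest hF hne
    exact ⟨p', hp', hp'1, hlow', hl ▸ mul_mem (inv_mem hpψ) (hS'l p' hp')⟩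
  · have hq1 : q' ∉ polySubgroup hF Γ Ω' (l + 1) := fun h => hpl' (by
      rw [← comp_mem_polySubgroup_iff hF hψ, ← inv_mem_iff]
      have : (p ∘ ψ)⁻¹ = ((p ∘ ψ)⁻¹ * q') * q'⁻¹ := by group
      rw [this]
      exact mul_mem (polySubgroup_anti hF _ (by omega) hqi) (inv_mem h))
    refine ⟨q', hq', fun h => hq1 (h ▸ one_mem _), fun q hq k hk => ?_, hqi⟩
    refine polySubgroup_anti hF _ ?_ (hS'l q hq)
    by_contra hcon
    exact hq1 (polySubgroup_anti hF _ (by omega) hk)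

end Complexity

/-! ### Density of continuous functions in L¹ -/

section Density

variable {α : Type*} [TopologicalSpace α] [T2Space α] [LocallyCompactSpace α]
  [MeasurableSpace α] [BorelSpace α] {E : Type*} [NormedAddCommGroup E] [NormedSpace ℝ E]
  {μ : Measure α}

/-- Urysohn's lemma between a compact set and an open neighbourhood of slightly larger measure. -/
theorem exists_continuous_eLpNorm_sub_le_of_isCompact [μ.Regular] {s : Set α}
    (hs : IsCompact s) (c : E) {ε : ℝ≥0∞} (hε : ε ≠ 0) :
    ∃ f : α → E, Continuous f ∧ eLpNorm (fun x => f x - s.indicator (fun _ => c) x) 1 μ ≤ ε ∧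
      MemLp f 1 μ := by
  obtain ⟨η, η_pos, hη⟩ := exists_eLpNorm_indicator_le (μ := μ) ENNReal.one_ne_top c hε
  obtain ⟨V, sV, V_open, h'V, hV⟩ :=
    hs.measurableSet.exists_isOpen_sdiff_lt hs.measure_ne_top (ENNReal.coe_pos.2 η_pos).ne'
      (μ := μ)
  obtain ⟨g, hgs, hgv, hgc, hg_range⟩ :=
    exists_continuous_one_zero_of_isCompact hs V_open.isClosed_compl
      (disjoint_compl_right_iff.2 sV)
  have hmem : MemLp (fun x => g x • c) 1 μ := by
    have h1 : Integrable (fun x => g x) μ := g.continuous.integrable_of_hasCompactSupport hgc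
    exact memLp_one_iff_integrable.2 (h1.smul_const c)
  have gc_bd : ∀ x, ‖g x • c - s.indicator (fun _ => c) x‖ ≤ ‖(V \ s).indicator (fun _ => c) x‖ := by
    intro x
    by_cases hv : x ∈ V
    · by_cases hxs : x ∈ s
      · simp [hgs hxs, hxs]
      · simp only [hxs, not_false_iff, Set.indicator_of_notMem, sub_zero, Set.mem_sdiff, hv,
          and_self, Set.indicator_of_mem, norm_smul, Real.norm_eq_abs, abs_of_nonneg (hg_range x).1]
        exact mul_le_of_le_one_left (norm_nonneg _) (hg_range x).2
    · simp [hgv hv, show x ∉ s from fun h => hv (sV h)]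
  exact ⟨_, g.continuous.smul continuous_const, (eLpNorm_mono gc_bd).trans (hη _ hV.le), hmem⟩

/-- Continuous functions are dense in `L¹` over a locally compact Hausdorff space. -/
theorem exists_continuous_eLpNorm_one_sub_le [μ.Regular] {f : α → E} (hf : MemLp f 1 μ)
    {ε : ℝ≥0∞} (hε : ε ≠ 0) :
    ∃ g : α → E, eLpNorm (f - g) 1 μ ≤ ε ∧ Continuous g ∧ MemLp g 1 μ := by
  refine hf.induction_dense ENNReal.one_ne_top (fun g => Continuous g ∧ MemLp g 1 μ) ?_ ?_ ?_ hε
  · intro c t ht htμ ε hε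
    obtain ⟨δ, δpos, hδ⟩ := exists_Lp_half E μ 1 hε
    obtain ⟨η, ηpos, hη⟩ := exists_eLpNorm_indicator_le (μ := μ) ENNReal.one_ne_top c δpos.ne'
    obtain ⟨s, st, s_compact, s_closed, μs⟩ :=
      ht.exists_isCompact_isClosed_sdiff_lt htμ.ne (ENNReal.coe_pos.2 ηpos).ne'
    have I1 : eLpNorm ((s.indicator fun _ => c) - t.indicator fun _ => c) 1 μ ≤ δ := by
      rw [← eLpNorm_neg, neg_sub, ← Set.indicator_sdiff st]
      exact hη _ μs.le
    obtain ⟨f, f_cont, I2, f_mem⟩ :=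
      exists_continuous_eLpNorm_sub_le_of_isCompact (μ := μ) s_compact c δpos.ne'
    refine ⟨f, ?_, f_cont, f_mem⟩
    convert! (hδ _ _ (f_mem.aestronglyMeasurable.sub
      (aestronglyMeasurable_const.indicator s_closed.measurableSet))
      ((aestronglyMeasurable_const.indicator s_closed.measurableSet).sub
        (aestronglyMeasurable_const.indicator ht)) I2 I1).le using 2
    simp only [sub_add_sub_cancel]
  · rintro f g ⟨f_cont, f_mem⟩ ⟨g_cont, g_mem⟩
    exact ⟨f_cont.add g_cont, f_mem.add g_mem⟩
  · rintro f ⟨_, f_mem⟩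
    exact f_mem.aestronglyMeasurable

end Density

/-! ### Comparing a map with its iterated derivatives -/

section DerivativesNear

variable {Γ : Type*} [Group Γ]
variable {𝕜 E : Type*} [RCLike 𝕜] [NormedAddCommGroup E] [NormedSpace 𝕜 E]

theorem norm_rightDeriv_sub_le (h : Γ → (E ≃ₗᵢ[𝕜] E)) (c n : Γ) (v : E) :
    ‖rightDeriv c h n v - v‖ ≤ ‖h n v - v‖ + ‖h (n * c) v - v‖ := by
  have e : ‖rightDeriv c h n v - v‖ = ‖h (n * c) v - h n v‖ := by
    rw [← (h n).norm_map (rightDeriv c h n v - v), map_sub]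
    congr 2
    change (h n * rightDeriv c h n) v = h (n * c) v
    rw [rightDeriv, mul_inv_cancel_left]
  rw [e, ← sub_sub_sub_cancel_right (h (n * c) v) (h n v) v, add_comm]
  exact norm_sub_le _ _

theorem norm_sub_le_rightDeriv (h : Γ → (E ≃ₗᵢ[𝕜] E)) (c n : Γ) (v : E) :
    ‖h n v - v‖ ≤ ‖rightDeriv c h n v - v‖ + ‖h (n * c) v - v‖ := by
  have e : ‖rightDeriv c h n v - v‖ = ‖h (n * c) v - h n v‖ := by
    rw [← (h n).norm_map (rightDeriv c h n v - v), map_sub]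
    congr 2
    change (h n * rightDeriv c h n) v = h (n * c) v
    rw [rightDeriv, mul_inv_cancel_left]
  rw [e]
  calc ‖h n v - v‖ = ‖(h (n * c) v - v) - (h (n * c) v - h n v)‖ := by congr 1; abel
    _ ≤ _ := (norm_sub_le _ _).trans (le_of_eq (add_comm _ _))

/-- If most points almost fix `v`, then iterated derivatives can be chosen so as to compare. -/
theorem exists_derivs_near (h : Γ → (E ≃ₗᵢ[𝕜] E)) (v : E) {ε : ℝ} (hε : 0 ≤ ε) (d : ℕ) :
    ∀ (i : ℕ) (K : ℕ → Set Γ), (∀ k, K k ⊆ K (k + 1)) →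
    (∀ k < d, ∀ S : Finset Γ, ↑S ⊆ K k → S.card ≤ 2 ^ (i + k) →
      ∃ c, ∀ n ∈ S, n * c ∈ K (k + 1) ∧ ‖h (n * c) v - v‖ ≤ ε) →
    ∀ S : Finset Γ, ↑S ⊆ K 0 → S.card ≤ 2 ^ i → ∃ cs : List Γ, cs.length = d ∧
      ∀ n ∈ S, ‖h n v - v‖ ≤ ‖cs.foldr rightDeriv h n v - v‖ + 2 ^ d * ε ∧
        (‖h n v - v‖ ≤ ε → ‖cs.foldr rightDeriv h n v - v‖ ≤ 2 ^ d * ε) := by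
  classical
  induction d with
  | zero =>
    intro i K _ _ S _ _
    refine ⟨[], rfl, fun n _ => ?_⟩
    simp [hε]
  | succ d ih =>
    intro i K hKm hstep S hS hcard
    -- The increment c serves all of S at once. The next stage must control both S and Sc, so the
    -- allowed cardinality doubles at each step.
    obtain ⟨c, hc⟩ := hstep 0 (by omega) S hS (by simpa using hcard)
    obtain ⟨cs, hlen, hcs⟩ := ih (i + 1) (fun k => K (k + 1)) (fun k => hKm _)
      (fun k hk T hT hTc => hstep (k + 1) (by omega) T hT
        (hTc.trans (le_of_eq (by congr 1; omega))))
      (S ∪ S.image (· * c)) (by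
        intro x hx
        rcases Finset.mem_union.1 (Finset.mem_coe.1 hx) with hx | hx
        · exact hKm 0 (hS hx)
        · obtain ⟨n, hn, rfl⟩ := Finset.mem_image.1 hx
          exact (hc n hn).1) (by
        refine (Finset.card_union_le _ _).trans ?_
        have := Finset.card_image_le (s := S) (f := (· * c))
        rw [pow_succ]; omega)
    refine ⟨c :: cs, by simp [hlen], fun n hn => ?_⟩
    have h1 := hcs n (Finset.mem_union_left _ hn)
    have h2 := hcs (n * c) (Finset.mem_union_right _ (Finset.mem_image_of_mem _ hn))
    have h3 := h2.2 (hc n hn).2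
    have h4 := norm_sub_le_rightDeriv (cs.foldr rightDeriv h) c n v
    have h5 := norm_rightDeriv_sub_le (cs.foldr rightDeriv h) c n v
    rw [List.foldr_cons, pow_succ]
    refine ⟨by linarith [h1.1], fun h6 => by linarith [h1.2 h6]⟩

end DerivativesNear

/-! ### Measurable polynomial maps are strongly continuous -/

section AutomaticContinuity

variable {Γ : Type*} [Group Γ] [TopologicalSpace Γ] [IsTopologicalGroup Γ] [LocallyCompactSpace Γ]
  [T2Space Γ] [MeasurableSpace Γ] [BorelSpace Γ]

/-- Right translation carries μ to a multiple of itself. Testing on a compact neighbourhood W of 1,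
whose translates by W⁻¹ stay in W W⁻¹, bounds the factor near 1. -/
theorem exists_measure_preimage_mul_right_le (μ : Measure Γ) [μ.IsHaarMeasure] [μ.Regular] :
    ∃ C : ℝ≥0∞, C ≠ ∞ ∧ ∀ᶠ b in 𝓝 (1 : Γ), ∀ s, μ ((· * b) ⁻¹' s) ≤ C * μ s := by
  obtain ⟨W, hW, hW1⟩ := exists_compact_mem_nhds (1 : Γ)
  have hpos : μ W ≠ 0 := (Measure.measure_pos_of_mem_nhds μ hW1).ne'
  refine ⟨μ (W * W⁻¹) / μ W, ENNReal.div_ne_top (hW.mul hW.inv).measure_ne_top hpos, ?_⟩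
  filter_upwards [hW1] with b hb s
  have hpre : ∀ t : Set Γ, Measure.map (· * b) μ t = μ ((· * b) ⁻¹' t) := fun t =>
    (Homeomorph.mulRight b).toMeasurableEquiv.map_apply t
  have hreg : (Measure.map (· * b) μ).Regular := Measure.Regular.map (Homeomorph.mulRight b)
  have heq := Measure.isMulLeftInvariant_eq_smul_of_regular (Measure.map (· * b) μ) μ
  set c := (Measure.map (· * b) μ).haarScalarFactor μ
  have hc : ∀ t : Set Γ, μ ((· * b) ⁻¹' t) = c * μ t := fun t => by
    rw [← hpre, heq]; rfl
  rw [hc]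
  gcongr
  rw [ENNReal.le_div_iff_mul_le (Or.inl hpos) (Or.inl hW.measure_ne_top), ← hc]
  refine measure_mono fun x hx => ?_
  exact ⟨x * b, hx, b⁻¹, Set.inv_mem_inv.2 hb, by simp⟩

/-- Right translations are continuous in measure. -/
theorem tendsto_measure_translate {E : Type*} [NormedAddCommGroup E] [NormedSpace ℝ E]
    (μ : Measure Γ) [μ.IsHaarMeasure] [μ.Regular] {f : Γ → E} {M : ℝ} (hM : ∀ n, ‖f n‖ ≤ M)
    (hf : ∀ K : Set Γ, IsCompact K → AEStronglyMeasurable f (μ.restrict K))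
    {K : Set Γ} (hK : IsCompact K) {ε : ℝ} (hε : 0 < ε) {η : ℝ≥0∞} (hη : η ≠ 0) :
    ∀ᶠ b in 𝓝 (1 : Γ), μ {n ∈ K | ε < ‖f (n * b) - f n‖} ≤ η := by
  obtain ⟨C, hC, hCb⟩ := exists_measure_preimage_mul_right_le μ
  obtain ⟨W, hW, hW1⟩ := exists_compact_mem_nhds (1 : Γ)
  have hK' := hK.mul hW
  have hmem : MemLp ((K * W).indicator f) 1 μ := by
    rw [memLp_indicator_iff_restrict hK'.measurableSet]
    have : IsFiniteMeasure (μ.restrict (K * W)) := ⟨by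
      rw [Measure.restrict_apply_univ]; exact hK'.measure_lt_top⟩
    exact MemLp.of_bound (hf _ hK') M (Eventually.of_forall hM)
  have hC1 : C + 1 ≠ ∞ := ENNReal.add_ne_top.2 ⟨hC, ENNReal.one_ne_top⟩
  have hε3 : ENNReal.ofReal (ε / 3) ≠ 0 := by
    rw [Ne, ENNReal.ofReal_eq_zero]; linarith
  -- By Markov's inequality, f and φ differ by at least ε/3 only on a set N of measure at most η/(C
  -- + 1). The preimage of N under translation by b costs a further factor C.
  obtain ⟨φ, hφ, hφc, hφm⟩ := exists_continuous_eLpNorm_one_sub_le hmem (ε := ENNReal.ofReal (ε / 3) * (η / (C + 1)))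
    (mul_ne_zero hε3 (ENNReal.div_ne_zero.2 ⟨hη, hC1⟩))
  set N := {x | ENNReal.ofReal (ε / 3) ≤ ‖((K * W).indicator f - φ) x‖ₑ} with hN
  have hNle : μ N ≤ η / (C + 1) := by
    have h1 := mul_meas_ge_le_pow_eLpNorm μ one_ne_zero ENNReal.one_ne_top
      (hmem.sub hφm).1 (ENNReal.ofReal (ε / 3))
    simp only [ENNReal.toReal_one, ENNReal.rpow_one] at h1
    exact (ENNReal.mul_le_mul_iff_right hε3 ENNReal.ofReal_ne_top).1 (h1.trans hφ)
  have huc : ∀ᶠ b in 𝓝 (1 : Γ), ∀ n ∈ K, ‖φ (n * b) - φ n‖ < ε / 3 := by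
    refine hK.eventually_forall_of_forall_eventually fun n _ => ?_
    have hcont : Continuous fun z : Γ × Γ => ‖φ (z.2 * z.1) - φ z.2‖ := by fun_prop
    refine hcont.continuousAt.eventually_lt continuousAt_const ?_
    simpa using by linarith
  filter_upwards [hCb, hW1, huc] with b hb hbW hbu
  have hsub : {n ∈ K | ε < ‖f (n * b) - f n‖} ⊆ ((· * b) ⁻¹' N) ∪ N := by
    rintro n ⟨hn, hlt⟩
    by_contra hcon
    rw [Set.mem_union, not_or] at hcon
    have h1 : n ∈ K * W := ⟨n, hn, 1, mem_of_mem_nhds hW1, mul_one n⟩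
    have h2 : n * b ∈ K * W := ⟨n, hn, b, hbW, rfl⟩
    have key : ∀ m ∈ K * W, m ∉ N → ‖f m - φ m‖ < ε / 3 := by
      intro m hm hmN
      rw [hN, Set.mem_ofPred_eq, not_le, Pi.sub_apply, Set.indicator_of_mem hm,
        ← ofReal_norm, ENNReal.ofReal_lt_ofReal_iff (by linarith)] at hmN
      exact hmN
    have h3 := key _ h1 hcon.2
    have h4 := key _ h2 hcon.1
    have h5 := hbu n hn
    have e : f (n * b) - f n = (f (n * b) - φ (n * b)) + (φ (n * b) - φ n) - (f n - φ n) := by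
      abel
    have h6 : ‖f (n * b) - f n‖ ≤ ‖f (n * b) - φ (n * b)‖ + ‖φ (n * b) - φ n‖ + ‖f n - φ n‖ := by
      rw [e]; exact (norm_sub_le _ _).trans (add_le_add_left (norm_add_le _ _) _)
    linarith
  calc μ {n ∈ K | ε < ‖f (n * b) - f n‖} ≤ μ ((· * b) ⁻¹' N) + μ N :=
        (measure_mono hsub).trans (measure_union_le _ _)
    _ ≤ (C + 1) * μ N := by rw [add_mul, one_mul]; gcongr; exact hb N
    _ ≤ (C + 1) * (η / (C + 1)) := by gcongr
    _ ≤ η := ENNReal.mul_div_le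

/-- A measurable right polynomial map into the unitary group is strongly continuous. -/
theorem continuous_of_isRightPolynomial {𝕜 E : Type*} [RCLike 𝕜] [NormedAddCommGroup E]
    [NormedSpace 𝕜 E] [NormedSpace ℝ E] (μ : Measure Γ) [μ.IsHaarMeasure]
    [μ.Regular] {g : Γ → (E ≃ₗᵢ[𝕜] E)} (hg : IsRightPolynomial g) (v : E)
    (hm : ∀ K : Set Γ, IsCompact K → AEStronglyMeasurable (fun n => g n v) (μ.restrict K)) :
    Continuous fun n => g n v := by
  obtain ⟨d, hd⟩ := hg
  rw [continuous_iff_continuousAt]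
  intro n₀
  obtain ⟨W, hW, hW1⟩ := exists_compact_mem_nhds (1 : Γ)
  let K : ℕ → Set Γ := fun k => Nat.rec {n₀} (fun _ S => S * W) k
  have hKs : ∀ k, K (k + 1) = K k * W := fun k => rfl
  have hKm : ∀ k, K k ⊆ K (k + 1) := fun k x hx => ⟨x, hx, 1, mem_of_mem_nhds hW1, mul_one x⟩
  have hKmono : Monotone K := monotone_nat_of_le_succ hKm
  have hKc : ∀ k, IsCompact (K k) := by
    intro k
    induction k with
    | zero => exact isCompact_singleton
    | succ k ih => exact ih.mul hW
  have hWpos : μ W ≠ 0 := (Measure.measure_pos_of_mem_nhds μ hW1).ne'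
  have key : ∀ ε > 0, ∀ᶠ b in 𝓝 (1 : Γ), ‖g (n₀ * b) v - g n₀ v‖ ≤ 2 ^ d * ε := by
    intro ε hε
    -- At most 2 ^ d translates of the exceptional set will be used, so together they have measure
    -- at most μ W / 2 and cannot cover W. A common increment c therefore exists.
    have hη : μ W / 2 ^ (d + 1) ≠ 0 :=
      ENNReal.div_ne_zero.2 ⟨hWpos, ENNReal.pow_ne_top ENNReal.ofNat_ne_top⟩
    filter_upwards [tendsto_measure_translate μ (M := ‖v‖) (fun n => ((g n).norm_map v).le) hm
      (hKc d) hε hη] with b hb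
    set h := rightDeriv b g with hh
    have hnorm : ∀ n, ‖h n v - v‖ = ‖g (n * b) v - g n v‖ := by
      intro n
      rw [← (g n).norm_map (h n v - v), map_sub]
      congr 2
      change (g n * rightDeriv b g n) v = g (n * b) v
      rw [rightDeriv, mul_inv_cancel_left]
    obtain ⟨cs, hlen, hcs⟩ := exists_derivs_near h v hε.le d 0 K hKm (by
      intro k hk S hS hcard
      by_contra hcon
      push Not at hcon
      have hcov : W ⊆ ⋃ n ∈ S, (fun c => n * c) ⁻¹' {n ∈ K d | ε < ‖g (n * b) v - g n v‖} := by
        intro c hc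
        obtain ⟨n, hn, hnc⟩ := hcon c
        have hmem : n * c ∈ K (k + 1) := ⟨n, hS hn, c, hc, rfl⟩
        refine Set.mem_iUnion₂.2 ⟨n, hn, hKmono (show k + 1 ≤ d by omega) hmem, ?_⟩
        rw [← hnorm]
        exact hnc hmem
      have hle : μ W ≤ 2 ^ d * (μ W / 2 ^ (d + 1)) := by
        calc μ W ≤ ∑ n ∈ S, μ ((fun c => n * c) ⁻¹' {n ∈ K d | ε < ‖g (n * b) v - g n v‖}) :=
              (measure_mono hcov).trans (measure_biUnion_finset_le _ _)
          _ ≤ ∑ n ∈ S, μ W / 2 ^ (d + 1) := by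
              refine Finset.sum_le_sum fun n _ => ?_
              rw [measure_preimage_mul]; exact hb
          _ = S.card * (μ W / 2 ^ (d + 1)) := by rw [Finset.sum_const, nsmul_eq_mul]
          _ ≤ 2 ^ d * (μ W / 2 ^ (d + 1)) := by
              gcongr
              calc (S.card : ℝ≥0∞) ≤ ((2 ^ d : ℕ) : ℝ≥0∞) := by
                    exact_mod_cast hcard.trans (Nat.pow_le_pow_right (by norm_num) (by omega))
                _ = 2 ^ d := by norm_cast
      have hlt : 2 ^ d * (μ W / 2 ^ (d + 1)) < μ W := by
        have e : (2 : ℝ≥0∞) ^ d * (μ W / 2 ^ (d + 1)) = μ W / 2 := by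
          rw [pow_succ, div_eq_mul_inv, ENNReal.mul_inv (Or.inl (by simp)) (Or.inr (by simp)),
            mul_comm, mul_assoc, mul_comm _ (2 ^ d : ℝ≥0∞), ← mul_assoc (2 ^ d : ℝ≥0∞),
            ENNReal.mul_inv_cancel (by simp) (by simp), one_mul, div_eq_mul_inv]
        rw [e]
        exact ENNReal.half_lt_self hWpos hW.measure_ne_top
      exact absurd hle (not_le.2 hlt)) {n₀} (by simp [K]) (by simp)
    have h1 := (hcs n₀ (Finset.mem_singleton_self _)).1
    -- The d derivatives of h = D_b g are d + 1 derivatives of g, hence trivial, so only the error 2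
    -- ^ d * ε survives.
    have h2 := hd (cs ++ [b]) (by simp [hlen]) n₀
    rw [List.foldr_append] at h2
    have h3 : cs.foldr rightDeriv h n₀ = 1 := h2
    rw [h3] at h1
    have h4 : ((1 : E ≃ₗᵢ[𝕜] E) v) = v := rfl
    rw [h4, sub_self, norm_zero, zero_add] at h1
    rw [← hnorm]
    exact h1
  have hshift : Tendsto (fun b => g (n₀ * b) v) (𝓝 1) (𝓝 (g n₀ v)) := by
    rw [tendsto_iff_norm_sub_tendsto_zero, Metric.tendsto_nhds]
    intro ε hε
    filter_upwards [key (ε / 2 / 2 ^ d) (by positivity)] with b hb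
    rw [Real.dist_0_eq_abs, abs_norm]
    have : (2 : ℝ) ^ d * (ε / 2 / 2 ^ d) = ε / 2 := by field_simp
    linarith
  have h1 : Tendsto (fun n : Γ => n₀⁻¹ * n) (𝓝 n₀) (𝓝 1) := by
    have : Continuous fun n : Γ => n₀⁻¹ * n := by fun_prop
    simpa using this.tendsto n₀
  have := hshift.comp h1
  simpa [ContinuousAt, Function.comp_def] using this

end AutomaticContinuity

/-! ### Bounded functions as a *-algebra with the L² norm -/

section BoundedFunctions

variable {X : Type*} [MeasurableSpace X] {ν : Measure X} [IsProbabilityMeasure ν]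
  {𝕜 : Type*} [RCLike 𝕜]

/-- The essentially bounded elements of `L²`. -/
def bddSubmodule (𝕜 : Type*) [RCLike 𝕜] (ν : Measure X) : Submodule 𝕜 (Lp 𝕜 2 ν) where
  carrier := {f | IsEssBounded f}
  add_mem' {a b} ha hb := by
    change ((a + b : Lp 𝕜 2 ν) : X →ₘ[ν] 𝕜) ∈ Lp 𝕜 ∞ ν
    rw [AddSubgroup.coe_add]; exact add_mem ha hb
  zero_mem' := zero_mem (Lp 𝕜 ∞ ν)
  smul_mem' c a ha := by
    change (c • (a : X →ₘ[ν] 𝕜)) ∈ Lp 𝕜 ∞ ν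
    exact Lp.const_smul_mem_Lp c ⟨_, ha⟩

/-- The algebra of essentially bounded functions, as a subspace of `L²`. -/
abbrev BddFun (𝕜 : Type*) [RCLike 𝕜] (ν : Measure X) : Type _ := ↥(bddSubmodule 𝕜 ν)

namespace BddFun

/-- The underlying class of functions. -/
def toAE (a : BddFun 𝕜 ν) : X →ₘ[ν] 𝕜 := ((a : Lp 𝕜 2 ν) : X →ₘ[ν] 𝕜)

theorem toAE_injective : Function.Injective (toAE : BddFun 𝕜 ν → X →ₘ[ν] 𝕜) :=
  fun _ _ h => Subtype.ext (Subtype.ext h)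

/-- An essentially bounded class of functions as an element of `BddFun`. -/
def ofAE (u : X →ₘ[ν] 𝕜) (hu : u ∈ Lp 𝕜 ∞ ν) : BddFun 𝕜 ν :=
  ⟨⟨u, Lp.antitone le_top hu⟩, hu⟩

theorem mul_mem (a b : BddFun 𝕜 ν) : a.toAE * b.toAE ∈ Lp 𝕜 ∞ ν := by
  rw [Lp.mem_Lp_iff_memLp]
  exact (memLp_congr_ae (AEEqFun.coeFn_mul _ _)).2
    (MemLp.mul (Lp.mem_Lp_iff_memLp.1 b.2) (Lp.mem_Lp_iff_memLp.1 a.2))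

theorem one_mem : (1 : X →ₘ[ν] 𝕜) ∈ Lp 𝕜 ∞ ν := by
  rw [Lp.mem_Lp_iff_memLp]
  exact (memLp_congr_ae AEEqFun.coeFn_one).2 (memLp_const (1 : 𝕜))

theorem star_mem (a : BddFun 𝕜 ν) : star a.toAE ∈ Lp 𝕜 ∞ ν := by
  rw [Lp.mem_Lp_iff_memLp]
  exact (memLp_congr_ae (AEEqFun.coeFn_star _)).2 (Lp.mem_Lp_iff_memLp.1 a.2).star

instance : Mul (BddFun 𝕜 ν) := ⟨fun a b => ofAE (a.toAE * b.toAE) (mul_mem a b)⟩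
instance : One (BddFun 𝕜 ν) := ⟨ofAE 1 one_mem⟩
instance : Star (BddFun 𝕜 ν) := ⟨fun a => ofAE (star a.toAE) (star_mem a)⟩

theorem toAE_mul (a b : BddFun 𝕜 ν) : (a * b).toAE = a.toAE * b.toAE := rfl
theorem toAE_one : (1 : BddFun 𝕜 ν).toAE = 1 := rfl

instance : CommMonoid (BddFun 𝕜 ν) where
  mul_assoc a b c := toAE_injective (by simp only [toAE_mul, mul_assoc])
  one_mul a := toAE_injective (by simp only [toAE_mul, toAE_one, one_mul])
  mul_one a := toAE_injective (by simp only [toAE_mul, toAE_one, mul_one])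
  mul_comm a b := toAE_injective (by simp only [toAE_mul, mul_comm])

theorem toAE_prod {κ : Type*} (s : Finset κ) (a : κ → BddFun 𝕜 ν) :
    (∏ i ∈ s, a i).toAE = ∏ i ∈ s, (a i).toAE :=
  map_prod (⟨⟨toAE, toAE_one⟩, toAE_mul⟩ : BddFun 𝕜 ν →* X →ₘ[ν] 𝕜) a s

theorem coe_mul_ae (a b : BddFun 𝕜 ν) :
    ∀ᵐ x ∂ν, ((a * b : BddFun 𝕜 ν) : Lp 𝕜 2 ν) x = (a : Lp 𝕜 2 ν) x * (b : Lp 𝕜 2 ν) x :=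
  AEEqFun.coeFn_mul a.toAE b.toAE

theorem coe_star_ae (a : BddFun 𝕜 ν) :
    ∀ᵐ x ∂ν, ((star a : BddFun 𝕜 ν) : Lp 𝕜 2 ν) x = star ((a : Lp 𝕜 2 ν) x) :=
  AEEqFun.coeFn_star a.toAE

theorem coe_one_ae : ∀ᵐ x ∂ν, ((1 : BddFun 𝕜 ν) : Lp 𝕜 2 ν) x = 1 :=
  AEEqFun.coeFn_one

/-- Essential bounds. -/
def NormLe (C : ℝ) (h : Lp 𝕜 2 ν) : Prop := ∀ᵐ x ∂ν, ‖h x‖ ≤ C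

theorem normLe_iff {C : ℝ} (hC : 0 ≤ C) {h : Lp 𝕜 2 ν} :
    NormLe C h ↔ eLpNorm h ∞ ν ≤ ENNReal.ofReal C := by
  rw [eLpNorm_exponent_top]
  constructor
  · intro h1
    exact eLpNormEssSup_le_of_ae_bound h1
  · intro h1
    filter_upwards [ae_le_eLpNormEssSup (f := h) (μ := ν)] with x hx
    have := hx.trans h1
    rwa [← ofReal_norm, ENNReal.ofReal_le_ofReal_iff hC] at this

theorem exists_normLe (a : BddFun 𝕜 ν) : ∃ C, 0 ≤ C ∧ NormLe C (a : Lp 𝕜 2 ν) := by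
  have h1 : eLpNorm (a : Lp 𝕜 2 ν) ∞ ν < ∞ := (Lp.mem_Lp_iff_memLp.1 a.2).2
  exact ⟨_, ENNReal.toReal_nonneg, (normLe_iff ENNReal.toReal_nonneg).2
    (ENNReal.ofReal_toReal h1.ne).ge⟩

/-- An element of `L²` with an essential bound. -/
def ofNormLe {C : ℝ} (h : Lp 𝕜 2 ν) (hC : NormLe C h) : BddFun 𝕜 ν :=
  ⟨h, Lp.mem_Lp_iff_memLp.2 (MemLp.of_bound (Lp.aestronglyMeasurable h) C hC)⟩

theorem NormLe.mono {C D : ℝ} {h : Lp 𝕜 2 ν} (hC : NormLe C h) (hCD : C ≤ D) : NormLe D h := by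
  filter_upwards [hC] with x hx using hx.trans hCD

theorem NormLe.nonneg {C : ℝ} {h : Lp 𝕜 2 ν} (hC : NormLe C h) : 0 ≤ C := by
  obtain ⟨x, hx⟩ := Eventually.exists (f := ae ν) hC
  exact (norm_nonneg _).trans hx

theorem NormLe.mul {C D : ℝ} {a b : BddFun 𝕜 ν} (ha : NormLe C (a : Lp 𝕜 2 ν))
    (hb : NormLe D (b : Lp 𝕜 2 ν)) : NormLe (C * D) ((a * b : BddFun 𝕜 ν) : Lp 𝕜 2 ν) := by
  have := ha.nonneg
  filter_upwards [ha, hb, coe_mul_ae a b] with x h1 h2 h3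
  rw [h3, norm_mul]
  gcongr

theorem NormLe.star {C : ℝ} {a : BddFun 𝕜 ν} (ha : NormLe C (a : Lp 𝕜 2 ν)) :
    NormLe C ((star a : BddFun 𝕜 ν) : Lp 𝕜 2 ν) := by
  filter_upwards [ha, coe_star_ae a] with x h1 h3
  rw [h3, norm_star]; exact h1

theorem NormLe.add {C D : ℝ} {a b : Lp 𝕜 2 ν} (ha : NormLe C a) (hb : NormLe D b) :
    NormLe (C + D) (a + b) := by
  filter_upwards [ha, hb, Lp.coeFn_add a b] with x h1 h2 h3
  rw [h3]; exact (norm_add_le _ _).trans (add_le_add h1 h2)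

theorem NormLe.smul {C : ℝ} {a : Lp 𝕜 2 ν} (ha : NormLe C a) (c : 𝕜) :
    NormLe (‖c‖ * C) (c • a) := by
  filter_upwards [ha, Lp.coeFn_smul c a] with x h1 h3
  rw [h3, Pi.smul_apply, norm_smul]; gcongr

/-- An L²-convergent sequence has a subsequence converging almost everywhere. -/
theorem isClosed_normLe (C : ℝ) : IsClosed {h : Lp 𝕜 2 ν | NormLe C h} := by
  refine IsSeqClosed.isClosed fun u h hu hlim => ?_
  obtain ⟨ns, -, hns⟩ := (tendstoInMeasure_of_tendsto_Lp hlim).exists_seq_tendsto_ae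
  have hu' : ∀ᵐ x ∂ν, ∀ n, ‖u n x‖ ≤ C := ae_all_iff.2 hu
  filter_upwards [hns, hu'] with x h1 h2
  exact le_of_tendsto h1.norm (Eventually.of_forall fun n => h2 _)

/-- A closed convex set contains the averages of its points. -/
theorem normLe_integral {α : Type*} [MeasurableSpace α] {P : Measure α} [IsProbabilityMeasure P]
    {a : α → Lp 𝕜 2 ν} {C : ℝ} (ha : ∀ n, NormLe C (a n)) (hi : Integrable a P) :
    NormLe C (∫ n, a n ∂P) := by
  refine Convex.integral_mem ?_ (isClosed_normLe C) (Eventually.of_forall ha) hi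
  intro x hx y hy s t hs ht hst
  filter_upwards [hx, hy, Lp.coeFn_add (s • x) (t • y), Lp.coeFn_smul s x, Lp.coeFn_smul t y]
    with z h1 h2 h3 h4 h5
  rw [h3, Pi.add_apply, h4, h5, Pi.smul_apply, Pi.smul_apply]
  calc ‖s • x z + t • y z‖ ≤ s * ‖x z‖ + t * ‖y z‖ := by
        refine (norm_add_le _ _).trans (le_of_eq ?_)
        rw [norm_smul, norm_smul, Real.norm_of_nonneg hs, Real.norm_of_nonneg ht]
    _ ≤ s * C + t * C := by gcongr
    _ = C := by rw [← add_mul, hst, one_mul]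

/-- Multiplication by a bounded function, as an operator on `L²`. -/
noncomputable def mulL (a : BddFun 𝕜 ν) : Lp 𝕜 2 ν →L[𝕜] Lp 𝕜 2 ν :=
  (ContinuousLinearMap.mul 𝕜 𝕜).holderL ν ∞ 2 2 ⟨a.toAE, a.2⟩

theorem mulL_ae (a : BddFun 𝕜 ν) (h : Lp 𝕜 2 ν) :
    ∀ᵐ x ∂ν, mulL a h x = (a : Lp 𝕜 2 ν) x * h x :=
  (ContinuousLinearMap.mul 𝕜 𝕜).coeFn_holder (r := 2) _ _

theorem mulL_coe (a b : BddFun 𝕜 ν) : mulL a (b : Lp 𝕜 2 ν) = ((a * b : BddFun 𝕜 ν) : Lp 𝕜 2 ν) := by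
  refine Lp.ext ?_
  filter_upwards [mulL_ae a b, coe_mul_ae a b] with x h1 h2
  rw [h1, h2]

theorem norm_mulL_le {a : BddFun 𝕜 ν} {C : ℝ} (ha : NormLe C (a : Lp 𝕜 2 ν)) (h : Lp 𝕜 2 ν) :
    ‖mulL a h‖ ≤ C * ‖h‖ := by
  refine Lp.norm_le_mul_norm_of_ae_le_mul ?_
  filter_upwards [ha, mulL_ae a h] with x h1 h2
  rw [h2, norm_mul]; gcongr

theorem norm_mul_le {a : BddFun 𝕜 ν} {C : ℝ} (ha : NormLe C (a : Lp 𝕜 2 ν)) (b : BddFun 𝕜 ν) :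
    ‖((a * b : BddFun 𝕜 ν) : Lp 𝕜 2 ν)‖ ≤ C * ‖(b : Lp 𝕜 2 ν)‖ := by
  rw [← mulL_coe]; exact norm_mulL_le ha _

theorem NormLe.norm_le {h : Lp 𝕜 2 ν} {C : ℝ} (ha : NormLe C h) : ‖h‖ ≤ C := by
  simpa [measureUnivNNReal] using Lp.norm_le_of_ae_bound ha.nonneg ha

theorem mul_add' (a b c : BddFun 𝕜 ν) : a * (b + c) = a * b + a * c := by
  apply Subtype.ext
  rw [← mulL_coe, Submodule.coe_add, map_add, mulL_coe, mulL_coe, Submodule.coe_add]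

theorem mul_smul' (a b : BddFun 𝕜 ν) (c : 𝕜) : a * (c • b) = c • (a * b) := by
  apply Subtype.ext
  rw [← mulL_coe, Submodule.coe_smul, map_smul, mulL_coe, Submodule.coe_smul]

theorem inner_mul_left (a c : BddFun 𝕜 ν) (h : Lp 𝕜 2 ν) :
    inner 𝕜 (mulL c (a : Lp 𝕜 2 ν)) h = inner 𝕜 (a : Lp 𝕜 2 ν) (mulL (star c) h) := by
  rw [L2.inner_def, L2.inner_def]
  refine integral_congr_ae ?_
  filter_upwards [mulL_ae c a, mulL_ae (star c) h, coe_star_ae c] with x h1 h2 h3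
  rw [h1, h2, h3, RCLike.inner_apply, RCLike.inner_apply, map_mul, RCLike.star_def]
  ring

end BddFun

/-! ### The action of the group -/

section Action

open BddFun

variable {G : Subgroup (Lp 𝕜 2 ν ≃ₗᵢ[𝕜] Lp 𝕜 2 ν)} (hG : ∀ U ∈ G, ActsOnLInfty U)

/-- The action of `G` on bounded functions. -/
noncomputable def act (u : G) (a : BddFun 𝕜 ν) : BddFun 𝕜 ν :=
  ⟨(u : Lp 𝕜 2 ν ≃ₗᵢ[𝕜] Lp 𝕜 2 ν) a, (hG u u.2).isEssBounded a a.2⟩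

theorem coe_act (u : G) (a : BddFun 𝕜 ν) :
    (act hG u a : Lp 𝕜 2 ν) = (u : Lp 𝕜 2 ν ≃ₗᵢ[𝕜] Lp 𝕜 2 ν) a := rfl

theorem act_mul_act (u w : G) (a : BddFun 𝕜 ν) : act hG (u * w) a = act hG u (act hG w a) := rfl

theorem act_one_left (a : BddFun 𝕜 ν) : act hG 1 a = a := rfl

theorem act_act_inv (u : G) (a : BddFun 𝕜 ν) : act hG u (act hG u⁻¹ a) = a := by
  rw [← act_mul_act, mul_inv_cancel, act_one_left]

theorem act_mul (u : G) (a b : BddFun 𝕜 ν) : act hG u (a * b) = act hG u a * act hG u b :=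
  toAE_injective ((hG u u.2).map_mul a b ((a * b : BddFun 𝕜 ν) : Lp 𝕜 2 ν) a.2 b.2 rfl)

/-- The action is multiplicative and onto, so the image of 1 is a unit for the product. -/
theorem act_one (u : G) : act hG u (1 : BddFun 𝕜 ν) = 1 := by
  have h := act_mul hG u (act hG u⁻¹ 1) 1
  rw [mul_one, act_act_inv, one_mul] at h
  exact h.symm

theorem act_prod {κ : Type*} (u : G) (s : Finset κ) (a : κ → BddFun 𝕜 ν) :
    act hG u (∏ i ∈ s, a i) = ∏ i ∈ s, act hG u (a i) :=
  map_prod (⟨⟨act hG u, act_one hG u⟩, act_mul hG u⟩ : BddFun 𝕜 ν →* BddFun 𝕜 ν) a s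

theorem act_add (u : G) (a b : BddFun 𝕜 ν) : act hG u (a + b) = act hG u a + act hG u b :=
  Subtype.ext (map_add (u : Lp 𝕜 2 ν ≃ₗᵢ[𝕜] Lp 𝕜 2 ν) (a : Lp 𝕜 2 ν) b)

theorem act_smul (u : G) (c : 𝕜) (a : BddFun 𝕜 ν) : act hG u (c • a) = c • act hG u a :=
  Subtype.ext (map_smul (u : Lp 𝕜 2 ν ≃ₗᵢ[𝕜] Lp 𝕜 2 ν) c (a : Lp 𝕜 2 ν))

theorem norm_act (u : G) (a : BddFun 𝕜 ν) : ‖(act hG u a : Lp 𝕜 2 ν)‖ = ‖(a : Lp 𝕜 2 ν)‖ :=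
  (u : Lp 𝕜 2 ν ≃ₗᵢ[𝕜] Lp 𝕜 2 ν).norm_map _

theorem inner_act_act (u : G) (a b : BddFun 𝕜 ν) :
    inner 𝕜 (act hG u a : Lp 𝕜 2 ν) (act hG u b : Lp 𝕜 2 ν) =
      inner 𝕜 (a : Lp 𝕜 2 ν) (b : Lp 𝕜 2 ν) :=
  (u : Lp 𝕜 2 ν ≃ₗᵢ[𝕜] Lp 𝕜 2 ν).inner_map_map _ _

theorem BddFun.NormLe.act {C : ℝ} {a : BddFun 𝕜 ν} (ha : NormLe C (a : Lp 𝕜 2 ν)) (u : G) :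
    NormLe C (_root_.act hG u a : Lp 𝕜 2 ν) := by
  have h0 := ha.nonneg
  rw [normLe_iff h0] at ha ⊢
  exact ((hG u u.2).isometric a a.2).le.trans ha

/-- Unitarity, multiplicativity and preservation of 1 give ⟨uc, u(ā)⟩ = ⟨c, ā⟩ = ⟨ac, 1⟩ = ⟨ua · uc,
1⟩ for every c, and uc is arbitrary. -/
theorem act_star (u : G) (a : BddFun 𝕜 ν) : act hG u (star a) = star (act hG u a) := by
  have key : ∀ b : BddFun 𝕜 ν, inner 𝕜 (b : Lp 𝕜 2 ν) (act hG u (star a) : Lp 𝕜 2 ν) =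
      inner 𝕜 (b : Lp 𝕜 2 ν) (star (act hG u a) : BddFun 𝕜 ν) := by
    intro b
    obtain ⟨c, rfl⟩ : ∃ c, act hG u c = b := ⟨_, act_act_inv hG u b⟩
    rw [inner_act_act, ← mul_one (star a), ← mulL_coe, ← inner_mul_left, mulL_coe,
      ← inner_act_act hG u, act_mul, act_one, ← mulL_coe, inner_mul_left, mulL_coe, mul_one]
  apply Subtype.ext
  rw [← sub_eq_zero, ← inner_self_eq_zero (𝕜 := 𝕜), inner_sub_right, ← Submodule.coe_sub, key,
    sub_self]

end Action

end BoundedFunctions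

/-! ### Averages over compact sets and the Følner filter -/

section Averages

variable {Γ : Type*} [Group Γ] [TopologicalSpace Γ] [IsTopologicalGroup Γ] [LocallyCompactSpace Γ]
  [T2Space Γ] [MeasurableSpace Γ] [BorelSpace Γ] {μ : Measure Γ} [μ.IsHaarMeasure]

/-- Compact sets of positive measure, with the discrete topology. -/
def FolnerSet (μ : Measure Γ) : Type _ := {F : Set Γ // IsCompact F ∧ 0 < μ F}

/-- With the discrete topology, any dependence on a Følner set is continuous, so these sets can be
adjoined as parameters. -/
instance : TopologicalSpace (FolnerSet μ) := ⊥
instance : DiscreteTopology (FolnerSet μ) := ⟨rfl⟩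

namespace FolnerSet

/-- A compact set of positive measure as a `FolnerSet`. -/
def of (F : Set Γ) (hF : IsCompact F) (h : 0 < μ F) : FolnerSet μ := ⟨F, hF, h⟩

/-- The underlying set. -/
def carrier (F : FolnerSet μ) : Set Γ := F.1

theorem isCompact (F : FolnerSet μ) : IsCompact F.carrier := F.2.1

theorem pos (F : FolnerSet μ) : 0 < μ F.carrier := F.2.2

theorem ne_top (F : FolnerSet μ) : μ F.carrier ≠ ∞ := F.isCompact.measure_ne_top

/-- The normalized restriction of `μ`. -/
noncomputable def prob (F : FolnerSet μ) : Measure Γ := (μ F.carrier)⁻¹ • μ.restrict F.carrier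

instance (F : FolnerSet μ) : IsProbabilityMeasure F.prob := ⟨by
  rw [prob, Measure.smul_apply, Measure.restrict_apply_univ, smul_eq_mul,
    ENNReal.inv_mul_cancel F.pos.ne' F.ne_top]⟩

theorem ae_mem (F : FolnerSet μ) : ∀ᵐ n ∂F.prob, n ∈ F.carrier :=
  Measure.ae_smul_measure (ae_restrict_mem F.isCompact.measurableSet) _

variable {E : Type*} [NormedAddCommGroup E] [NormedSpace ℝ E]

theorem integrable (F : FolnerSet μ) {a : Γ → E} (ha : Continuous a) : Integrable a F.prob :=
  (ha.continuousOn.integrableOn_compact F.isCompact).smul_measure (ENNReal.inv_ne_top.2 F.pos.ne')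

theorem integral_prob (F : FolnerSet μ) (a : Γ → E) :
    ∫ n, a n ∂F.prob = (μ.real F.carrier)⁻¹ • ∫ n in F.carrier, a n ∂μ := by
  rw [prob, integral_smul_measure, ENNReal.toReal_inv]; rfl

theorem norm_integral_le (F : FolnerSet μ) {a : Γ → E} {C : ℝ}
    (ha : ∀ n ∈ F.carrier, ‖a n‖ ≤ C) : ‖∫ n, a n ∂F.prob‖ ≤ C := by
  have := norm_integral_le_of_norm_le_const (μ := F.prob) (F.ae_mem.mono ha)
  simpa using this

/-- Compactness of the set of integration makes convergence in y uniform in n. -/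
theorem continuous_integral (F : FolnerSet μ) {Y : Type*} [TopologicalSpace Y] {a : Y × Γ → E}
    (ha : Continuous a) : Continuous fun y => ∫ n, a (y, n) ∂F.prob := by
  rw [continuous_iff_continuousAt]
  intro y₀
  rw [ContinuousAt, tendsto_iff_norm_sub_tendsto_zero, Metric.tendsto_nhds]
  intro ε hε
  have h1 : ∀ᶠ y in 𝓝 y₀, ∀ n ∈ F.carrier, ‖a (y, n) - a (y₀, n)‖ < ε / 2 := by
    refine F.isCompact.eventually_forall_of_forall_eventually fun n _ => ?_
    have hc : Continuous fun z : Y × Γ => ‖a (z.1, z.2) - a (y₀, z.2)‖ := by fun_prop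
    refine hc.continuousAt.eventually_lt continuousAt_const ?_
    simpa using by linarith
  filter_upwards [h1] with y hy
  rw [Real.dist_0_eq_abs, abs_norm, ← integral_sub (F.integrable (by fun_prop))
    (F.integrable (by fun_prop))]
  exact (F.norm_integral_le fun n hn => (hy n hn).le).trans_lt (by linarith)

theorem continuous_integral_of_continuous {Y : Type*} [TopologicalSpace Y] {F : Y → FolnerSet μ}
    (hF : Continuous F) {a : Y × Γ → E} (ha : Continuous a) :
    Continuous fun y => ∫ n, a (y, n) ∂(F y).prob := by
  have h1 : Continuous fun p : Y × FolnerSet μ => ∫ n, a (p.1, n) ∂p.2.prob :=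
    continuous_prod_of_discrete_right.2 fun F => F.continuous_integral ha
  exact h1.comp (continuous_id.prodMk hF)

/-- No σ-finiteness is assumed. Multiplying by cutoffs equal to 1 on the two compact sets reduces to
Fubini for continuous functions of compact support. -/
theorem integral_swap (F F' : FolnerSet μ) {a : Γ × Γ → E} (ha : Continuous a) :
    ∫ l, ∫ m, a (l, m) ∂F.prob ∂F'.prob = ∫ m, ∫ l, a (l, m) ∂F'.prob ∂F.prob := by
  obtain ⟨χ, hχ, -, hχc, -⟩ := exists_continuous_one_zero_of_isCompact F.isCompact
    isClosed_empty (Set.disjoint_empty _)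
  obtain ⟨χ', hχ', -, hχc', -⟩ := exists_continuous_one_zero_of_isCompact F'.isCompact
    isClosed_empty (Set.disjoint_empty _)
  have key := integral_integral_swap_of_hasCompactSupport
    (f := fun l m => (χ' l * χ m) • a (l, m)) (μ := F'.prob) (ν := F.prob) (by
      simp only [Function.uncurry_def]; fun_prop) (by
      refine HasCompactSupport.intro (hχc'.isCompact.prod hχc.isCompact) ?_
      rintro ⟨l, m⟩ h
      simp only [Set.mem_prod, not_and_or] at h
      rcases h with h | h
      · simp [Function.uncurry, image_eq_zero_of_notMem_tsupport h]
      · simp [Function.uncurry, image_eq_zero_of_notMem_tsupport h])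
  have h1 : ∀ l ∈ F'.carrier, ∀ m ∈ F.carrier, (χ' l * χ m) • a (l, m) = a (l, m) := by
    intro l hl m hm
    rw [hχ' hl, hχ hm]; simp
  have e1 : ∫ l, ∫ m, (χ' l * χ m) • a (l, m) ∂F.prob ∂F'.prob =
      ∫ l, ∫ m, a (l, m) ∂F.prob ∂F'.prob := by
    refine integral_congr_ae ?_
    filter_upwards [F'.ae_mem] with l hl
    refine integral_congr_ae ?_
    filter_upwards [F.ae_mem] with m hm using h1 l hl m hm
  have e2 : ∫ m, ∫ l, (χ' l * χ m) • a (l, m) ∂F'.prob ∂F.prob =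
      ∫ m, ∫ l, a (l, m) ∂F'.prob ∂F.prob := by
    refine integral_congr_ae ?_
    filter_upwards [F.ae_mem] with m hm
    refine integral_congr_ae ?_
    filter_upwards [F'.ae_mem] with l hl using h1 l hl m hm
  rw [← e1, ← e2]
  exact key

theorem norm_integral_sub_integral_le {A B : Set Γ} (hA : IsCompact A) (hB : IsCompact B)
    {a : Γ → E} (ha : Continuous a) {C : ℝ} (hC : ∀ n, ‖a n‖ ≤ C) :
    ‖(∫ n in A, a n ∂μ) - ∫ n in B, a n ∂μ‖ ≤ C * μ.real (symmDiff A B) := by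
  have iA := ha.continuousOn.integrableOn_compact (μ := μ) hA
  have iB := ha.continuousOn.integrableOn_compact (μ := μ) hB
  rw [← integral_inter_add_sdiff hB.measurableSet iA, ← integral_inter_add_sdiff hA.measurableSet iB,
    Set.inter_comm B A, add_sub_add_left_eq_sub]
  have fA : μ (A \ B) < ∞ := (measure_mono Set.sdiff_subset).trans_lt hA.measure_lt_top
  have fB : μ (B \ A) < ∞ := (measure_mono Set.sdiff_subset).trans_lt hB.measure_lt_top
  have e : μ.real (symmDiff A B) = μ.real (A \ B) + μ.real (B \ A) := by
    rw [Set.symmDiff_def, measureReal_union disjoint_sdiff_sdiff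
      (hB.measurableSet.diff hA.measurableSet) fA.ne fB.ne]
  rw [e, mul_add]
  refine (norm_sub_le _ _).trans (add_le_add ?_ ?_)
  · exact norm_setIntegral_le_of_norm_le_const fA fun n _ => hC n
  · exact norm_setIntegral_le_of_norm_le_const fB fun n _ => hC n

/-- Left invariance moves the translation from the integrand to the domain. -/
theorem norm_integral_sub_translate_le (F : FolnerSet μ) {a : Γ → E} (ha : Continuous a) {C : ℝ}
    (hC : ∀ n, ‖a n‖ ≤ C) (l : Γ) {δ : ℝ} (hδ : 0 ≤ δ)
    (h : μ (symmDiff (l • F.carrier) F.carrier) ≤ ENNReal.ofReal δ * μ F.carrier) :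
    ‖(∫ n, a n ∂F.prob) - ∫ m, a (l * m) ∂F.prob‖ ≤ C * δ := by
  have hC0 : 0 ≤ C := (norm_nonneg _).trans (hC 1)
  have hpos : 0 < μ.real F.carrier := ENNReal.toReal_pos F.pos.ne' F.ne_top
  have htr : ∫ m in F.carrier, a (l * m) ∂μ = ∫ n in l • F.carrier, a n ∂μ := by
    have h1 := (measurePreserving_mul_left μ l).setIntegral_preimage_emb
      (measurableEmbedding_mulLeft l) a (l • F.carrier)
    rw [← h1]
    congr 2
    ext x
    simp [Set.mem_smul_set_iff_inv_smul_mem]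
  rw [integral_prob, integral_prob, htr, ← smul_sub, norm_smul, norm_inv,
    Real.norm_of_nonneg hpos.le, inv_mul_le_iff₀ hpos]
  have h2 := norm_integral_sub_integral_le (μ := μ) F.isCompact (F.isCompact.smul l) ha hC
  have h3 : μ.real (symmDiff F.carrier (l • F.carrier)) ≤ δ * μ.real F.carrier := by
    rw [symmDiff_comm]
    have := ENNReal.toReal_mono (ENNReal.mul_ne_top ENNReal.ofReal_ne_top F.ne_top) h
    rwa [ENNReal.toReal_mul, ENNReal.toReal_ofReal hδ] at this
  calc _ ≤ C * (δ * μ.real F.carrier) := h2.trans (by gcongr)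
    _ = _ := by ring

end FolnerSet

/-- The filter of asymptotic left invariance on compact sets of positive measure. -/
def folner (μ : Measure Γ) : Filter (FolnerSet μ) :=
  ⨅ (K : Set Γ) (_ : IsCompact K) (δ : ℝ) (_ : 0 < δ),
    𝓟 {F | ∀ l ∈ K, μ (symmDiff (l • F.carrier) F.carrier) ≤ ENNReal.ofReal δ * μ F.carrier}

theorem eventually_folner {K : Set Γ} (hK : IsCompact K) {δ : ℝ} (hδ : 0 < δ) :
    ∀ᶠ F in folner μ, ∀ l ∈ K,
      μ (symmDiff (l • F.carrier) F.carrier) ≤ ENNReal.ofReal δ * μ F.carrier :=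
  mem_iInf_of_mem K (mem_iInf_of_mem hK (mem_iInf_of_mem δ (mem_iInf_of_mem hδ
    (mem_principal_self _))))

theorem IsFolnerNet.tendsto {ι : Type*} [Preorder ι] {F : ι → Set Γ} (hF : IsFolnerNet μ F) :
    Tendsto (fun α => FolnerSet.of (F α) (hF.isCompact α) (hF.measure_pos α)) atTop
      (folner μ) := by
  simp only [folner, tendsto_iInf, tendsto_principal]
  intro K hK δ hδ
  have h1 := (hF.tendsto_symmDiff K hK).eventually (ge_mem_nhds (ENNReal.ofReal_pos.2 hδ))
  filter_upwards [h1] with α hα l hl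
  have h2 := (le_iSup₂ (f := fun l (_ : l ∈ K) => μ (symmDiff (l • F α) (F α)) / μ (F α)) l
    hl).trans hα
  rwa [ENNReal.div_le_iff (hF.measure_pos α).ne' (hF.isCompact α).measure_ne_top] at h2

end Averages

/-! ### Means on spaces of parameters -/

section Means

/-- Bounded continuous real functions. -/
structure IsBC {Y : Type*} [TopologicalSpace Y] (φ : Y → ℝ) : Prop where
  cont : Continuous φ
  bdd : ∃ C, ∀ y, |φ y| ≤ C

variable {Y Z : Type*} [TopologicalSpace Y] [TopologicalSpace Z]

theorem IsBC.add {φ ψ : Y → ℝ} (hφ : IsBC φ) (hψ : IsBC ψ) : IsBC fun y => φ y + ψ y := by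
  obtain ⟨C, hC⟩ := hφ.bdd
  obtain ⟨D, hD⟩ := hψ.bdd
  exact ⟨hφ.cont.add hψ.cont, C + D, fun y => (abs_add_le _ _).trans (add_le_add (hC y) (hD y))⟩

theorem IsBC.smul {φ : Y → ℝ} (hφ : IsBC φ) (c : ℝ) : IsBC fun y => c * φ y := by
  obtain ⟨C, hC⟩ := hφ.bdd
  refine ⟨continuous_const.mul hφ.cont, |c| * C, fun y => ?_⟩
  rw [abs_mul]; gcongr; exact hC y

theorem IsBC.const (c : ℝ) : IsBC fun _ : Y => c := ⟨continuous_const, |c|, fun _ => le_rfl⟩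

theorem IsBC.comp {φ : Y → ℝ} (hφ : IsBC φ) {f : Z → Y} (hf : Continuous f) :
    IsBC fun z => φ (f z) := by
  obtain ⟨C, hC⟩ := hφ.bdd
  exact ⟨hφ.cont.comp hf, C, fun z => hC _⟩

/-- A positive normalized functional on bounded continuous functions. -/
structure Mean (Y : Type*) [TopologicalSpace Y] where
  toFun : (Y → ℝ) → ℝ
  map_add : ∀ φ ψ, IsBC φ → IsBC ψ → toFun (fun y => φ y + ψ y) = toFun φ + toFun ψ
  map_smul : ∀ (c : ℝ) φ, IsBC φ → toFun (fun y => c * φ y) = c * toFun φ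
  nonneg : ∀ φ, IsBC φ → (∀ y, 0 ≤ φ y) → 0 ≤ toFun φ
  map_one : toFun (fun _ => 1) = 1

namespace Mean

instance : CoeFun (Mean Y) fun _ => (Y → ℝ) → ℝ := ⟨toFun⟩

variable (Λ : Mean Y)

theorem mono {φ ψ : Y → ℝ} (hφ : IsBC φ) (hψ : IsBC ψ) (h : ∀ y, φ y ≤ ψ y) : Λ φ ≤ Λ ψ := by
  have h1 := Λ.nonneg _ (hψ.add (hφ.smul (-1))) fun y => by have := h y; linarith
  rw [Λ.map_add _ _ hψ (hφ.smul (-1)), Λ.map_smul _ _ hφ] at h1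
  linarith

theorem map_const (c : ℝ) : Λ (fun _ => c) = c := by
  have := Λ.map_smul c (fun _ => 1) (IsBC.const 1)
  rw [Λ.map_one] at this
  simpa using this

theorem abs_le {φ : Y → ℝ} (hφ : IsBC φ) {C : ℝ} (hC : ∀ y, |φ y| ≤ C) : |Λ φ| ≤ C := by
  rw [_root_.abs_le]
  constructor
  · rw [← Λ.map_const (-C)]
    exact Λ.mono (IsBC.const _) hφ fun y => (_root_.abs_le.1 (hC y)).1
  · rw [← Λ.map_const C]
    exact Λ.mono hφ (IsBC.const _) fun y => (_root_.abs_le.1 (hC y)).2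

/-- Evaluation at a point. -/
def eval (y : Y) : Mean Y where
  toFun φ := φ y
  map_add _ _ _ _ := rfl
  map_smul _ _ _ := rfl
  nonneg _ _ h := h y
  map_one := rfl

section Limit

variable {I : Type*} [TopologicalSpace I] (q : Ultrafilter I)

theorem exists_tendsto {φ : Y × I → ℝ} (hφ : IsBC φ) :
    ∃ c, Tendsto (fun i => Λ fun y => φ (y, i)) q (𝓝 c) := by
  obtain ⟨C, hC⟩ := hφ.bdd
  have h1 : ∀ i, (Λ fun y => φ (y, i)) ∈ Set.Icc (-C) C := fun i =>
    _root_.abs_le.1 (Λ.abs_le (hφ.comp (continuous_id.prodMk continuous_const)) fun y => hC _)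
  obtain ⟨c, -, hc⟩ := (isCompact_Icc (a := -C) (b := C)).ultrafilter_le_nhds
    (q.map fun i => Λ fun y => φ (y, i)) (by
      rw [le_principal_iff, Ultrafilter.coe_map]; exact mem_map.2 (univ_mem' h1))
  exact ⟨c, hc⟩

theorem tendsto_limUnder {φ : Y × I → ℝ} (hφ : IsBC φ) :
    Tendsto (fun i => Λ fun y => φ (y, i)) q (𝓝 (limUnder (q : Filter I) fun i => Λ fun y => φ (y, i))) :=
  tendsto_nhds_limUnder (Λ.exists_tendsto q hφ)

/-- The limit of a mean along an ultrafilter of additional parameters. -/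
noncomputable def limit : Mean (Y × I) where
  toFun φ := limUnder (q : Filter I) fun i => Λ fun y => φ (y, i)
  map_add φ ψ hφ hψ := by
    refine tendsto_nhds_unique (Λ.tendsto_limUnder q (hφ.add hψ)) ?_
    refine ((Λ.tendsto_limUnder q hφ).add (Λ.tendsto_limUnder q hψ)).congr fun i => ?_
    exact (Λ.map_add _ _ (hφ.comp (continuous_id.prodMk continuous_const))
      (hψ.comp (continuous_id.prodMk continuous_const))).symm
  map_smul c φ hφ := by
    refine tendsto_nhds_unique (Λ.tendsto_limUnder q (hφ.smul c)) ?_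
    refine ((Λ.tendsto_limUnder q hφ).const_mul c).congr fun i => ?_
    exact (Λ.map_smul c _ (hφ.comp (continuous_id.prodMk continuous_const))).symm
  nonneg φ hφ h := ge_of_tendsto (Λ.tendsto_limUnder q hφ) (Eventually.of_forall fun i =>
    Λ.nonneg _ (hφ.comp (continuous_id.prodMk continuous_const)) fun y => h _)
  map_one := by simp only [Λ.map_one]; exact tendsto_const_nhds.limUnder_eq

theorem tendsto_limit {φ : Y × I → ℝ} (hφ : IsBC φ) :
    Tendsto (fun i => Λ fun y => φ (y, i)) q (𝓝 (Λ.limit q φ)) :=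
  Λ.tendsto_limUnder q hφ

/-- Adjoining a parameter does not change the mean of quantities that ignore it, so estimates on the
larger space descend. -/
theorem limit_fst (φ : Y → ℝ) : (Λ.limit q) (fun p => φ p.1) = Λ φ :=
  (tendsto_const_nhds (x := Λ φ) (f := (q : Filter I))).limUnder_eq

end Limit

section Average

variable {Γ : Type*} [Group Γ] [TopologicalSpace Γ] [IsTopologicalGroup Γ] [LocallyCompactSpace Γ]
  [T2Space Γ] [MeasurableSpace Γ] [BorelSpace Γ] {μ : Measure Γ} [μ.IsHaarMeasure]

theorem _root_.IsBC.integral {F : Y → FolnerSet μ} (hF : Continuous F) {φ : Y × Γ → ℝ}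
    (hφ : IsBC φ) : IsBC fun y => ∫ n, φ (y, n) ∂(F y).prob := by
  obtain ⟨C, hC⟩ := hφ.bdd
  exact ⟨FolnerSet.continuous_integral_of_continuous hF hφ.cont, C, fun y => by
    rw [← Real.norm_eq_abs]; exact (F y).norm_integral_le fun n _ => hC _⟩

/-- Averaging over the Følner sets attached to the parameters. -/
noncomputable def average {F : Y → FolnerSet μ} (hF : Continuous F) : Mean (Y × Γ) where
  toFun φ := Λ fun y => ∫ n, φ (y, n) ∂(F y).prob
  map_add φ ψ hφ hψ := by
    rw [← Λ.map_add _ _ (hφ.integral hF) (hψ.integral hF)]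
    congr 1; ext y
    have h1 := hφ.cont
    have h2 := hψ.cont
    exact integral_add ((F y).integrable (by fun_prop)) ((F y).integrable (by fun_prop))
  map_smul c φ hφ := by
    rw [← Λ.map_smul _ _ (hφ.integral hF)]
    congr 1; ext y
    exact integral_const_mul _ _
  nonneg φ hφ h := Λ.nonneg _ (hφ.integral hF) fun y => integral_nonneg fun n => h _
  map_one := by simp [Λ.map_one]

end Average

end Mean

end Means

/-! ### Continuous bounded families, weighted averages and their adjoints -/

section NiceFamilies

open BddFun

variable {X : Type*} [MeasurableSpace X] {ν : Measure X} [IsProbabilityMeasure ν]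
  {𝕜 : Type*} [RCLike 𝕜] {Y Z : Type*} [TopologicalSpace Y] [TopologicalSpace Z]

/-- Families of bounded functions which are continuous into `L²` and uniformly bounded. -/
structure Nice (a : Y → BddFun 𝕜 ν) : Prop where
  cont : Continuous fun y => (a y : Lp 𝕜 2 ν)
  bdd : ∃ C, ∀ y, NormLe C (a y : Lp 𝕜 2 ν)

theorem Nice.comp {a : Y → BddFun 𝕜 ν} (ha : Nice a) {φ : Z → Y} (hφ : Continuous φ) :
    Nice fun z => a (φ z) := by
  obtain ⟨C, hC⟩ := ha.bdd
  exact ⟨ha.cont.comp hφ, C, fun z => hC _⟩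

theorem Nice.const (a : BddFun 𝕜 ν) : Nice fun _ : Y => a := by
  obtain ⟨C, -, hC⟩ := exists_normLe a
  exact ⟨continuous_const, C, fun _ => hC⟩

/-- In ab − a₀b₀ = a(b − b₀) + b₀(a − a₀), the uniform essential bounds make multiplication
continuous for the L² norm. -/
theorem Nice.mul {a b : Y → BddFun 𝕜 ν} (ha : Nice a) (hb : Nice b) :
    Nice fun y => a y * b y := by
  obtain ⟨C, hC⟩ := ha.bdd
  obtain ⟨D, hD⟩ := hb.bdd
  refine ⟨continuous_iff_continuousAt.2 fun y₀ => ?_, C * D, fun y => (hC y).mul (hD y)⟩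
  rw [ContinuousAt, tendsto_iff_norm_sub_tendsto_zero]
  have h1 : Tendsto (fun y => C * ‖(b y : Lp 𝕜 2 ν) - b y₀‖ + D * ‖(a y : Lp 𝕜 2 ν) - a y₀‖)
      (𝓝 y₀) (𝓝 0) := by
    have e1 := tendsto_iff_norm_sub_tendsto_zero.1 (hb.cont.tendsto y₀)
    have e2 := tendsto_iff_norm_sub_tendsto_zero.1 (ha.cont.tendsto y₀)
    simpa using (e1.const_mul C).add (e2.const_mul D)
  refine squeeze_zero (fun _ => norm_nonneg _) (fun y => ?_) h1
  have e : ((a y * b y : BddFun 𝕜 ν) : Lp 𝕜 2 ν) - (a y₀ * b y₀ : BddFun 𝕜 ν) =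
      mulL (a y) ((b y : Lp 𝕜 2 ν) - b y₀) + mulL (b y₀) ((a y : Lp 𝕜 2 ν) - a y₀) := by
    rw [map_sub, map_sub, mulL_coe, mulL_coe, mulL_coe, mulL_coe, mul_comm (b y₀) (a y),
      mul_comm (b y₀) (a y₀)]
    abel
  rw [e]
  exact (norm_add_le _ _).trans (add_le_add (norm_mulL_le (hC y) _) (norm_mulL_le (hD y₀) _))

theorem Nice.prod {κ : Type*} (s : Finset κ) {a : κ → Y → BddFun 𝕜 ν} (ha : ∀ i ∈ s, Nice (a i)) :
    Nice fun y => ∏ i ∈ s, a i y := by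
  classical
  induction s using Finset.induction_on with
  | empty => simpa using Nice.const 1
  | insert i s hi ih =>
    simp only [Finset.prod_insert hi]
    exact (ha i (Finset.mem_insert_self i s)).mul
      (ih fun k hk => ha k (Finset.mem_insert_of_mem hk))

theorem Nice.star {a : Y → BddFun 𝕜 ν} (ha : Nice a) : Nice fun y => star (a y) := by
  obtain ⟨C, hC⟩ := ha.bdd
  refine ⟨continuous_iff_continuousAt.2 fun y₀ => ?_, C, fun y => (hC y).star⟩
  rw [ContinuousAt, tendsto_iff_norm_sub_tendsto_zero]
  refine squeeze_zero (fun _ => norm_nonneg _) (fun y => ?_)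
    (tendsto_iff_norm_sub_tendsto_zero.1 (ha.cont.tendsto y₀))
  refine Lp.norm_le_norm_of_ae_le ?_
  filter_upwards [Lp.coeFn_sub ((Star.star (a y) : BddFun 𝕜 ν) : Lp 𝕜 2 ν)
    ((Star.star (a y₀) : BddFun 𝕜 ν) : Lp 𝕜 2 ν), Lp.coeFn_sub (a y : Lp 𝕜 2 ν) (a y₀ : Lp 𝕜 2 ν),
    coe_star_ae (a y), coe_star_ae (a y₀)] with x h1 h2 h3 h4
  rw [h1, h2, Pi.sub_apply, Pi.sub_apply, h3, h4, ← star_sub, norm_star]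

theorem Nice.add {a b : Y → BddFun 𝕜 ν} (ha : Nice a) (hb : Nice b) : Nice fun y => a y + b y := by
  obtain ⟨C, hC⟩ := ha.bdd
  obtain ⟨D, hD⟩ := hb.bdd
  exact ⟨ha.cont.add hb.cont, C + D, fun y => (hC y).add (hD y)⟩

theorem Nice.smul {a : Y → BddFun 𝕜 ν} (ha : Nice a) (c : 𝕜) : Nice fun y => c • a y := by
  obtain ⟨C, hC⟩ := ha.bdd
  exact ⟨ha.cont.const_smul c, ‖c‖ * C, fun y => (hC y).smul c⟩

theorem Nice.exists_norm_le {a : Y → BddFun 𝕜 ν} (ha : Nice a) :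
    ∃ C, ∀ y, ‖(a y : Lp 𝕜 2 ν)‖ ≤ C := by
  obtain ⟨C, hC⟩ := ha.bdd
  exact ⟨C, fun y => (hC y).norm_le⟩

/-- Bounded continuous maps into a normed space have bounded continuous square norms. -/
theorem IsBC.norm_sq {E : Type*} [NormedAddCommGroup E] {x : Y → E} (hx : Continuous x)
    (hb : ∃ C, ∀ y, ‖x y‖ ≤ C) : IsBC fun y => ‖x y‖ ^ 2 := by
  obtain ⟨C, hC⟩ := hb
  refine ⟨by fun_prop, C ^ 2, fun y => ?_⟩
  rw [abs_of_nonneg (by positivity)]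
  gcongr; exact hC y

theorem Nice.isBC_norm_sq {a : Y → BddFun 𝕜 ν} (ha : Nice a) :
    IsBC fun y => ‖(a y : Lp 𝕜 2 ν)‖ ^ 2 :=
  IsBC.norm_sq ha.cont ha.exists_norm_le

theorem IsBC.norm_sub_sq {E : Type*} [NormedAddCommGroup E] {x y : Y → E} (hx : Continuous x)
    (hb : ∃ C, ∀ z, ‖x z‖ ≤ C) (hy : Continuous y) (hb' : ∃ C, ∀ z, ‖y z‖ ≤ C) :
    IsBC fun z => ‖x z - y z‖ ^ 2 := by
  obtain ⟨C, hC⟩ := hb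
  obtain ⟨D, hD⟩ := hb'
  exact IsBC.norm_sq (hx.sub hy) ⟨C + D, fun z => (norm_sub_le _ _).trans
    (add_le_add (hC z) (hD z))⟩

theorem Nice.isBC_norm_sub_sq {a b : Y → BddFun 𝕜 ν} (ha : Nice a) (hb : Nice b) :
    IsBC fun y => ‖(a y : Lp 𝕜 2 ν) - b y‖ ^ 2 :=
  IsBC.norm_sub_sq ha.cont ha.exists_norm_le hb.cont hb.exists_norm_le

variable {G : Subgroup (Lp 𝕜 2 ν ≃ₗᵢ[𝕜] Lp 𝕜 2 ν)} (hG : ∀ U ∈ G, ActsOnLInfty U)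

/-- Continuity in the strong operator topology. -/
def StrongCont (u : Y → G) : Prop :=
  ∀ v : Lp 𝕜 2 ν, Continuous fun y => (u y : Lp 𝕜 2 ν ≃ₗᵢ[𝕜] Lp 𝕜 2 ν) v

theorem StrongCont.apply {u : Y → G} (hu : StrongCont u) {x : Y → Lp 𝕜 2 ν} (hx : Continuous x) :
    Continuous fun y => (u y : Lp 𝕜 2 ν ≃ₗᵢ[𝕜] Lp 𝕜 2 ν) (x y) := by
  refine continuous_iff_continuousAt.2 fun y₀ => ?_
  rw [ContinuousAt, tendsto_iff_norm_sub_tendsto_zero]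
  have h1 : Tendsto (fun y => ‖x y - x y₀‖ + ‖(u y : Lp 𝕜 2 ν ≃ₗᵢ[𝕜] Lp 𝕜 2 ν) (x y₀) -
      (u y₀ : Lp 𝕜 2 ν ≃ₗᵢ[𝕜] Lp 𝕜 2 ν) (x y₀)‖) (𝓝 y₀) (𝓝 0) := by
    simpa using (tendsto_iff_norm_sub_tendsto_zero.1 (hx.tendsto y₀)).add
      (tendsto_iff_norm_sub_tendsto_zero.1 ((hu (x y₀)).tendsto y₀))
  refine squeeze_zero (fun _ => norm_nonneg _) (fun y => ?_) h1
  rw [← (u y : Lp 𝕜 2 ν ≃ₗᵢ[𝕜] Lp 𝕜 2 ν).norm_map (x y - x y₀), map_sub]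
  exact norm_sub_le_norm_sub_add_norm_sub _ _ _

theorem StrongCont.mul {u w : Y → G} (hu : StrongCont u) (hw : StrongCont w) :
    StrongCont fun y => u y * w y :=
  fun v => hu.apply (hw v)

/-- For isometries, ‖u⁻¹v − w‖ = ‖v − uw‖. -/
theorem StrongCont.inv {u : Y → G} (hu : StrongCont u) : StrongCont fun y => (u y)⁻¹ := by
  intro v
  refine continuous_iff_continuousAt.2 fun y₀ => ?_
  rw [ContinuousAt, tendsto_iff_norm_sub_tendsto_zero]
  set w := ((u y₀)⁻¹ : G).1 v with hw
  have hv : (u y₀).1 w = v := by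
    change ((u y₀ * (u y₀)⁻¹ : G) : Lp 𝕜 2 ν ≃ₗᵢ[𝕜] Lp 𝕜 2 ν) v = v
    rw [mul_inv_cancel]; rfl
  refine (tendsto_iff_norm_sub_tendsto_zero.1 ((hu w).tendsto y₀)).congr fun y => ?_
  have h2 : (u y : Lp 𝕜 2 ν ≃ₗᵢ[𝕜] Lp 𝕜 2 ν) (((u y)⁻¹ : G).1 v) = v := by
    change ((u y * (u y)⁻¹ : G) : Lp 𝕜 2 ν ≃ₗᵢ[𝕜] Lp 𝕜 2 ν) v = v
    rw [mul_inv_cancel]; rfl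
  calc _ = ‖(u y).1 w - v‖ := by rw [hv]
    _ = ‖(u y : Lp 𝕜 2 ν ≃ₗᵢ[𝕜] Lp 𝕜 2 ν) (((u y)⁻¹ : G).1 v - w)‖ := by
      rw [map_sub, h2, norm_sub_rev]
    _ = _ := LinearIsometryEquiv.norm_map _ _

theorem StrongCont.comp {u : Y → G} (hu : StrongCont u) {φ : Z → Y} (hφ : Continuous φ) :
    StrongCont fun z => u (φ z) :=
  fun v => (hu v).comp hφ

theorem StrongCont.slice {p : Y × Z → G} (hp : StrongCont p) (y : Y) :
    StrongCont fun n => p (y, n) :=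
  hp.comp (by fun_prop)

theorem StrongCont.one : StrongCont fun _ : Y => (1 : G) := fun _ => continuous_const

theorem Nice.act {u : Y → G} (hu : StrongCont u) {a : Y → BddFun 𝕜 ν} (ha : Nice a) :
    Nice fun y => _root_.act hG (u y) (a y) := by
  obtain ⟨C, hC⟩ := ha.bdd
  exact ⟨hu.apply ha.cont, C, fun y => (hC y).act hG _⟩

variable {Γ : Type*} [Group Γ] [TopologicalSpace Γ] [IsTopologicalGroup Γ] [LocallyCompactSpace Γ]
  [T2Space Γ] [MeasurableSpace Γ] [BorelSpace Γ] {μ : Measure Γ} [μ.IsHaarMeasure]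

open Classical in
/-- Averages of families of bounded functions. -/
noncomputable def bddAvg (F : FolnerSet μ) (a : Γ → BddFun 𝕜 ν) : BddFun 𝕜 ν :=
  -- The value 0 never occurs for a nice family, by `coe_bddAvg`.
  if h : IsEssBounded (∫ n, (a n : Lp 𝕜 2 ν) ∂F.prob) then ⟨_, h⟩ else 0

theorem coe_bddAvg (F : FolnerSet μ) {a : Γ → BddFun 𝕜 ν} (ha : Nice a) :
    (bddAvg F a : Lp 𝕜 2 ν) = ∫ n, (a n : Lp 𝕜 2 ν) ∂F.prob := by
  obtain ⟨C, hC⟩ := ha.bdd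
  have h : IsEssBounded (∫ n, (a n : Lp 𝕜 2 ν) ∂F.prob) :=
    (ofNormLe _ (normLe_integral hC (F.integrable ha.cont))).2
  rw [bddAvg, dif_pos h]

theorem normLe_bddAvg (F : FolnerSet μ) {a : Γ → BddFun 𝕜 ν} (ha : Nice a) {C : ℝ}
    (hC : ∀ n, NormLe C (a n : Lp 𝕜 2 ν)) : NormLe C (bddAvg F a : Lp 𝕜 2 ν) := by
  rw [coe_bddAvg F ha]
  exact normLe_integral hC (F.integrable ha.cont)

theorem Nice.slice {a : Y × Γ → BddFun 𝕜 ν} (ha : Nice a) (y : Y) : Nice fun n => a (y, n) :=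
  ha.comp (by fun_prop)

theorem Nice.bddAvg {F : Y → FolnerSet μ} (hF : Continuous F) {a : Y × Γ → BddFun 𝕜 ν}
    (ha : Nice a) : Nice fun y => _root_.bddAvg (F y) fun n => a (y, n) := by
  obtain ⟨C, hC⟩ := ha.bdd
  refine ⟨?_, C, fun y => normLe_bddAvg (F y) (ha.slice y) fun n => hC _⟩
  simp only [coe_bddAvg _ (ha.slice _)]
  exact FolnerSet.continuous_integral_of_continuous hF ha.cont

/-- The average of `W n * p n v`. -/
noncomputable def weightedAvg (W : Γ → BddFun 𝕜 ν) (p : Γ → G) (F : FolnerSet μ)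
    (v : BddFun 𝕜 ν) : BddFun 𝕜 ν :=
  bddAvg F fun n => W n * act hG (p n) v

/-- The average of `(p n)⁻¹ (w n)`. -/
noncomputable def dualAvg (p : Γ → G) (F : FolnerSet μ) (w : Γ → BddFun 𝕜 ν) : BddFun 𝕜 ν :=
  bddAvg F fun n => act hG (p n)⁻¹ (w n)

theorem nice_weightedAvg {W : Y × Γ → BddFun 𝕜 ν} (hW : Nice W) {p : Y × Γ → G}
    (hp : StrongCont p) {F : Y → FolnerSet μ} (hF : Continuous F) {v : Y → BddFun 𝕜 ν}
    (hv : Nice v) : Nice fun y => weightedAvg hG (fun n => W (y, n)) (fun n => p (y, n)) (F y) (v y) :=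
  Nice.bddAvg hF (a := fun z => W z * act hG (p z) (v z.1))
    (hW.mul (Nice.act hG hp (hv.comp continuous_fst)))

theorem nice_dualAvg {p : Y × Γ → G} (hp : StrongCont p) {F : Y → FolnerSet μ} (hF : Continuous F)
    {w : Y × Γ → BddFun 𝕜 ν} (hw : Nice w) :
    Nice fun y => dualAvg hG (fun n => p (y, n)) (F y) fun n => w (y, n) :=
  Nice.bddAvg hF (a := fun z => act hG (p z)⁻¹ (w z)) (Nice.act hG hp.inv hw)

section Pointwise

variable {W : Γ → BddFun 𝕜 ν} (hW : Nice W) {p : Γ → G} (hp : StrongCont p) (F : FolnerSet μ)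
include hW hp

theorem nice_weight (v : BddFun 𝕜 ν) : Nice fun n => W n * act hG (p n) v :=
  hW.mul (Nice.act hG hp (Nice.const v))

theorem coe_weightedAvg (v : BddFun 𝕜 ν) : (weightedAvg hG W p F v : Lp 𝕜 2 ν) =
    ∫ n, ((W n * act hG (p n) v : BddFun 𝕜 ν) : Lp 𝕜 2 ν) ∂F.prob :=
  coe_bddAvg F (nice_weight hG hW hp v)

theorem weightedAvg_add_smul (v w : BddFun 𝕜 ν) (c : 𝕜) :
    (weightedAvg hG W p F (v + c • w) : Lp 𝕜 2 ν) =
      weightedAvg hG W p F v + c • (weightedAvg hG W p F w : Lp 𝕜 2 ν) := by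
  rw [coe_weightedAvg hG hW hp, coe_weightedAvg hG hW hp, coe_weightedAvg hG hW hp,
    ← integral_smul]
  refine Eq.trans (integral_congr_ae (Eventually.of_forall fun n => ?_))
    (integral_add (F.integrable (nice_weight hG hW hp v).cont)
      ((F.integrable (nice_weight hG hW hp w).cont).smul c))
  simp only [act_add, act_smul, mul_add', mul_smul']
  rfl

theorem norm_weightedAvg_le {C : ℝ} (hC : ∀ n, NormLe C (W n : Lp 𝕜 2 ν)) (v : BddFun 𝕜 ν) :
    ‖(weightedAvg hG W p F v : Lp 𝕜 2 ν)‖ ≤ C * ‖(v : Lp 𝕜 2 ν)‖ := by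
  rw [coe_weightedAvg hG hW hp]
  refine F.norm_integral_le fun n _ => ?_
  rw [← norm_act hG (p n) v]
  exact norm_mul_le (hC n) _

/-- The adjoint of v ↦ `weightedAvg` v sends h to `dualAvg` of star W * h; here h is the weighted
average of v itself. -/
theorem inner_dualAvg (v : BddFun 𝕜 ν) :
    RCLike.re (inner 𝕜 (v : Lp 𝕜 2 ν) (dualAvg hG p F fun n =>
      star (W n) * weightedAvg hG W p F v : BddFun 𝕜 ν)) =
      ‖(weightedAvg hG W p F v : Lp 𝕜 2 ν)‖ ^ 2 := by
  set h := weightedAvg hG W p F v with hh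
  have hn : Nice fun n => act hG (p n)⁻¹ (star (W n) * h) :=
    Nice.act hG hp.inv (hW.star.mul (Nice.const h))
  have hi := F.integrable hn.cont
  have hi2 := F.integrable (nice_weight hG hW hp v).cont
  rw [dualAvg, coe_bddAvg F hn, ← integral_inner hi]
  have e : ∀ n, inner 𝕜 (v : Lp 𝕜 2 ν) (act hG (p n)⁻¹ (star (W n) * h) : Lp 𝕜 2 ν) =
      starRingEnd 𝕜 (inner 𝕜 (h : Lp 𝕜 2 ν) (W n * act hG (p n) v : BddFun 𝕜 ν)) := by
    intro n
    rw [← inner_act_act hG (p n), act_act_inv, inner_conj_symm, ← mulL_coe, ← mulL_coe,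
      inner_mul_left]
  simp only [e]
  rw [integral_conj, integral_inner hi2, ← coe_weightedAvg hG hW hp, ← hh, inner_conj_symm,
    inner_self_eq_norm_sq]

theorem norm_dualAvg_le {C : ℝ} (hC : ∀ n, NormLe C (W n : Lp 𝕜 2 ν)) (h : BddFun 𝕜 ν) :
    ‖(dualAvg hG p F fun n => star (W n) * h : Lp 𝕜 2 ν)‖ ≤ C * ‖(h : Lp 𝕜 2 ν)‖ := by
  have hn : Nice fun n => act hG (p n)⁻¹ (star (W n) * h) :=
    Nice.act hG hp.inv (hW.star.mul (Nice.const h))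
  rw [dualAvg, coe_bddAvg F hn]
  refine F.norm_integral_le fun n _ => ?_
  rw [norm_act]
  exact norm_mul_le (hC n).star _

/-- For l ∈ F', asymptotic invariance of F allows n to be replaced by lm in the dual average, at
cost Dδ. Then W(l) p(l) moves under the integral and the two averages are exchanged. -/
theorem weightedAvg_dualAvg {w : Γ → BddFun 𝕜 ν} (hw : Nice w) {C D δ : ℝ}
    (hC : ∀ n, NormLe C (W n : Lp 𝕜 2 ν)) (hD : ∀ n, NormLe D (w n : Lp 𝕜 2 ν)) (hδ : 0 ≤ δ)
    (F' : FolnerSet μ) (hF : ∀ l ∈ F'.carrier,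
      μ (symmDiff (l • F.carrier) F.carrier) ≤ ENNReal.ofReal δ * μ F.carrier) :
    ‖(weightedAvg hG W p F' (dualAvg hG p F w) : Lp 𝕜 2 ν) -
      ∫ m, ((bddAvg F' fun l => W l * act hG (p l * (p (l * m))⁻¹) (w (l * m)) : BddFun 𝕜 ν) :
        Lp 𝕜 2 ν) ∂F.prob‖ ≤ C * (D * δ) := by
  have hn : Nice fun n => act hG (p n)⁻¹ (w n) := Nice.act hG hp.inv hw
  have hΦ : Nice fun z : Γ × Γ => W z.1 * act hG (p z.1 * (p (z.1 * z.2))⁻¹) (w (z.1 * z.2)) :=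
    (hW.comp continuous_fst).mul (Nice.act hG ((hp.comp continuous_fst).mul
      (hp.comp (φ := fun z : Γ × Γ => z.1 * z.2) (by fun_prop)).inv)
      (hw.comp (φ := fun z : Γ × Γ => z.1 * z.2) (by fun_prop)))
  have e1 : ∀ m, (bddAvg F' fun l => W l * act hG (p l * (p (l * m))⁻¹) (w (l * m)) :
      Lp 𝕜 2 ν) = ∫ l, ((W l * act hG (p l * (p (l * m))⁻¹) (w (l * m)) : BddFun 𝕜 ν) : Lp 𝕜 2 ν)
        ∂F'.prob := fun m =>
    coe_bddAvg F' (hΦ.comp (φ := fun l : Γ => (l, m)) (by fun_prop))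
  rw [integral_congr_ae (Eventually.of_forall e1), ← FolnerSet.integral_swap F F' hΦ.cont, coe_weightedAvg hG hW hp,
    ← integral_sub (F'.integrable (nice_weight hG hW hp _).cont)
      (F'.integrable (F.continuous_integral hΦ.cont))]
  refine F'.norm_integral_le fun l hl => ?_
  have e2 : (∫ m, ((W l * act hG (p l * (p (l * m))⁻¹) (w (l * m)) : BddFun 𝕜 ν) : Lp 𝕜 2 ν)
      ∂F.prob) = mulL (W l) ((p l : Lp 𝕜 2 ν ≃ₗᵢ[𝕜] Lp 𝕜 2 ν)
        (∫ m, (act hG (p (l * m))⁻¹ (w (l * m)) : Lp 𝕜 2 ν) ∂F.prob)) := by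
    have hint : Integrable (fun m => (act hG (p (l * m))⁻¹ (w (l * m)) : Lp 𝕜 2 ν)) F.prob :=
      F.integrable (hn.comp (φ := fun m : Γ => l * m) (by fun_prop)).cont
    have h1 := ((mulL (W l)).comp
      ((p l : Lp 𝕜 2 ν ≃ₗᵢ[𝕜] Lp 𝕜 2 ν).toContinuousLinearEquiv : Lp 𝕜 2 ν →L[𝕜] Lp 𝕜 2 ν)).integral_comp_comm hint
    refine Eq.trans (integral_congr_ae (Eventually.of_forall fun m => ?_)) h1
    simp only [← mulL_coe, act_mul_act]
    rfl
  rw [e2, ← mulL_coe, coe_act, ← map_sub, ← map_sub]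
  refine (norm_mulL_le (hC l) _).trans ?_
  have hC0 := (hC 1).nonneg
  rw [LinearIsometryEquiv.norm_map, dualAvg, coe_bddAvg F hn]
  gcongr
  exact F.norm_integral_sub_translate_le hn.cont (fun n => ((hD n).act hG _).norm_le) l hδ (hF l hl)

end Pointwise

end NiceFamilies

/-! ### Convergence of averages of dual functions -/

section DualAverages

open BddFun

variable {Γ : Type*} [Group Γ] [TopologicalSpace Γ] [IsTopologicalGroup Γ] [LocallyCompactSpace Γ]
  [T2Space Γ] [MeasurableSpace Γ] [BorelSpace Γ] {μ : Measure Γ} [μ.IsHaarMeasure]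

theorem FolnerSet.norm_integral_sq_le (F : FolnerSet μ) {E : Type*} [NormedAddCommGroup E]
    [NormedSpace ℝ E] {a : Γ → E} (ha : Continuous a) :
    ‖∫ n, a n ∂F.prob‖ ^ 2 ≤ ∫ n, ‖a n‖ ^ 2 ∂F.prob := by
  have h1 : (∫ n, ‖a n‖ ∂F.prob) ^ 2 ≤ ∫ n, ‖a n‖ ^ 2 ∂F.prob :=
    (even_two.convexOn_pow (𝕜 := ℝ)).map_integral_le (by fun_prop) isClosed_univ
      (Eventually.of_forall fun _ => Set.mem_univ _) (F.integrable ha.norm)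
      (F.integrable (a := fun n => ‖a n‖ ^ 2) (by fun_prop))
  refine le_trans ?_ h1
  gcongr
  exact norm_integral_le_integral_norm _

variable {Y : Type*} [TopologicalSpace Y]

/-- A mean for which the sets `F y` are asymptotically invariant. -/
def Concentrated (Λ : Mean Y) (F : Y → FolnerSet μ) : Prop :=
  ∀ K : Set Γ, IsCompact K → ∀ δ > 0, ∀ φ, IsBC φ → ∀ c, (∀ y, (∀ l ∈ K,
    μ (symmDiff (l • (F y).carrier) (F y).carrier) ≤ ENNReal.ofReal δ * μ (F y).carrier) →
      φ y ≤ c) → Λ φ ≤ c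

/-- Since q refines the Følner filter, the adjoined set is as invariant as desired for q-almost
every value. -/
theorem concentrated_limit (Λ : Mean Y) {q : Ultrafilter (FolnerSet μ)} (hq : ↑q ≤ folner μ) :
    Concentrated (Λ.limit q) Prod.snd := by
  intro K hK δ hδ φ hφ c h
  refine le_of_tendsto (Λ.tendsto_limit q hφ) ?_
  filter_upwards [hq (eventually_folner hK hδ)] with F hF
  rw [← Λ.map_const c]
  exact Λ.mono (hφ.comp (by fun_prop)) (IsBC.const c) fun y => h (y, F) hF

variable {X : Type*} [MeasurableSpace X] {ν : Measure X} [IsProbabilityMeasure ν]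
  {𝕜 : Type*} [RCLike 𝕜]

/-- Convergence of averages in square mean. -/
def MeanCauchy (Λ : Mean Y) (A : FolnerSet μ → Y → BddFun 𝕜 ν) : Prop :=
  ∀ ε > 0, ∀ᶠ Q in folner μ ×ˢ folner μ,
    Λ (fun y => ‖(A Q.1 y : Lp 𝕜 2 ν) - A Q.2 y‖ ^ 2) ≤ ε

theorem BddFun.star_one' : star (1 : BddFun 𝕜 ν) = 1 := by
  refine Subtype.ext (Lp.ext ?_)
  filter_upwards [coe_star_ae (1 : BddFun 𝕜 ν), coe_one_ae (𝕜 := 𝕜) (ν := ν)] with x h1 h2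
  rw [h1, h2, star_one]

theorem BddFun.star_mul_eq (a b : BddFun 𝕜 ν) : star (a * b) = star a * star b := by
  refine Subtype.ext (Lp.ext ?_)
  filter_upwards [coe_star_ae (a * b), coe_star_ae a, coe_star_ae b, coe_mul_ae a b,
    coe_mul_ae (star a) (star b)] with x h1 h2 h3 h4 h5
  rw [h1, h4, h5, h2, h3, star_mul']

variable {G : Subgroup (Lp 𝕜 2 ν ≃ₗᵢ[𝕜] Lp 𝕜 2 ν)} (hG : ∀ U ∈ G, ActsOnLInfty U)

/-- The averages obtained by applying `weightedAvg` to a `dualAvg` and exchanging the order of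
integration. -/
noncomputable def vdcAvg (W w : Y × Γ → BddFun 𝕜 ν) (p : Y × Γ → G) (F : FolnerSet μ)
    (z : Y × Γ) : BddFun 𝕜 ν :=
  bddAvg F fun l => W (z.1, l) * act hG (p (z.1, l) * (p (z.1, l * z.2))⁻¹) (w (z.1, l * z.2))

theorem nice_vdcAvg {W w : Y × Γ → BddFun 𝕜 ν} {p : Y × Γ → G} (hW : Nice W) (hw : Nice w)
    (hp : StrongCont p) (F : FolnerSet μ) : Nice (vdcAvg hG W w p F) := by
  have c1 : Continuous fun x : (Y × Γ) × Γ => (x.1.1, x.2) := by fun_prop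
  have c2 : Continuous fun x : (Y × Γ) × Γ => (x.1.1, x.2 * x.1.2) := by fun_prop
  exact Nice.bddAvg (F := fun _ : Y × Γ => F) continuous_const
    (a := fun x : (Y × Γ) × Γ => W (x.1.1, x.2) *
      act hG (p (x.1.1, x.2) * (p (x.1.1, x.2 * x.1.2))⁻¹) (w (x.1.1, x.2 * x.1.2)))
    ((hW.comp c1).mul (Nice.act hG ((hp.comp c1).mul (hp.comp c2).inv) (hw.comp c2)))

/-- By `weightedAvg_dualAvg`, the difference of two averages is, up to a small error, an average
over m ∈ F y of differences of `vdcAvg`. Jensen's inequality bounds its square by the mean in which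
m is adjoined as a parameter. -/
theorem meanCauchy_dualAvg {W w : Y × Γ → BddFun 𝕜 ν} {p : Y × Γ → G} (hW : Nice W) (hw : Nice w)
    (hp : StrongCont p) {F : Y → FolnerSet μ} (hF : Continuous F) {Λ : Mean Y}
    (hΛ : Concentrated Λ F) (hR : MeanCauchy (Λ.average hF) (vdcAvg (μ := μ) hG W w p)) :
    MeanCauchy Λ fun (F' : FolnerSet μ) y => weightedAvg hG (fun n => W (y, n)) (fun n => p (y, n)) F'
      (dualAvg hG (fun n => p (y, n)) (F y) fun n => w (y, n)) := by
  intro ε hε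
  obtain ⟨C, hC⟩ := hW.bdd
  obtain ⟨D, hD⟩ := hw.bdd
  -- An error of e = min 1 (ε / 16) in each average contributes 2 (2e)² ≤ ε / 2, and twice the bound
  -- ε / 4 from `hR` gives the other half.
  obtain ⟨δ, hδ, hCD⟩ := exists_pos_mul_lt (show 0 < min 1 (ε / 16) by positivity) (C * D)
  have hσ := nice_dualAvg hG hp hF hw
  filter_upwards [hR (ε / 4) (by positivity)] with Q hQ
  have hA : ∀ F' : FolnerSet μ, Nice fun y => weightedAvg hG (fun n => W (y, n)) (fun n => p (y, n)) F'
      (dualAvg hG (fun n => p (y, n)) (F y) fun n => w (y, n)) := fun F' =>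
    nice_weightedAvg hG hW hp continuous_const hσ
  have hRn := fun F' : FolnerSet μ => nice_vdcAvg hG hW hw hp F'
  have b1 := (hA Q.1).isBC_norm_sub_sq (hA Q.2)
  have b2 := ((hRn Q.1).isBC_norm_sub_sq (hRn Q.2)).integral hF
  have key := hΛ _ (Q.1.isCompact.union Q.2.isCompact) δ hδ _ (b1.add (b2.smul (-2))) (ε / 2)
    fun y hy => by
      have hZ : ∀ F' : FolnerSet μ, (∀ l ∈ F'.carrier, μ (symmDiff (l • (F y).carrier)
          (F y).carrier) ≤ ENNReal.ofReal δ * μ (F y).carrier) →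
          ‖(weightedAvg hG (fun n => W (y, n)) (fun n => p (y, n)) F'
            (dualAvg hG (fun n => p (y, n)) (F y) fun n => w (y, n)) : Lp 𝕜 2 ν) -
            ∫ m, (vdcAvg hG W w p F' (y, m) : Lp 𝕜 2 ν) ∂(F y).prob‖ ≤ min 1 (ε / 16) := by
        intro F' hF'
        refine (weightedAvg_dualAvg hG (hW.slice y) (hp.slice y) (F y) (hw.slice y)
          (fun n => hC _) (fun n => hD _) hδ.le F' hF').trans ?_
        rw [← mul_assoc]; exact hCD.le
      have h1 := hZ Q.1 fun l hl => hy l (Or.inl hl)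
      have h2 := hZ Q.2 fun l hl => hy l (Or.inr hl)
      have c1 := ((hRn Q.1).slice y).cont
      have c2 := ((hRn Q.2).slice y).cont
      have h3 := (F y).norm_integral_sq_le (c1.sub c2)
      simp only [Pi.sub_apply] at h3
      rw [integral_sub ((F y).integrable c1) ((F y).integrable c2)] at h3
      set a₁ := (weightedAvg hG (fun n => W (y, n)) (fun n => p (y, n)) Q.1
            (dualAvg hG (fun n => p (y, n)) (F y) fun n => w (y, n)) : Lp 𝕜 2 ν)
      set a₂ := (weightedAvg hG (fun n => W (y, n)) (fun n => p (y, n)) Q.2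
            (dualAvg hG (fun n => p (y, n)) (F y) fun n => w (y, n)) : Lp 𝕜 2 ν)
      set z₁ := ∫ m, (vdcAvg hG W w p Q.1 (y, m) : Lp 𝕜 2 ν) ∂(F y).prob
      set z₂ := ∫ m, (vdcAvg hG W w p Q.2 (y, m) : Lp 𝕜 2 ν) ∂(F y).prob
      have h4 : ‖a₁ - a₂‖ ≤ 2 * min 1 (ε / 16) + ‖z₁ - z₂‖ := by
        have : a₁ - a₂ = (a₁ - z₁) - (a₂ - z₂) + (z₁ - z₂) := by abel
        rw [this]
        refine (norm_add_le _ _).trans ?_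
        have := norm_sub_le (a₁ - z₁) (a₂ - z₂)
        linarith
      have h5 : ‖a₁ - a₂‖ ^ 2 ≤ 2 * (2 * min 1 (ε / 16)) ^ 2 + 2 * ‖z₁ - z₂‖ ^ 2 := by
        have := pow_le_pow_left₀ (norm_nonneg _) h4 2
        nlinarith [sq_nonneg (2 * min 1 (ε / 16) - ‖z₁ - z₂‖)]
      have hm1 : min 1 (ε / 16) ≤ 1 := min_le_left _ _
      have hm2 : min 1 (ε / 16) ≤ ε / 16 := min_le_right _ _
      have hm0 : 0 ≤ min 1 (ε / 16) := by positivity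
      have h6 : min 1 (ε / 16) ^ 2 ≤ ε / 16 := by nlinarith
      linarith
  rw [Λ.map_add _ _ b1 (b2.smul (-2)), Λ.map_smul _ _ b2] at key
  have hQ' : Λ (fun y => ∫ n, ‖(vdcAvg hG W w p Q.1 (y, n) : Lp 𝕜 2 ν) -
    vdcAvg hG W w p Q.2 (y, n)‖ ^ 2 ∂(F y).prob) ≤ ε / 4 := hQ
  linarith

end DualAverages

/-! ### Systems of maps and their reduction -/

section Systems

open BddFun

universe u

variable {Γ : Type u} [Group Γ] [TopologicalSpace Γ] [IsTopologicalGroup Γ] [LocallyCompactSpace Γ]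
  [T2Space Γ] [MeasurableSpace Γ] [BorelSpace Γ] {μ : Measure Γ} [μ.IsHaarMeasure]
  {X : Type*} [MeasurableSpace X] {ν : Measure X} [IsProbabilityMeasure ν]
  {𝕜 : Type*} [RCLike 𝕜]
  {G : Subgroup (Lp 𝕜 2 ν ≃ₗᵢ[𝕜] Lp 𝕜 2 ν)} (hG : ∀ U ∈ G, ActsOnLInfty U)
  {Ω Ω' : Type u} [TopologicalSpace Ω] [TopologicalSpace Ω']

/-- The product of the functions `f i ω` transformed by `q i ω n`. -/
noncomputable def sysProd {κ : Type*} (s : Finset κ) (q : κ → Ω → Γ → G)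
    (f : κ → Ω → BddFun 𝕜 ν) (z : Ω × Γ) : BddFun 𝕜 ν :=
  ∏ i ∈ s, act hG (q i z.1 z.2) (f i z.1)

/-- The averages of `sysProd`. -/
noncomputable def sysAvg {κ : Type*} (s : Finset κ) (q : κ → Ω → Γ → G)
    (f : κ → Ω → BddFun 𝕜 ν) (F : FolnerSet μ) (ω : Ω) : BddFun 𝕜 ν :=
  bddAvg F fun n => sysProd hG s q f (ω, n)

theorem nice_sysProd {κ : Type*} {s : Finset κ} {q : κ → Ω → Γ → G} {f : κ → Ω → BddFun 𝕜 ν}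
    (hq : ∀ i ∈ s, StrongCont fun z : Ω × Γ => q i z.1 z.2) (hf : ∀ i, Nice (f i)) :
    Nice (sysProd hG s q f) :=
  Nice.prod s fun i hi => Nice.act hG (hq i hi) ((hf i).comp continuous_fst)

/-- Systems of maps all of whose averages converge. -/
def Good (μ : Measure Γ) [μ.IsHaarMeasure] (S : Finset (Ω → Γ → G)) : Prop :=
  ∀ (Λ : Mean Ω) (f : (Ω → Γ → G) → Ω → BddFun 𝕜 ν), (∀ i, Nice (f i)) →
    MeanCauchy (μ := μ) Λ (sysAvg hG S id f)

/-- Factors moved by the same map are multiplied together first, so a family with repetitions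
reduces to the set of its maps. -/
theorem Good.meanCauchy {S : Finset (Ω → Γ → G)} (hS : Good hG μ S) {κ : Type*} {s : Finset κ}
    {q : κ → Ω → Γ → G} (hq : ∀ i ∈ s, q i ∈ S) {f : κ → Ω → BddFun 𝕜 ν} (hf : ∀ i, Nice (f i))
    (Λ : Mean Ω) : MeanCauchy (μ := μ) Λ (sysAvg hG s q f) := by
  classical
  have key := hS Λ (fun g ω => ∏ i ∈ s with q i = g, f i ω) fun g =>
    Nice.prod _ fun i _ => hf i
  have e : sysProd hG S id (fun g ω => ∏ i ∈ s with q i = g, f i ω) = sysProd hG s q f := by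
    funext z
    simp only [sysProd, id]
    rw [← Finset.prod_fiberwise_of_maps_to hq]
    refine Finset.prod_congr rfl fun g _ => ?_
    rw [act_prod]
    refine Finset.prod_congr rfl fun i hi => ?_
    rw [(Finset.mem_filter.1 hi).2]
  have e' : sysAvg (μ := μ) hG S id (fun g ω => ∏ i ∈ s with q i = g, f i ω) = sysAvg hG s q f := by
    funext F ω
    simp only [sysAvg, e]
  rwa [e'] at key

/-- The maps of the system which controls the averages `vdcAvg`. -/
noncomputable def redMap (p : Ω → Γ → G) (ψ : Ω' → Ω) (m : Ω' → Γ) :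
    (Ω → Γ → G) ⊕ Option (Ω → Γ → G) → Ω' → Γ → G
  | Sum.inl i => fun ω l => i (ψ ω) l
  | Sum.inr none => fun ω l => p (ψ ω) l * (p (ψ ω) (l * m ω))⁻¹
  | Sum.inr (some i) => fun ω l => p (ψ ω) l * (p (ψ ω) (l * m ω))⁻¹ * i (ψ ω) (l * m ω)

open Classical in
/-- The system which controls the averages `vdcAvg`. -/
noncomputable def redFinset (S : Finset (Ω → Γ → G)) (p : Ω → Γ → G) (ψ : Ω' → Ω) (m : Ω' → Γ) :
    Finset (Ω' → Γ → G) :=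
  ((S.erase p).disjSum (S.erase p).insertNone).image (redMap p ψ m)

open Classical in
-- The action respects products and conjugation, so p(l) p(lm)⁻¹ distributes over the factors. The
-- index `none` carries h, which does not depend on l.
theorem vdcAvg_eq_sysAvg (S : Finset (Ω → Γ → G)) (p : Ω → Γ → G) (ψ : Ω' → Ω)
    (e : (Ω → Γ → G) → Ω' → BddFun 𝕜 ν) (h : Ω' → BddFun 𝕜 ν) (F : FolnerSet μ) (z : Ω' × Γ) :
    vdcAvg hG (sysProd hG (S.erase p) (fun i ω => i (ψ ω)) e)
      (fun z => star (sysProd hG (S.erase p) (fun i ω => i (ψ ω)) e z) * h z.1)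
      (fun z => p (ψ z.1) z.2) F z =
    sysAvg hG ((S.erase p).disjSum (S.erase p).insertNone)
      (redMap p (fun z : Ω' × Γ => ψ z.1) Prod.snd)
      (Sum.elim (fun i z => e i z.1) fun o z => o.elim (h z.1) fun i => star (e i z.1)) F z := by
  have hstar : ∀ (s : Finset (Ω → Γ → G)) (a : (Ω → Γ → G) → BddFun 𝕜 ν),
      star (∏ i ∈ s, a i) = ∏ i ∈ s, star (a i) := by
    intro s a
    induction s using Finset.induction_on with
    | empty => exact star_one'
    | insert i s hi ih =>
      rw [Finset.prod_insert hi, Finset.prod_insert hi, ← ih, star_mul_eq]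
  unfold vdcAvg sysAvg
  congr 1
  funext l
  simp only [sysProd]
  rw [Finset.prod_disjSum, Finset.prod_insertNone, act_mul, hstar, act_prod, mul_comm _ (act hG _ (h z.1))]
  simp only [redMap, Sum.elim_inl, Sum.elim_inr, Option.elim, act_mul_act, act_star]

theorem strongCont_redMap {S : Finset (Ω → Γ → G)} {p : Ω → Γ → G} {ψ : Ω' → Ω} {m : Ω' → Γ}
    (hS : ∀ q ∈ S, StrongCont fun z : Ω × Γ => q z.1 z.2) (hp : p ∈ S) (hψ : Continuous ψ)
    (hm : Continuous m) : ∀ q ∈ redFinset S p ψ m, StrongCont fun z : Ω' × Γ => q z.1 z.2 := by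
  classical
  have c1 : Continuous fun z : Ω' × Γ => (ψ z.1, z.2) := by fun_prop
  have c2 : Continuous fun z : Ω' × Γ => (ψ z.1, z.2 * m z.1) := by fun_prop
  have hp1 := ((hS p hp).comp c1).mul ((hS p hp).comp c2).inv
  intro q hq
  obtain ⟨i, hi, rfl⟩ := Finset.mem_image.1 hq
  rcases i with i | _ | i
  · exact (hS i (Finset.mem_of_mem_erase (Finset.inl_mem_disjSum.1 hi))).comp c1
  · exact hp1
  · have := Finset.mem_of_mem_erase (Finset.some_mem_insertNone.1 (Finset.inr_mem_disjSum.1 hi))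
    exact hp1.mul ((hS i this).comp c2)

end Systems

/-! ### Energy increment: from the reduced systems to the system -/

section Step

open BddFun

universe u

variable {Γ : Type u} [Group Γ] [TopologicalSpace Γ] [IsTopologicalGroup Γ] [LocallyCompactSpace Γ]
  [T2Space Γ] [MeasurableSpace Γ] [BorelSpace Γ] {μ : Measure Γ} [μ.IsHaarMeasure]
  {X : Type*} [MeasurableSpace X] {ν : Measure X} [IsProbabilityMeasure ν]
  {𝕜 : Type*} [RCLike 𝕜]
  {G : Subgroup (Lp 𝕜 2 ν ≃ₗᵢ[𝕜] Lp 𝕜 2 ν)} (hG : ∀ U ∈ G, ActsOnLInfty U)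
  {Ω : Type u} [TopologicalSpace Ω]

/-- A small θ lets structured terms be added repeatedly without multiplying the main bound. -/
theorem norm_add_sq_le_weighted {E : Type*} [NormedAddCommGroup E] (a b : E) {θ : ℝ} (hθ : 0 < θ) :
    ‖a + b‖ ^ 2 ≤ (1 + θ) * ‖a‖ ^ 2 + (1 + θ⁻¹) * ‖b‖ ^ 2 := by
  have h1 := pow_le_pow_left₀ (norm_nonneg _) (norm_add_le a b) 2
  have h2 : 2 * (‖a‖ * ‖b‖) ≤ θ * ‖a‖ ^ 2 + θ⁻¹ * ‖b‖ ^ 2 := by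
    have h3 : 0 ≤ θ⁻¹ * (θ * ‖a‖ - ‖b‖) ^ 2 := by positivity
    have h4 : θ⁻¹ * (θ * ‖a‖ - ‖b‖) ^ 2 =
        θ * ‖a‖ ^ 2 + θ⁻¹ * ‖b‖ ^ 2 - 2 * (‖a‖ * ‖b‖) := by field_simp; ring
    linarith
  nlinarith

/-- The step c = C⁻² minimizes −2ct² + c²C²t², the bound for the change in ‖v‖². -/
theorem norm_sub_smul_sq_le {E : Type*} [NormedAddCommGroup E] [InnerProductSpace 𝕜 E] {v σ : E}
    {C t : ℝ} (hC : 0 < C) (h1 : RCLike.re (inner 𝕜 v σ) = t ^ 2)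
    (h2 : ‖σ‖ ≤ C * t) : ‖v + (-((C ^ 2)⁻¹ : ℝ) : 𝕜) • σ‖ ^ 2 ≤ ‖v‖ ^ 2 - (C ^ 2)⁻¹ * t ^ 2 := by
  have h3 := norm_add_sq (𝕜 := 𝕜) v ((-((C ^ 2)⁻¹ : ℝ) : 𝕜) • σ)
  have h4 : RCLike.re (inner 𝕜 v ((-((C ^ 2)⁻¹ : ℝ) : 𝕜) • σ)) = -(C ^ 2)⁻¹ * t ^ 2 := by
    rw [inner_smul_right, ← h1, ← RCLike.ofReal_neg, RCLike.re_ofReal_mul]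
  have h5 : ‖(-((C ^ 2)⁻¹ : ℝ) : 𝕜) • σ‖ = (C ^ 2)⁻¹ * ‖σ‖ := by
    rw [norm_smul, ← RCLike.ofReal_neg, RCLike.norm_ofReal, abs_neg, abs_of_pos (by positivity)]
  have h6 : ((C ^ 2)⁻¹ * ‖σ‖) ^ 2 ≤ (C ^ 2)⁻¹ * t ^ 2 := by
    have h7 : ‖σ‖ ^ 2 ≤ (C * t) ^ 2 := pow_le_pow_left₀ (norm_nonneg _) h2 2
    calc ((C ^ 2)⁻¹ * ‖σ‖) ^ 2 = ((C ^ 2)⁻¹) ^ 2 * ‖σ‖ ^ 2 := by ring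
      _ ≤ ((C ^ 2)⁻¹) ^ 2 * (C * t) ^ 2 := by gcongr
      _ = _ := by field_simp
  rw [h3, h4, h5]
  linarith

theorem exists_ultrafilter_of_frequently {α : Type*} {l : Filter α} {P : α → Prop}
    (h : ∃ᶠ a in l, P a) : ∃ q : Ultrafilter α, ↑q ≤ l ∧ ∀ᶠ a in q, P a := by
  have : (l ⊓ 𝓟 {a | P a}).NeBot := frequently_mem_iff_neBot.1 h
  exact ⟨Ultrafilter.of _, (Ultrafilter.of_le _).trans inf_le_left,
    (Ultrafilter.of_le (l ⊓ 𝓟 {a | P a})).trans inf_le_right (mem_principal_self _)⟩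

theorem eventually_norm_sub_sq_le {Y : Type*} [TopologicalSpace Y] {Λ : Mean Y}
    {A : FolnerSet μ → Y → BddFun 𝕜 ν} (hA : ∀ F, Nice (A F)) {ε : ℝ}
    (h : ∀ᶠ F in folner μ, Λ (fun y => ‖(A F y : Lp 𝕜 2 ν)‖ ^ 2) ≤ ε) :
    ∀ᶠ Q in folner μ ×ˢ folner μ, Λ (fun y => ‖(A Q.1 y : Lp 𝕜 2 ν) - A Q.2 y‖ ^ 2) ≤ 4 * ε := by
  filter_upwards [h.prod_inl _, h.prod_inr _] with Q h1 h2
  have b1 := (hA Q.1).isBC_norm_sq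
  have b2 := (hA Q.2).isBC_norm_sq
  refine (Λ.mono ((hA Q.1).isBC_norm_sub_sq (hA Q.2)) ((b1.smul 2).add (b2.smul 2))
    fun y => ?_).trans ?_
  · have := norm_add_sq_le_weighted (A Q.1 y : Lp 𝕜 2 ν) (-(A Q.2 y : Lp 𝕜 2 ν)) one_pos
    rw [← sub_eq_add_neg, norm_neg] at this
    norm_num at this ⊢
    exact this
  · rw [Λ.map_add _ _ (b1.smul 2) (b2.smul 2), Λ.map_smul _ _ b1, Λ.map_smul _ _ b2]
    linarith

theorem eventually_norm_sub_sq_add_smul_le {Y : Type*} [TopologicalSpace Y] {Λ : Mean Y}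
    {A B D : FolnerSet μ → Y → BddFun 𝕜 ν} (hA : ∀ F, Nice (A F)) (hB : ∀ F, Nice (B F))
    (hD : ∀ F, Nice (D F)) {c : 𝕜}
    (hADB : ∀ F y, (D F y : Lp 𝕜 2 ν) = A F y + c • (B F y : Lp 𝕜 2 ν)) {ε : ℝ}
    (h : ∀ δ > 0, ∀ᶠ Q in folner μ ×ˢ folner μ,
      Λ (fun y => ‖(A Q.1 y : Lp 𝕜 2 ν) - A Q.2 y‖ ^ 2) ≤ ε + δ) (hBC : MeanCauchy Λ B) :
    ∀ δ > 0, ∀ᶠ Q in folner μ ×ˢ folner μ,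
      Λ (fun y => ‖(D Q.1 y : Lp 𝕜 2 ν) - D Q.2 y‖ ^ 2) ≤ ε + δ := by
  intro δ hδ
  obtain ⟨θ, hθ, hθ'⟩ := exists_pos_mul_lt (show 0 < δ / 4 by positivity) (ε + δ / 2)
  obtain ⟨ε', hε', hε''⟩ := exists_pos_mul_lt (show 0 < δ / 4 by positivity)
    ((1 + θ⁻¹) * ‖c‖ ^ 2)
  filter_upwards [h (δ / 2) (by positivity), hBC ε' hε'] with Q hQ1 hQ2
  have b1 := (hA Q.1).isBC_norm_sub_sq (hA Q.2)
  have b2 := (hB Q.1).isBC_norm_sub_sq (hB Q.2)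
  refine (Λ.mono ((hD Q.1).isBC_norm_sub_sq (hD Q.2)) ((b1.smul (1 + θ)).add
    (b2.smul ((1 + θ⁻¹) * ‖c‖ ^ 2))) fun y => ?_).trans ?_
  · have h1 := norm_add_sq_le_weighted ((A Q.1 y : Lp 𝕜 2 ν) - A Q.2 y)
      (c • ((B Q.1 y : Lp 𝕜 2 ν) - B Q.2 y)) hθ
    rw [norm_smul, mul_pow, ← mul_assoc] at h1
    refine le_trans (le_of_eq ?_) h1
    rw [hADB, hADB, smul_sub]
    congr 2
    abel
  · rw [Λ.map_add _ _ (b1.smul _) (b2.smul _), Λ.map_smul _ _ b1, Λ.map_smul _ _ b2]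
    have h1 := mul_le_mul_of_nonneg_left hQ1 (show 0 ≤ 1 + θ by positivity)
    have h2 := mul_le_mul_of_nonneg_left hQ2 (show 0 ≤ (1 + θ⁻¹) * ‖c‖ ^ 2 by positivity)
    linarith

section Structured

variable {Y : Type*} [TopologicalSpace Y] {W : Y × Γ → BddFun 𝕜 ν} {P : Y × Γ → G}
  {v : Y → BddFun 𝕜 ν}

/-- The structured function built from large averages of `v`. -/
noncomputable def structured (W : Y × Γ → BddFun 𝕜 ν) (P : Y × Γ → G) (v : Y → BddFun 𝕜 ν)
    (y : Y × FolnerSet μ) : BddFun 𝕜 ν :=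
  dualAvg hG (fun n => P (y.1, n)) y.2 fun n => star (W (y.1, n)) *
    weightedAvg hG (fun n => W (y.1, n)) (fun n => P (y.1, n)) y.2 (v y.1)

theorem nice_weightedAvg_fst (hW : Nice W) (hP : StrongCont P) (hv : Nice v) :
    Nice fun y : Y × FolnerSet μ =>
      weightedAvg hG (fun n => W (y.1, n)) (fun n => P (y.1, n)) y.2 (v y.1) :=
  nice_weightedAvg hG (W := fun z : (Y × FolnerSet μ) × Γ => W (z.1.1, z.2))
    (p := fun z => P (z.1.1, z.2)) (hW.comp (by fun_prop)) (hP.comp (by fun_prop)) continuous_snd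
    (hv.comp continuous_fst)

theorem nice_structured (hW : Nice W) (hP : StrongCont P) (hv : Nice v) :
    Nice (structured (μ := μ) hG W P v) := by
  have hW' : Nice fun z : (Y × FolnerSet μ) × Γ => W (z.1.1, z.2) := hW.comp (by fun_prop)
  exact nice_dualAvg hG (p := fun z : (Y × FolnerSet μ) × Γ => P (z.1.1, z.2))
    (hP.comp (by fun_prop)) continuous_snd (w := fun z => star (W (z.1.1, z.2)) *
      weightedAvg hG (fun n => W (z.1.1, n)) (fun n => P (z.1.1, n)) z.1.2 (v z.1.1))
    (hW'.star.mul ((nice_weightedAvg_fst hG hW hP hv).comp continuous_fst))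

/-- Pointwise, the decrease is C⁻² times the squared norm of the large average. Its mean is at least
ε along q. -/
theorem limit_norm_sub_structured_le (hW : Nice W) (hP : StrongCont P) (hv : Nice v) {C ε : ℝ}
    (hC0 : 0 < C) (hC : ∀ z, NormLe C (W z : Lp 𝕜 2 ν)) {Λ : Mean Y}
    {q : Ultrafilter (FolnerSet μ)} (hbig : ∀ᶠ F in (q : Filter (FolnerSet μ)), ε ≤ Λ (fun y =>
      ‖(weightedAvg hG (fun n => W (y, n)) (fun n => P (y, n)) F (v y) : Lp 𝕜 2 ν)‖ ^ 2)) :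
    Λ.limit q (fun y => ‖((v y.1 + (-(((C ^ 2)⁻¹ : ℝ) : 𝕜)) • structured hG W P v y :
      BddFun 𝕜 ν) : Lp 𝕜 2 ν)‖ ^ 2) ≤ Λ (fun y => ‖(v y : Lp 𝕜 2 ν)‖ ^ 2) - ε / C ^ 2 := by
  have hh := nice_weightedAvg_fst (μ := μ) hG hW hP hv
  have hv' : Nice fun y : Y × FolnerSet μ => v y.1 := hv.comp continuous_fst
  have h1 := ge_of_tendsto (Λ.tendsto_limit q hh.isBC_norm_sq) hbig
  have b1 := hv'.isBC_norm_sq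
  have b2 := hh.isBC_norm_sq
  have h2 := (Λ.limit q).mono
    (hv'.add ((nice_structured hG hW hP hv).smul (-(((C ^ 2)⁻¹ : ℝ) : 𝕜)))).isBC_norm_sq
    (b1.add (b2.smul (-(C ^ 2)⁻¹))) fun y => by
      have h3 := norm_sub_smul_sq_le (𝕜 := 𝕜) hC0
        (inner_dualAvg hG (hW.slice y.1) (hP.slice y.1) y.2 (v y.1))
        (norm_dualAvg_le hG (hW.slice y.1) (hP.slice y.1) y.2 (fun n => hC _) _)
      rw [neg_mul, ← sub_eq_add_neg]
      exact h3
  rw [(Λ.limit q).map_add _ _ b1 (b2.smul _), (Λ.limit q).map_smul _ _ b2,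
    Λ.limit_fst q fun y => ‖(v y : Lp 𝕜 2 ν)‖ ^ 2] at h2
  have h5 := mul_le_mul_of_nonneg_left h1 (show 0 ≤ (C ^ 2)⁻¹ by positivity)
  rw [div_eq_inv_mul]
  linarith

end Structured

open Classical in
-- The averages of a structured function are governed by `vdcAvg`, hence by the reduced systems,
-- which are good by assumption.
theorem meanCauchy_structured {S : Finset (Ω → Γ → G)} {p : Ω → Γ → G}
    (hred : ∀ (Ω' : Type u) [TopologicalSpace Ω'] (ψ : Ω' → Ω) (m : Ω' → Γ), Continuous ψ →
      Function.Surjective ψ → Continuous m → Good hG μ (redFinset S p ψ m))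
    {Ω' : Type u} [TopologicalSpace Ω'] {ψ : Ω' → Ω} (hψ : Continuous ψ)
    (hψs : Function.Surjective ψ) {Λ : Mean Ω'} {e : (Ω → Γ → G) → Ω' → BddFun 𝕜 ν}
    (he : ∀ i, Nice (e i)) {W : Ω' × Γ → BddFun 𝕜 ν} (hW : Nice W)
    (hWe : W = sysProd hG (S.erase p) (fun i ω => i (ψ ω)) e) {P : Ω' × Γ → G} (hP : StrongCont P)
    (hPp : P = fun z => p (ψ z.1) z.2) {v : Ω' → BddFun 𝕜 ν} (hv : Nice v)
    {q : Ultrafilter (FolnerSet μ)} (hq : ↑q ≤ folner μ) :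
    MeanCauchy (Λ.limit q) fun (F : FolnerSet μ) y =>
      weightedAvg hG (fun n => W (y.1, n)) (fun n => P (y.1, n)) F (structured hG W P v y) := by
  have : Nonempty (FolnerSet μ) := Filter.nonempty_of_neBot (q : Filter (FolnerSet μ))
  have hh := nice_weightedAvg_fst (μ := μ) hG hW hP hv
  have c : Continuous fun z : (Ω' × FolnerSet μ) × Γ => (z.1.1, z.2) := by fun_prop
  have hW' : Nice fun z : (Ω' × FolnerSet μ) × Γ => W (z.1.1, z.2) := hW.comp c
  have hP' : StrongCont fun z : (Ω' × FolnerSet μ) × Γ => P (z.1.1, z.2) := hP.comp c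
  have hw : Nice fun z : (Ω' × FolnerSet μ) × Γ => star (W (z.1.1, z.2)) *
      weightedAvg hG (fun n => W (z.1.1, n)) (fun n => P (z.1.1, n)) z.1.2 (v z.1.1) :=
    hW'.star.mul (hh.comp continuous_fst)
  have main := meanCauchy_dualAvg hG hW' hw hP' continuous_snd (concentrated_limit Λ hq)
  unfold structured
  refine main ?_
  -- The parameters are now the old ones, the Følner set F defining the structured function, and the
  -- shift m averaged over F.
  have hgood := hred ((Ω' × FolnerSet μ) × Γ) (fun z => ψ z.1.1) Prod.snd (by fun_prop)
    (hψs.comp (Prod.fst_surjective.comp Prod.fst_surjective)) continuous_snd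
  have he' : ∀ i, Nice fun z : (Ω' × FolnerSet μ) × Γ => e i z.1.1 := fun i =>
    (he i).comp (by fun_prop)
  have hall := hgood.meanCauchy hG (fun i hi => Finset.mem_image_of_mem _ hi)
    (f := Sum.elim (fun i z => e i z.1.1) fun o z => o.elim
      (weightedAvg hG (fun n => W (z.1.1, n)) (fun n => P (z.1.1, n)) z.1.2 (v z.1.1))
      fun i => star (e i z.1.1)) (by
      rintro (i | _ | i)
      · exact he' i
      · exact hh.comp continuous_fst
      · exact (he' i).star)
  have heq := fun (F : FolnerSet μ) z => vdcAvg_eq_sysAvg hG S p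
    (fun y : Ω' × FolnerSet μ => ψ y.1) (fun i y => e i y.1)
    (fun y => weightedAvg hG (fun n => W (y.1, n)) (fun n => P (y.1, n)) y.2 (v y.1)) F z
  have hW'' : (fun z : (Ω' × FolnerSet μ) × Γ => W (z.1.1, z.2)) =
    sysProd hG (S.erase p) (fun i y => i (ψ y.1)) (fun i y => e i y.1) := by rw [hWe]; rfl
  have hP'' : (fun z : (Ω' × FolnerSet μ) × Γ => P (z.1.1, z.2)) = fun z => p (ψ z.1.1) z.2 := by
    rw [hPp]
  rw [← hP'', ← hW''] at heq
  intro ε hε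
  filter_upwards [hall ((Λ.limit q).average (F := Prod.snd) continuous_snd) ε hε] with Q hQ
  simp only [heq]
  exact hQ

open Classical in
-- k bounds the energy of v in units of ε / C². Either the averages of v are eventually small, or an
-- ultrafilter of sets with large averages supplies a structured function. Subtracting it costs one
-- unit, and its own averages are Cauchy. At k = 0 the averages are small outright.
theorem energy_increment {S : Finset (Ω → Γ → G)} {p : Ω → Γ → G}
    (hred : ∀ (Ω' : Type u) [TopologicalSpace Ω'] (ψ : Ω' → Ω) (m : Ω' → Γ), Continuous ψ →
      Function.Surjective ψ → Continuous m → Good hG μ (redFinset S p ψ m))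
    {ε C : ℝ} (hε : 0 < ε) (hC0 : 0 < C) (k : ℕ) :
    ∀ (Ω' : Type u) [TopologicalSpace Ω'] (ψ : Ω' → Ω), Continuous ψ → Function.Surjective ψ →
      ∀ (Λ : Mean Ω') (e : (Ω → Γ → G) → Ω' → BddFun 𝕜 ν), (∀ i, Nice (e i)) →
      ∀ (W : Ω' × Γ → BddFun 𝕜 ν), Nice W → W = sysProd hG (S.erase p) (fun i ω => i (ψ ω)) e →
      ∀ P : Ω' × Γ → G, StrongCont P → (P = fun z => p (ψ z.1) z.2) →
      (∀ z, NormLe C (W z : Lp 𝕜 2 ν)) →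
      ∀ v : Ω' → BddFun 𝕜 ν, Nice v → Λ (fun ω => ‖(v ω : Lp 𝕜 2 ν)‖ ^ 2) ≤ k * (ε / C ^ 2) →
      ∀ δ > 0, ∀ᶠ Q in folner μ ×ˢ folner μ, Λ (fun ω =>
        ‖(weightedAvg hG (fun n => W (ω, n)) (fun n => P (ω, n)) Q.1 (v ω) : Lp 𝕜 2 ν) -
          weightedAvg hG (fun n => W (ω, n)) (fun n => P (ω, n)) Q.2 (v ω)‖ ^ 2) ≤ 4 * ε + δ := by
  induction k with
  | zero =>
    intro Ω' _ ψ hψ hψs Λ e he W hW hWe P hP hPp hC v hv hΛ δ hδ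
    have hA : ∀ F : FolnerSet μ, Nice fun ω =>
        weightedAvg hG (fun n => W (ω, n)) (fun n => P (ω, n)) F (v ω) := fun F =>
      nice_weightedAvg hG hW hP continuous_const hv
    refine (eventually_norm_sub_sq_le (Λ := Λ) hA (ε := ε) (Eventually.of_forall fun F => ?_)).mono
      fun Q hQ => hQ.trans (by linarith)
    refine (Λ.mono (hA F).isBC_norm_sq (hv.isBC_norm_sq.smul (C ^ 2)) fun ω => ?_).trans ?_
    · rw [← mul_pow]
      gcongr
      exact norm_weightedAvg_le hG (hW.slice ω) (hP.slice ω) F (fun n => hC _) _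
    · rw [Λ.map_smul _ _ hv.isBC_norm_sq]
      rw [Nat.cast_zero, zero_mul] at hΛ
      nlinarith [sq_nonneg C]
  | succ k ih =>
    intro Ω' _ ψ hψ hψs Λ e he W hW hWe P hP hPp hC v hv hΛ
    have hA : ∀ F : FolnerSet μ, Nice fun ω =>
        weightedAvg hG (fun n => W (ω, n)) (fun n => P (ω, n)) F (v ω) := fun F =>
      nice_weightedAvg hG hW hP continuous_const hv
    by_cases hsmall : ∀ᶠ F in folner μ, Λ (fun ω => ‖(weightedAvg hG (fun n => W (ω, n))
        (fun n => P (ω, n)) F (v ω) : Lp 𝕜 2 ν)‖ ^ 2) ≤ ε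
    · exact fun δ hδ => (eventually_norm_sub_sq_le hA hsmall).mono fun Q hQ =>
        hQ.trans (by linarith)
    obtain ⟨q, hq, hbig⟩ := exists_ultrafilter_of_frequently (not_eventually.1 hsmall)
    have : Nonempty (FolnerSet μ) := Filter.nonempty_of_neBot (q : Filter (FolnerSet μ))
    have hσ := nice_structured (μ := μ) hG hW hP hv
    have hv' : Nice fun y : Ω' × FolnerSet μ => v y.1 := hv.comp continuous_fst
    have hv'' := hv'.add (hσ.smul (-(((C ^ 2)⁻¹ : ℝ) : 𝕜)))
    have henergy := limit_norm_sub_structured_le hG hW hP hv hC0 hC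
      (hbig.mono fun F hF => (not_le.1 hF).le)
    have hle : Λ (fun ω => ‖(v ω : Lp 𝕜 2 ν)‖ ^ 2) - ε / C ^ 2 ≤ k * (ε / C ^ 2) := by
      push_cast at hΛ; linarith
    have c : Continuous fun z : (Ω' × FolnerSet μ) × Γ => (z.1.1, z.2) := by fun_prop
    have hW' : Nice fun z : (Ω' × FolnerSet μ) × Γ => W (z.1.1, z.2) := hW.comp c
    have hP' : StrongCont fun z : (Ω' × FolnerSet μ) × Γ => P (z.1.1, z.2) := hP.comp c
    have hih := ih (Ω' × FolnerSet μ) (fun y => ψ y.1) (by fun_prop)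
      (hψs.comp Prod.fst_surjective) (Λ.limit q) (fun i y => e i y.1)
      (fun i => (he i).comp continuous_fst) _ hW' (by rw [hWe]; rfl) _ hP' (by rw [hPp])
      (fun z => hC _) _ hv'' (henergy.trans hle)
    have hcauchy := meanCauchy_structured (Λ := Λ) hG hred hψ hψs he hW hWe hP hPp hv hq
    have hN : ∀ (F : FolnerSet μ) (x : Ω' × FolnerSet μ → BddFun 𝕜 ν), Nice x →
        Nice fun y => weightedAvg hG (fun n => W (y.1, n)) (fun n => P (y.1, n)) F (x y) :=
      fun F x hx => nice_weightedAvg hG hW' hP' continuous_const hx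
    have split : ∀ (F : FolnerSet μ) (y : Ω' × FolnerSet μ),
        (weightedAvg hG (fun n => W (y.1, n)) (fun n => P (y.1, n)) F (v y.1) : Lp 𝕜 2 ν) =
        weightedAvg hG (fun n => W (y.1, n)) (fun n => P (y.1, n)) F
          (v y.1 + (-(((C ^ 2)⁻¹ : ℝ) : 𝕜)) • structured hG W P v y) + (((C ^ 2)⁻¹ : ℝ) : 𝕜) •
        (weightedAvg hG (fun n => W (y.1, n)) (fun n => P (y.1, n)) F
          (structured hG W P v y) : Lp 𝕜 2 ν) := by
      intro F y
      have h1 := weightedAvg_add_smul hG (hW.slice y.1) (hP.slice y.1) F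
        (v y.1 + (-(((C ^ 2)⁻¹ : ℝ) : 𝕜)) • structured hG W P v y) (structured hG W P v y)
        (((C ^ 2)⁻¹ : ℝ) : 𝕜)
      rw [← h1]
      congr 2
      rw [neg_smul, neg_add_cancel_right]
    have key := eventually_norm_sub_sq_add_smul_le (fun F => hN F _ hv'') (fun F => hN F _ hσ)
      (fun F => hN F _ hv') split hih hcauchy
    intro δ hδ
    refine (key δ hδ).mono fun Q hQ => ?_
    exact (Λ.limit_fst q _).symm.le.trans hQ

theorem good_of_redFinset {S : Finset (Ω → Γ → G)} {p : Ω → Γ → G} (hp : p ∈ S)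
    (hS : ∀ q ∈ S, StrongCont fun z : Ω × Γ => q z.1 z.2)
    (hred : ∀ (Ω' : Type u) [TopologicalSpace Ω'] (ψ : Ω' → Ω) (m : Ω' → Γ), Continuous ψ →
      Function.Surjective ψ → Continuous m → Good hG μ (redFinset S p ψ m)) : Good hG μ S := by
  classical
  intro Λ f hf ε hε
  have hW : Nice (sysProd hG (S.erase p) (fun i (ω : Ω) => i ω) f) :=
    nice_sysProd hG (fun i hi => hS i (Finset.mem_of_mem_erase hi)) hf
  obtain ⟨C', hC'⟩ := hW.bdd
  set C := max C' 1 with hCdef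
  have hC0 : 0 < C := lt_max_of_lt_right one_pos
  have hC : ∀ z, NormLe C (sysProd hG (S.erase p) (fun i (ω : Ω) => i ω) f z : Lp 𝕜 2 ν) :=
    fun z => (hC' z).mono (le_max_left _ _)
  -- With ε / 8 and δ = ε / 2, the final bound is 4 * (ε / 8) + ε / 2 = ε.
  obtain ⟨k, hk⟩ := exists_nat_ge (Λ (fun ω => ‖(f p ω : Lp 𝕜 2 ν)‖ ^ 2) / (ε / 8 / C ^ 2))
  rw [div_le_iff₀ (by positivity)] at hk
  refine (energy_increment hG hred (ε := ε / 8) (by positivity) hC0 k Ω id continuous_id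
    Function.surjective_id Λ f hf _ hW rfl _ (hS p hp) rfl hC (f p) (hf p) hk (ε / 2)
    (by positivity)).mono fun Q hQ => ?_
  refine le_trans (le_of_eq ?_) (hQ.trans (by linarith))
  have e : ∀ (F : FolnerSet μ) (ω : Ω), sysAvg hG S id f F ω = weightedAvg hG (fun n =>
      sysProd hG (S.erase p) (fun i (ω : Ω) => i ω) f (ω, n)) (fun n => p ω n) F (f p ω) := by
    intro F ω
    unfold sysAvg weightedAvg
    congr 1
    funext n
    simp only [sysProd, id]
    rw [Finset.prod_erase_mul _ _ hp]
  simp only [e]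

end Step

/-! ### Induction on complexity and convergence along the Følner filter -/

section Induction

open BddFun

universe u

variable {Γ : Type u} [Group Γ] [TopologicalSpace Γ] [IsTopologicalGroup Γ] [LocallyCompactSpace Γ]
  [T2Space Γ] [MeasurableSpace Γ] [BorelSpace Γ] {μ : Measure Γ} [μ.IsHaarMeasure]
  {X : Type*} [MeasurableSpace X] {ν : Measure X} [IsProbabilityMeasure ν]
  {𝕜 : Type*} [RCLike 𝕜]
  {G : Subgroup (Lp 𝕜 2 ν ≃ₗᵢ[𝕜] Lp 𝕜 2 ν)} (hG : ∀ U ∈ G, ActsOnLInfty U)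
  {F : ℕ → Subgroup G} {N : ℕ}

theorem good_of_forall_eq_one {Ω : Type u} [TopologicalSpace Ω] {S : Finset (Ω → Γ → G)}
    (hS : ∀ q ∈ S, q = 1) : Good hG μ S := by
  intro Λ f hf ε hε
  have e : ∀ (F : FolnerSet μ) ω, (sysAvg hG S id f F ω : Lp 𝕜 2 ν) =
      (∏ q ∈ S, f q ω : BddFun 𝕜 ν) := by
    intro F ω
    have e1 : (fun n => sysProd hG S id f (ω, n)) = fun _ => ∏ q ∈ S, f q ω := by
      funext n
      refine Finset.prod_congr rfl fun q hq => ?_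
      rw [id, hS q hq]
      exact act_one_left hG _
    rw [sysAvg, e1, coe_bddAvg F (Nice.const _), integral_const]
    simp
  refine Eventually.of_forall fun Q => ?_
  simp only [e, sub_self, norm_zero]
  rw [Λ.map_const]
  simpa using hε.le

theorem rightDeriv_mem_polySubgroup (hF : IsCommFiltration F N) {Ω Ω' : Type u} (ψ : Ω' → Ω)
    (m : Ω' → Γ) {t : ℕ} {g : Ω → Γ → G} (hg : g ∈ polySubgroup hF Γ Ω t) :
    (fun ω => rightDeriv (m ω) (g (ψ ω))) ∈ polySubgroup hF Γ Ω' (t + 1) :=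
  fun ω => (mem_polyMap_iff.1 (hg (ψ ω))).2 (m ω)

/-- p(l) p(lm)⁻¹ h(lm) = h(l) D_m(p⁻¹h)(l), with h = 1 for the index `none`. This is why passing to
the reduced system raises degrees. -/
theorem redMap_inr {Ω Ω' : Type u} (p : Ω → Γ → G) (ψ : Ω' → Ω) (m : Ω' → Γ)
    (o : Option (Ω → Γ → G)) :
    (o.getD 1 ∘ ψ)⁻¹ * redMap p ψ m (Sum.inr o) =
      fun ω => rightDeriv (m ω) ((p⁻¹ * o.getD 1) (ψ ω)) := by
  funext ω l
  rcases o with _ | i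
  · simp [redMap, rightDeriv]
  · simp [redMap, rightDeriv, mul_assoc]

theorem redFinset_isPerturbation (hF : IsCommFiltration F N) {Ω Ω' : Type u}
    {S : Finset (Ω → Γ → G)} {p : Ω → Γ → G} (h1 : 1 ∈ S) (hp1 : p ≠ 1) (ψ : Ω' → Ω) (m : Ω' → Γ) :
    IsPerturbation hF ψ S p (redFinset S p ψ m) := by
  classical
  intro q' hq'
  obtain ⟨i | o, hi, rfl⟩ := Finset.mem_image.1 hq'
  · obtain ⟨hip, hiS⟩ := Finset.mem_erase.1 (Finset.inl_mem_disjSum.1 hi)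
    refine ⟨i, hiS, hip, fun t _ => ?_⟩
    have : (i ∘ ψ)⁻¹ * redMap p ψ m (Sum.inl i) = 1 := inv_mul_cancel (i ∘ ψ)
    rw [this]
    exact one_mem _
  · have ho : o.getD 1 ∈ S ∧ o.getD 1 ≠ p := by
      rcases o with _ | i
      · exact ⟨h1, hp1.symm⟩
      · have := Finset.mem_erase.1
          (Finset.some_mem_insertNone.1 (Finset.inr_mem_disjSum.1 hi))
        exact ⟨this.2, this.1⟩
    refine ⟨o.getD 1, ho.1, ho.2, fun t ht => ?_⟩
    rw [redMap_inr]
    exact rightDeriv_mem_polySubgroup hF ψ m ht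

theorem redFinset_subset_polySubgroup (hF : IsCommFiltration F N) {Ω Ω' : Type u}
    {S : Finset (Ω → Γ → G)} {p : Ω → Γ → G} (h0 : ∀ q ∈ S, q ∈ polySubgroup hF Γ Ω 0)
    (hp : p ∈ S) {ψ : Ω' → Ω} {m : Ω' → Γ} (hS' : IsPerturbation hF ψ S p (redFinset S p ψ m)) :
    ∀ q ∈ redFinset S p ψ m, q ∈ polySubgroup hF Γ Ω' 0 := by
  intro q' hq'
  obtain ⟨h, hh, -, hq⟩ := hS' q' hq'
  have h2 := polySubgroup_anti hF _ (Nat.zero_le 1) (hq 0 (mul_mem (inv_mem (h0 p hp)) (h0 h hh)))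
  have h3 : h ∘ ψ ∈ polySubgroup hF Γ Ω' 0 := fun ω => h0 h hh (ψ ω)
  simpa using mul_mem h3 h2

theorem one_mem_redFinset {Ω Ω' : Type u} {S : Finset (Ω → Γ → G)} {p : Ω → Γ → G} (h1 : 1 ∈ S)
    (hp1 : p ≠ 1) (ψ : Ω' → Ω) (m : Ω' → Γ) : 1 ∈ redFinset S p ψ m := by
  classical
  exact Finset.mem_image.2 ⟨Sum.inl 1,
    Finset.inl_mem_disjSum.2 (Finset.mem_erase.2 ⟨hp1.symm, h1⟩), rfl⟩

/-- Well-founded induction: each reduced system has smaller complexity for a suitable marked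
element, unless all its maps are trivial and its averages are constant. -/
theorem good_of_complexity (hF : IsCommFiltration F N) (c : Lex (Fin N → ℕ)) :
    ∀ (Ω : Type u) [TopologicalSpace Ω] (S : Finset (Ω → Γ → G)) (p : Ω → Γ → G), 1 ∈ S →
      (∀ q ∈ S, q ∈ polySubgroup hF Γ Ω 0) → (∀ q ∈ S, StrongCont fun z : Ω × Γ => q z.1 z.2) →
      p ∈ S → p ≠ 1 → IsLowest hF S p → complexity hF S p = c → Good hG μ S := by
  induction c using WellFoundedLT.induction with
  | ind c ih =>
    intro Ω _ S p h1 h0 hS hp hp1 hlow hc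
    refine good_of_redFinset hG hp hS fun Ω' _ ψ m hψ hψs hm => ?_
    by_cases hne : ∃ q ∈ redFinset S p ψ m, q ≠ 1
    · have hpert := redFinset_isPerturbation hF h1 hp1 ψ m
      have h1' := one_mem_redFinset h1 hp1 ψ m
      obtain ⟨p', hp', hp1', hlow', hlt⟩ :=
        exists_complexity_lt hF hψs h0 hp hp1 hlow hpert h1' hne
      exact ih _ (hc ▸ hlt) Ω' _ p' h1' (redFinset_subset_polySubgroup hF h0 hp hpert)
        (strongCont_redMap hS hp hψ hm) hp' hp1' hlow' rfl
    · push Not at hne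
      exact good_of_forall_eq_one hG hne

theorem good_of_polynomial (hF : IsCommFiltration F N) {Ω : Type u} [TopologicalSpace Ω]
    {S : Finset (Ω → Γ → G)} (h1 : 1 ∈ S) (h0 : ∀ q ∈ S, q ∈ polySubgroup hF Γ Ω 0)
    (hS : ∀ q ∈ S, StrongCont fun z : Ω × Γ => q z.1 z.2) : Good hG μ S := by
  by_cases hne : ∃ q ∈ S, q ≠ 1
  · obtain ⟨p, hp, hp1, hlow⟩ := exists_isLowest hF hne
    exact good_of_complexity hG hF _ Ω S p h1 h0 hS hp hp1 hlow rfl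
  · push Not at hne
    exact good_of_forall_eq_one hG hne

theorem IsRightPolynomial.map {H H' : Type*} [Group H] [Group H'] (φ : H →* H') {g : Γ → H}
    (hg : IsRightPolynomial g) : IsRightPolynomial fun n => φ (g n) := by
  obtain ⟨d, hd⟩ := hg
  refine ⟨d, fun bs hbs n => ?_⟩
  have key : ∀ bs : List Γ, bs.foldr rightDeriv (fun n => φ (g n)) =
      fun n => φ (bs.foldr rightDeriv g n) := by
    intro bs
    induction bs with
    | nil => rfl
    | cons b bs ih =>
      rw [List.foldr_cons, ih]
      funext n
      simp [rightDeriv]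
  simp only [key, hd bs hbs, map_one]

/-- The averages of a product of bounded functions moved by polynomial maps converge along
asymptotically invariant sets. -/
theorem exists_tendsto_integral [Group.IsNilpotent G] {κ : Type*} [Fintype κ]
    {g : κ → Γ → G} (hg : ∀ i, IsRightPolynomial (g i)) (hc : ∀ i, StrongCont (g i))
    (f : κ → BddFun 𝕜 ν) : ∃ L : Lp 𝕜 2 ν, Tendsto (fun F : FolnerSet μ =>
      ∫ n, ((∏ i, act hG (g i n) (f i) : BddFun 𝕜 ν) : Lp 𝕜 2 ν) ∂F.prob) (folner μ) (𝓝 L) := by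
  classical
  -- The filter is trivial when no asymptotically invariant sets exist; any L then works.
  rcases (folner μ).eq_or_neBot with hbot | hne
  · exact ⟨0, by rw [hbot]; exact tendsto_bot⟩
  obtain ⟨F, N, hF, hgF⟩ := exists_filtration g hg
  set q : κ → PUnit.{u + 1} → Γ → G := fun i _ => g i
  have hq : ∀ i ∈ Finset.univ, q i ∈ insert 1 (Finset.univ.image q) := fun i hi =>
    Finset.mem_insert_of_mem (Finset.mem_image_of_mem q hi)
  have hqc : ∀ i, StrongCont fun z : PUnit.{u + 1} × Γ => q i z.1 z.2 := fun i =>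
    (hc i).comp continuous_snd
  -- The identity map is adjoined because the induction requires it in the system. The parameter
  -- space is a single point.
  have hgood : Good hG μ (insert 1 (Finset.univ.image q)) := by
    refine good_of_polynomial hG hF (Finset.mem_insert_self _ _) (fun r hr => ?_) fun r hr => ?_
    · rcases Finset.mem_insert.1 hr with rfl | hr
      · exact one_mem _
      · obtain ⟨i, -, rfl⟩ := Finset.mem_image.1 hr
        exact fun _ => hgF i
    · rcases Finset.mem_insert.1 hr with rfl | hr
      · exact StrongCont.one
      · obtain ⟨i, -, rfl⟩ := Finset.mem_image.1 hr
        exact hqc i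
  have hcauchy := hgood.meanCauchy hG hq (f := fun i _ => f i) (fun i => Nice.const _)
    (Mean.eval PUnit.unit)
  have e : ∀ F : FolnerSet μ, (sysAvg hG Finset.univ q (fun i _ => f i) F PUnit.unit : Lp 𝕜 2 ν) =
      ∫ n, ((∏ i, act hG (g i n) (f i) : BddFun 𝕜 ν) : Lp 𝕜 2 ν) ∂F.prob := fun F =>
    coe_bddAvg F ((nice_sysProd hG (fun i _ => hqc i) fun i => Nice.const _).slice _)
  refine cauchy_map_iff_exists_tendsto.1 (cauchy_map_iff'.2 ?_)
  rw [tendsto_uniformity_iff_dist_tendsto_zero, Metric.tendsto_nhds]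
  intro ε hε
  filter_upwards [hcauchy ((ε / 2) ^ 2) (by positivity)] with Q hQ
  have h1 : ‖(sysAvg hG Finset.univ q (fun i _ => f i) Q.1 PUnit.unit : Lp 𝕜 2 ν) -
    sysAvg hG Finset.univ q (fun i _ => f i) Q.2 PUnit.unit‖ ^ 2 ≤ (ε / 2) ^ 2 := hQ
  rw [e, e] at h1
  have h2 := abs_le_of_sq_le_sq h1 (by positivity)
  rw [abs_norm] at h2
  rw [Real.dist_0_eq_abs, abs_of_nonneg dist_nonneg, dist_eq_norm]
  linarith

end Induction

/-! ### The convergence theorem -/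

theorem mainTheorem6
    {Γ : Type*} [Group Γ] [TopologicalSpace Γ] [IsTopologicalGroup Γ] [LocallyCompactSpace Γ]
    [T2Space Γ] [MeasurableSpace Γ] [BorelSpace Γ]
    (μ : Measure Γ) [μ.IsHaarMeasure] [μ.Regular]
    {X : Type*} [MeasurableSpace X] (ν : Measure X) [IsProbabilityMeasure ν]
    {𝕜 : Type*} [RCLike 𝕜]
    (G : Subgroup (Lp 𝕜 2 ν ≃ₗᵢ[𝕜] Lp 𝕜 2 ν)) [Group.IsNilpotent G]
    (hG : ∀ U ∈ G, ActsOnLInfty U)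
    (j : ℕ) (g : Fin j → Γ → G)
    (hg_meas : ∀ i, IsMeasurableOperatorMap μ (fun m => (g i m : Lp 𝕜 2 ν ≃ₗᵢ[𝕜] Lp 𝕜 2 ν)))
    (hg_poly : ∀ i, IsRightPolynomial (g i))
    (f : Fin j → Lp 𝕜 2 ν) (hf : ∀ i, IsEssBounded (f i)) :
    let A : Γ → Lp 𝕜 2 ν := fun m =>
      boundedProd (fun i => (g i m : Lp 𝕜 2 ν ≃ₗᵢ[𝕜] Lp 𝕜 2 ν) (f i))
        (fun i => (hG (g i m) (g i m).2).isEssBounded (f i) (hf i))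
    ∃ L : Lp 𝕜 2 ν,
      ∀ (ι : Type*) [Preorder ι] [IsDirectedOrder ι] [Nonempty ι] (F : ι → Set Γ),
        IsFolnerNet μ F →
          (∀ α, IntegrableOn A (F α) μ) ∧
          Tendsto (fun α => (μ.real (F α))⁻¹ • ∫ m in F α, A m ∂μ) atTop (𝓝 L) := by
  intro A
  have hcont : ∀ i, StrongCont (g i) := fun i v =>
    continuous_of_isRightPolynomial μ ((hg_poly i).map G.subtype) v (hg_meas i v)
  have hA : ∀ m, A m = ((∏ i, act hG (g i m) (⟨f i, hf i⟩ : BddFun 𝕜 ν) : BddFun 𝕜 ν) :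
      Lp 𝕜 2 ν) := fun m =>
    Subtype.ext (BddFun.toAE_prod Finset.univ fun i => act hG (g i m) ⟨f i, hf i⟩).symm
  have hAcont : Continuous A := by
    rw [funext hA]
    exact (Nice.prod Finset.univ fun i _ => Nice.act hG (hcont i) (Nice.const _)).cont
  obtain ⟨L, hL⟩ := exists_tendsto_integral (μ := μ) hG hg_poly hcont fun i =>
    (⟨f i, hf i⟩ : BddFun 𝕜 ν)
  simp only [← hA, FolnerSet.integral_prob] at hL
  clear_value A
  refine ⟨L, fun ι _ _ _ F hF => ⟨fun α =>
    hAcont.continuousOn.integrableOn_compact (hF.isCompact α), ?_⟩⟩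
  have h := hL.comp hF.tendsto
  exact h
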